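/- Let $d\in\{2,3\}$ and let $\Omega\subset\mathbb R^d$ be a bounded domain with connected Lipschitz boundary. Then there is a constant $C=C(\Omega)>0$ with the following property. Let $D\subset\Omega$ be a domain with connected boundary of class $C^{2,\alpha}$ for some $\alpha\in(0,1]$, with $\operatorname{dist}(D,\partial\Omega)>0$ and $\Omega\setminus\overline D$ connected. Write $e(u)=\frac12(\nabla u+\nabla u^T)$ and $\sigma(u,p)=2e(u)-pI$. Let $g$ be a vector field on $\partial\Omega$, let $(u_0,p_0)\in H^1(\Omega)^d\times L^2(\Omega)$ be a weak solution of $$-\operatorname{div}\sigma(u_0,p_0)=0,\quad \operatorname{div}u_0=0\ \text{ in }\Omega,\qquad u_0=g\ \text{ on }\partial\Omega,$$ and let $(u,p)\in H^1(\Omega\setminus\overline D)^d\times L^2(\Omega\setminus\overline D)$ be a weak solution of $$-\operatorname{div}\sigma(u,p)=0,\quad \operatorname{div}u=0\ \text{ in }\Omega\setminus\overline D,\qquad u=g\ \text{ on }\partial\Omega,\quad u=0\ \text{ on }\partial D,$$ the boundary conditions being understood in the sense of traces. Put $$W_0=\int_{\partial\Omega}(\sigma(u_0,p_0)n)\cdot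 g,\qquad W=\int_{\partial\Omega}(\sigma(u,p)n)\cdot g .$$ Then $$\int_D|\nabla u_0|^2\le C\,(W-W_0)\qquad\text{and}\qquad W-W_0=\int_{\partial D}u_0\cdot\sigma(u,p)n ,$$ where $n$ is the exterior unit normal to $\partial\Omega$ and to $\partial D$, respectively. Here the three boundary integrals are read (i) in general as duality pairings between $H^{-1/2}$ and $H^{1/2}$, $\sigma n$ being the weak normal trace of a divergence free $\sigma\in L^2$; and (ii) whenever $\sigma(u_0,p_0)$ and $\sigma(u,p)$ belong to $H^1$ (in particular if $(u_0,p_0)$ and $(u,p)$ are in $H^2\times H^1$), also as surface integrals of the traces. The assertion holds in both readings, with the same $C$. -/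

import Mathlib

open MeasureTheory Set Filter Topology
open scoped ContDiff

/-! ### Domains -/

/-- The space `ℝ^d` with `d = n + 1` and its Euclidean norm. -/
abbrev Space (n : ℕ) := EuclideanSpace ℝ (Fin (n + 1))

/-- `x ↦ x' = (x_1, …, x_{d-1})`. -/
noncomputable def tangentialPart {n : ℕ} (y : Space n) : EuclideanSpace ℝ (Fin n) :=
  WithLp.toLp 2 (fun i : Fin n => y i.castSucc)

/-- `φ` is of class `C^{k,α}` on the ball `B'_ρ(0)`, with `φ(0) = 0`, with `∇φ(0) = 0` if `k ≥ 1`,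
and with `∑_{i ≤ k} ρ^i ‖D^i φ‖_∞ + ρ^{k+α} |D^k φ|_α ≤ M ρ`.
The numbers `b i` and `h` bound the sup norms and the Hölder seminorm. -/
structure IsBoundaryGraph {n : ℕ} (k : ℕ) (α ρ M : ℝ) (φ : EuclideanSpace ℝ (Fin n) → ℝ) :
    Prop where
  contDiffOn : ContDiffOn ℝ k φ (Metric.ball 0 ρ)
  zero : φ 0 = 0
  fderiv_zero : 1 ≤ k → fderiv ℝ φ 0 = 0
  norm_le : ∃ (b : ℕ → ℝ) (h : ℝ),
    (∀ i ≤ k, ∀ x ∈ Metric.ball (0 : EuclideanSpace ℝ (Fin n)) ρ,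
      ‖iteratedFDeriv ℝ i φ x‖ ≤ b i) ∧
    (∀ x ∈ Metric.ball (0 : EuclideanSpace ℝ (Fin n)) ρ,
      ∀ y ∈ Metric.ball (0 : EuclideanSpace ℝ (Fin n)) ρ,
        ‖iteratedFDeriv ℝ k φ x - iteratedFDeriv ℝ k φ y‖ ≤ h * ‖x - y‖ ^ α) ∧
    (∑ i ∈ Finset.range (k + 1), ρ ^ i * b i) + ρ ^ ((k : ℝ) + α) * h ≤ M * ρ

/-- `A` is a bounded domain (open, connected, nonempty) of `ℝ^d` whose boundary is of class
`C^{k,α}` with constants `ρ, M`: near every boundary point, in suitable rigid coordinates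
`y ↦ x₀ + R y`, the set `A ∩ B_ρ(x₀)` is `{y ∈ B_ρ(0) : y_d > φ(y')}`.
The case `k = 0`, `α = 1` is that of a Lipschitz boundary. -/
structure IsDomainOfClass {n : ℕ} (k : ℕ) (α ρ M : ℝ) (A : Set (Space n)) : Prop where
  isOpen : IsOpen A
  isConnected : IsConnected A
  isBounded : Bornology.IsBounded A
  rho_pos : 0 < ρ
  const_pos : 0 < M
  graph : ∀ x₀ ∈ frontier A,
    ∃ (R : Space n ≃ₗᵢ[ℝ] Space n) (φ : EuclideanSpace ℝ (Fin n) → ℝ),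
      IsBoundaryGraph k α ρ M φ ∧
      ∀ y : Space n, ‖y‖ < ρ → (x₀ + R y ∈ A ↔ φ (tangentialPart y) < y (Fin.last n))

/-- The assumption on the cavity `D`: it is a domain of class `C^{2,α}` for some `α ∈ (0,1]`, with
connected boundary, contained in `Ω` at positive distance from `∂Ω`, and `Ω \ closure D` is
connected. -/
structure IsCavity {n : ℕ} (Ω D : Set (Space n)) : Prop where
  subset : D ⊆ Ω
  connected_compl : IsConnected (Ω \ closure D)
  dist_pos : ∃ d₀ : ℝ, 0 < d₀ ∧ ∀ x ∈ D, ∀ y ∈ frontier Ω, d₀ ≤ dist x y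
  connected_frontier : IsConnected (frontier D)
  smooth : ∃ α ρ L : ℝ, 0 < α ∧ α ≤ 1 ∧ IsDomainOfClass 2 α ρ L D

/-! ### Surface measure and exterior normal -/

/-- Surface measure on a boundary piece `Γ`: the `(d-1)`-dimensional Hausdorff measure, normalised
so as to be the usual area. -/
noncomputable def surfaceMeasure {n : ℕ} (Γ : Set (Space n)) : Measure (Space n) :=
  (Measure.euclideanHausdorffMeasure n).restrict Γ

/-- `ν` is the exterior unit normal to `A` at the boundary point `x`: up to `o(|y - x|)`, near `x`
the set `A` is the half space `{y : (y - x) · ν < 0}`. There is at most one such `ν`. -/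
def IsOuterNormal {n : ℕ} (A : Set (Space n)) (x ν : Space n) : Prop :=
  ‖ν‖ = 1 ∧ ∀ ε > 0, ∀ᶠ y in 𝓝 x,
    (inner ℝ (y - x) ν < -(ε * ‖y - x‖) → y ∈ A) ∧
    (ε * ‖y - x‖ < inner ℝ (y - x) ν → y ∉ A)

open Classical in
/-- The exterior unit normal field on `∂A`. It exists at almost every point of a Lipschitz
boundary; the value `0` is used elsewhere. -/
noncomputable def outerNormal {n : ℕ} (A : Set (Space n)) (x : Space n) : Space n :=
  if h : ∃ ν, IsOuterNormal A x ν then h.choose else 0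

/-! ### Sobolev functions and traces -/

/-- The classical partial derivative `∂_j φ`. -/
noncomputable def partialDeriv {n : ℕ} (j : Fin (n + 1)) (φ : Space n → ℝ) (x : Space n) : ℝ :=
  fderiv ℝ φ x (EuclideanSpace.single j 1)

/-- `f ∈ H^1(U)` with weak partial derivatives `Df j`. -/
structure MemH1 {n : ℕ} (U : Set (Space n)) (f : Space n → ℝ) (Df : Fin (n + 1) → Space n → ℝ) :
    Prop where
  memLp : MemLp f 2 (volume.restrict U)
  memLp_deriv : ∀ j, MemLp (Df j) 2 (volume.restrict U)
  weak_deriv : ∀ φ : Space n → ℝ, ContDiff ℝ ∞ φ → HasCompactSupport φ → tsupport φ ⊆ U →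
    ∀ j, ∫ x in U, f x * partialDeriv j φ x = -∫ x in U, Df j x * φ x

/-- `f ∈ H^1(U)` and `h ∈ L²(Γ)` is the trace of `f` on the closed part `Γ` of the boundary of `U`:
some smooth functions converge to `f` in `H^1(U)` while their restrictions to `Γ` converge to `h`
in `L²(Γ)`. -/
def HasTrace {n : ℕ} (U Γ : Set (Space n)) (f h : Space n → ℝ) : Prop :=
  ∃ Df : Fin (n + 1) → Space n → ℝ, MemH1 U f Df ∧ MemLp h 2 (surfaceMeasure Γ) ∧
    ∃ φ : ℕ → Space n → ℝ, (∀ k, ContDiff ℝ ∞ (φ k)) ∧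
      Tendsto (fun k => eLpNorm (fun x => φ k x - f x) 2 (volume.restrict U)) atTop (𝓝 0) ∧
      (∀ j, Tendsto (fun k => eLpNorm (fun x => partialDeriv j (φ k) x - Df j x) 2
        (volume.restrict U)) atTop (𝓝 0)) ∧
      Tendsto (fun k => eLpNorm (fun x => φ k x - h x) 2 (surfaceMeasure Γ)) atTop (𝓝 0)

/-! ### The Stokes system (viscosity `1`) -/

/-- The stress `σ(u,p) = 2 e(u) - p I = ∇u + ∇uᵀ - p I`, where `Du x i j = ∂_j u_i (x)`. -/
def stress {n : ℕ} (Du : Space n → Matrix (Fin (n + 1)) (Fin (n + 1)) ℝ) (p : Space n → ℝ)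
    (x : Space n) : Matrix (Fin (n + 1)) (Fin (n + 1)) ℝ :=
  Du x + (Du x).transpose - p x • (1 : Matrix (Fin (n + 1)) (Fin (n + 1)) ℝ)

/-- `(u,p) ∈ H^1(U)^d × L²(U)` is a weak solution of `-div σ(u,p) = 0`, `div u = 0` in `U`, where
`Du` is the weak gradient of `u`. The test fields `v` run through `H^1_0(U)^d`. -/
structure IsStokesSolution {n : ℕ} (U : Set (Space n)) (u : Space n → Space n)
    (Du : Space n → Matrix (Fin (n + 1)) (Fin (n + 1)) ℝ) (p : Space n → ℝ) : Prop where
  memH1 : ∀ i, MemH1 U (fun x => u x i) (fun j x => Du x i j)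
  memLp_pressure : MemLp p 2 (volume.restrict U)
  div_free : ∀ᵐ x ∂(volume.restrict U), (Du x).trace = 0
  momentum : ∀ (v : Space n → Space n) (Dv : Space n → Matrix (Fin (n + 1)) (Fin (n + 1)) ℝ),
    (∀ i, MemH1 U (fun x => v x i) (fun j x => Dv x i j)) →
    (∀ i, HasTrace U (frontier U) (fun x => v x i) (fun _ => 0)) →
    ∫ x in U, ∑ i, ∑ j, stress Du p x i j * Dv x i j = 0

/-- The vector field `u` on `U` has the boundary values `g` on `Γ`, in the sense of traces. -/
def HasBoundaryValues {n : ℕ} (U Γ : Set (Space n)) (u g : Space n → Space n) : Prop :=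
  ∀ i, HasTrace U Γ (fun x => u x i) (fun x => g x i)

/-- The matrix field `σ` on `U` belongs to `H^1(U)^{d×d}` and has the trace `T` on `Γ`. -/
def HasMatrixTrace {n : ℕ} (U Γ : Set (Space n))
    (σ T : Space n → Matrix (Fin (n + 1)) (Fin (n + 1)) ℝ) : Prop :=
  ∀ i j, HasTrace U Γ (fun x => σ x i j) (fun x => T x i j)

/-- The surface integral `∫_{∂A} (T n) · g`, with `n` the exterior unit normal to `∂A`. -/
noncomputable def tractionIntegral {n : ℕ} (A : Set (Space n))
    (T : Space n → Matrix (Fin (n + 1)) (Fin (n + 1)) ℝ) (g : Space n → Space n) : ℝ :=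
  ∫ x, ∑ i, (∑ j, T x i j * outerNormal A x j) * g x i ∂(surfaceMeasure (frontier A))

/-- `c` is the duality pairing `⟨σ n_U, v⟩` on the part `Γ` of `∂U` between `H^{-1/2}` and
`H^{1/2}`, for a divergence free `σ ∈ L²(U)^{d×d}` and `v ∈ H^1(U)^d` with gradient `Dv`, where
`n_U` is exterior to `U`. By definition of the weak normal trace this is `∫_U σ · ∇(χ v)`, where
`χ` is a smooth cut-off that is `1` near `Γ` and `0` near the rest of `∂U`. -/
def IsTractionPairing {n : ℕ} (U Γ : Set (Space n))
    (σ : Space n → Matrix (Fin (n + 1)) (Fin (n + 1)) ℝ) (v : Space n → Space n)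
    (Dv : Space n → Matrix (Fin (n + 1)) (Fin (n + 1)) ℝ) (c : ℝ) : Prop :=
  ∃ χ : Space n → ℝ, ContDiff ℝ ∞ χ ∧
    (∀ᶠ x in 𝓝ˢ Γ, χ x = 1) ∧ (∀ᶠ x in 𝓝ˢ (frontier U \ Γ), χ x = 0) ∧
    c = ∫ x in U, ∑ i, ∑ j, σ x i j * (χ x * Dv x i j + v x i * partialDeriv j χ x)

/-! Let `U = Ω \ closure D`, extend `u` by zero to a field ũ on `Ω`, and put w = ũ - u₀. Since `u`
vanishes on `∂D` and agrees with `u₀` on `∂Ω`, the field w is divergence free with zero trace on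
`∂Ω`, and ∇w = -∇u₀ on `D`. The pressure does no work on divergence free fields, so W₀ = 2∫_Ω
|e(u₀)|² and W = 2∫_U |e(u)|². Testing the equation of u₀ with w gives 2∫_Ω e(u₀) : e(w) = 0, and
Pythagoras yields W - W₀ = 2∫_Ω |e(w)|² = ∫_Ω |∇w|² + ∫_Ω ∇w : ∇wᵀ. For a field with zero trace the
last integral is ∫ (div w)² ≥ 0, which is Korn's inequality. Hence W - W₀ ≥ ∫_Ω |∇w|² ≥ ∫_D |∇u₀|²,
and the constant is 1. Testing the equation of `u` with (1 - χ)u₀ - u, where χ is 1 near `∂D` and 0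
near `∂Ω`, shows that the pairing on `∂D` is W - 2∫_U e(u) : e(u₀), which is W - W₀ by the
orthogonality above. This computation is `IsHolePair.energy_estimate`.

The analytic work is to justify it when traces are `L²` limits of restrictions of smooth functions.
That w is a legitimate test field is `IsHolePair.exists_isH1Limit_sub`; it rests on extension by
zero (`IsGreenPair.memH1_indicator`) followed by mollification (`MemH1.exists_isH1Limit_univ`). The
sign in Korn's inequality is `integral_sum_deriv_mul_deriv_nonneg`.

Both extension by zero and the reading as surface integrals need Green's formula with Hausdorff
measure on the boundary. It is derived from the area formula for Lipschitz graphs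
(`hausdorff_graph_eq`), the fundamental theorem of calculus in sheared coordinates
(`integral_epigraph_fderiv`), and a partition of unity
(`HasLipschitzBoundary.integral_partialDeriv`). When the stress is in `H¹`, its row divergences
vanish almost everywhere, and Green's formula turns the duality pairing into the surface integral
(`IsStokesSolution.isTractionPairing_integral`). -/

/-! ### The splitting `ℝ^d = ℝ^{d-1} × ℝ` -/

/-- The point of `ℝ^d` with given tangential part and last coordinate. -/
noncomputable def snocPoint {n : ℕ} (x : EuclideanSpace ℝ (Fin n)) (t : ℝ) : Space n :=
  WithLp.toLp 2 (Fin.snoc (α := fun _ => ℝ) (fun i => x i) t)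

@[simp] lemma snocPoint_castSucc {n : ℕ} (x : EuclideanSpace ℝ (Fin n)) (t : ℝ) (i : Fin n) :
    snocPoint x t i.castSucc = x i := by simp [snocPoint]

@[simp] lemma snocPoint_last {n : ℕ} (x : EuclideanSpace ℝ (Fin n)) (t : ℝ) :
    snocPoint x t (Fin.last n) = t := by simp [snocPoint]

@[simp] lemma tangentialPart_snocPoint {n : ℕ} (x : EuclideanSpace ℝ (Fin n)) (t : ℝ) :
    tangentialPart (snocPoint x t) = x := by
  ext i; simp [tangentialPart]

@[simp] lemma tangentialPart_apply {n : ℕ} (y : Space n) (i : Fin n) :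
    tangentialPart y i = y i.castSucc := rfl

@[simp] lemma snocPoint_tangentialPart {n : ℕ} (y : Space n) :
    snocPoint (tangentialPart y) (y (Fin.last n)) = y := by
  ext i
  refine Fin.lastCases ?_ (fun i => ?_) i <;> simp

lemma norm_sq_split {n : ℕ} (y : Space n) :
    ‖y‖ ^ 2 = ‖tangentialPart y‖ ^ 2 + y (Fin.last n) ^ 2 := by
  simp [EuclideanSpace.norm_sq_eq, Fin.sum_univ_castSucc]

lemma inner_split {n : ℕ} (y z : Space n) :
    inner ℝ y z = inner ℝ (tangentialPart y) (tangentialPart z)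
      + y (Fin.last n) * z (Fin.last n) := by
  simp [PiLp.inner_apply, Fin.sum_univ_castSucc, mul_comm]

lemma norm_tangentialPart_le {n : ℕ} (y : Space n) : ‖tangentialPart y‖ ≤ ‖y‖ := by
  have h := norm_sq_split y
  exact le_of_sq_le_sq (by nlinarith [sq_nonneg (y (Fin.last n))]) (norm_nonneg y)

lemma norm_snocPoint_sq {n : ℕ} (x : EuclideanSpace ℝ (Fin n)) (t : ℝ) :
    ‖snocPoint x t‖ ^ 2 = ‖x‖ ^ 2 + t ^ 2 := by
  rw [norm_sq_split]; simp

lemma snocPoint_add {n : ℕ} (x y : EuclideanSpace ℝ (Fin n)) (s t : ℝ) :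
    snocPoint (x + y) (s + t) = snocPoint x s + snocPoint y t := by
  ext i
  refine Fin.lastCases ?_ (fun i => ?_) i <;> simp

lemma snocPoint_smul {n : ℕ} (c : ℝ) (x : EuclideanSpace ℝ (Fin n)) (t : ℝ) :
    snocPoint (c • x) (c * t) = c • snocPoint x t := by
  ext i
  refine Fin.lastCases ?_ (fun i => ?_) i <;> simp

lemma snocPoint_sub {n : ℕ} (x y : EuclideanSpace ℝ (Fin n)) (s t : ℝ) :
    snocPoint (x - y) (s - t) = snocPoint x s - snocPoint y t := by
  ext i
  refine Fin.lastCases ?_ (fun i => ?_) i <;> simp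

/-- `tangentialPart` as a continuous linear map. -/
noncomputable def tangentialPartL (n : ℕ) : Space n →L[ℝ] EuclideanSpace ℝ (Fin n) :=
  LinearMap.mkContinuous
    { toFun := tangentialPart
      map_add' := fun x y => by ext i; simp
      map_smul' := fun c x => by ext i; simp } 1 (fun y => by simpa using norm_tangentialPart_le y)

@[simp] lemma tangentialPartL_apply {n : ℕ} (y : Space n) :
    tangentialPartL n y = tangentialPart y := rfl

lemma continuous_tangentialPart {n : ℕ} : Continuous (tangentialPart (n := n)) :=
  (tangentialPartL n).continuous

/-- `snocPoint` as a continuous linear map. -/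
noncomputable def snocPointL (n : ℕ) : EuclideanSpace ℝ (Fin n) × ℝ →L[ℝ] Space n :=
  LinearMap.toContinuousLinearMap
    { toFun := fun z => snocPoint z.1 z.2
      map_add' := fun x y => by simp [snocPoint_add]
      map_smul' := fun c x => by simp [snocPoint_smul] }

@[simp] lemma snocPointL_apply {n : ℕ} (z : EuclideanSpace ℝ (Fin n) × ℝ) :
    snocPointL n z = snocPoint z.1 z.2 := rfl

lemma continuous_snocPoint {n : ℕ} :
    Continuous (fun z : EuclideanSpace ℝ (Fin n) × ℝ => snocPoint z.1 z.2) :=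
  (snocPointL n).continuous

/-- `ℝ^d` and `ℝ^{d-1} × ℝ` are isomorphic as measurable spaces. -/
noncomputable def snocEquiv (n : ℕ) : EuclideanSpace ℝ (Fin n) × ℝ ≃ᵐ Space n where
  toFun z := snocPoint z.1 z.2
  invFun y := (tangentialPart y, y (Fin.last n))
  left_inv z := by simp
  right_inv y := by simp
  measurable_toFun := continuous_snocPoint.measurable
  measurable_invFun := by
    refine Measurable.prodMk continuous_tangentialPart.measurable ?_
    exact (Continuous.measurable (by fun_prop))

lemma measurePreserving_snocEquiv (n : ℕ) : MeasurePreserving (snocEquiv n) volume volume := by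
  have h1 := (volume_preserving_piFinSuccAbove (fun _ : Fin (n + 1) => ℝ) (Fin.last n)).symm
  have h2 : MeasurePreserving (fun z : EuclideanSpace ℝ (Fin n) × ℝ =>
      (z.2, (WithLp.ofLp z.1 : Fin n → ℝ))) volume volume := by
    have h3 : MeasurePreserving (fun z : EuclideanSpace ℝ (Fin n) × ℝ => (z.2, z.1))
        volume volume := Measure.measurePreserving_swap
    have h4 : MeasurePreserving (Prod.map id (WithLp.ofLp : EuclideanSpace ℝ (Fin n) → _))
        ((volume : Measure ℝ).prod volume) (volume.prod volume) :=
      (MeasurePreserving.id _).prod (PiLp.volume_preserving_ofLp (Fin n))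
    exact h4.comp h3
  have h5 := (PiLp.volume_preserving_toLp (Fin (n + 1))).comp (h1.comp h2)
  convert! h5 using 1
  ext z i
  refine Fin.lastCases ?_ (fun i => ?_) i <;>
    simp [snocEquiv, MeasurableEquiv.piFinSuccAbove, Fin.insertNthEquiv]

/-! ### The area formula for Lipschitz graphs -/

/-- The graph parametrisation `x ↦ (x, φ x)`. -/
noncomputable def graphMap {n : ℕ} (φ : EuclideanSpace ℝ (Fin n) → ℝ)
    (x : EuclideanSpace ℝ (Fin n)) : Space n := snocPoint x (φ x)

lemma graphMap_injective {n : ℕ} (φ : EuclideanSpace ℝ (Fin n) → ℝ) :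
    Function.Injective (graphMap φ) := fun x y h => by
  simpa [graphMap] using congrArg tangentialPart h

lemma continuous_graphMap {n : ℕ} {φ : EuclideanSpace ℝ (Fin n) → ℝ} (h : Continuous φ) :
    Continuous (graphMap φ) :=
  continuous_snocPoint.comp (continuous_id.prodMk h)

lemma measurableEmbedding_graphMap {n : ℕ} {φ : EuclideanSpace ℝ (Fin n) → ℝ}
    (h : Continuous φ) : MeasurableEmbedding (graphMap φ) :=
  (continuous_graphMap h).measurableEmbedding (graphMap_injective φ)

/-- The area density of a graph with derivative `A`. -/
noncomputable def areaDensity {E : Type*} [NormedAddCommGroup E] [NormedSpace ℝ E]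
    (A : E →L[ℝ] ℝ) : ℝ := √(1 + ‖A‖ ^ 2)

lemma one_le_areaDensity {E : Type*} [NormedAddCommGroup E] [NormedSpace ℝ E]
    (A : E →L[ℝ] ℝ) : 1 ≤ areaDensity A := by
  rw [areaDensity, Real.one_le_sqrt]; nlinarith [sq_nonneg ‖A‖]

lemma areaDensity_sq {E : Type*} [NormedAddCommGroup E] [NormedSpace ℝ E]
    (A : E →L[ℝ] ℝ) : areaDensity A ^ 2 = 1 + ‖A‖ ^ 2 := Real.sq_sqrt (by positivity)

/-- The map t ↦ √(1 + t²) is 1-Lipschitz, so the densities differ by at most `δ`; as the density of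
`B` is at least 1, this additive error is also a relative one. -/
lemma areaDensity_le {E : Type*} [NormedAddCommGroup E] [NormedSpace ℝ E]
    {A B : E →L[ℝ] ℝ} {δ : ℝ} (h : ‖A - B‖ ≤ δ) : areaDensity A ≤ (1 + δ) * areaDensity B := by
  have h1 := one_le_areaDensity B
  have hδ : 0 ≤ δ := (norm_nonneg _).trans h
  have h2 : ‖A‖ ≤ ‖B‖ + δ := by
    have := norm_le_norm_add_norm_sub' A B; linarith
  have h3 := areaDensity_sq B
  have h4 : ‖B‖ ≤ areaDensity B := le_of_sq_le_sq (by rw [h3]; linarith) (by linarith)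
  rw [areaDensity, Real.sqrt_le_left (by positivity)]
  have h5 : ‖A‖ ^ 2 ≤ (‖B‖ + δ) ^ 2 := by gcongr
  have h6 : 0 ≤ δ * areaDensity B * (areaDensity B - 1) := by
    apply mul_nonneg (by positivity); linarith
  nlinarith [mul_nonneg hδ (sub_nonneg.2 h4), mul_nonneg hδ (sub_nonneg.2 h1),
    mul_nonneg (mul_nonneg hδ hδ) (sub_nonneg.2 h1), sq_nonneg δ, norm_nonneg B]

/-- A linear graph over `ℝ^n` is isometric to `ℝ^n` in such a way that the parametrisation gets the
determinant `√(1 + ‖A‖²)`. -/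
lemma exists_linearMap_norm_eq_graph {n : ℕ} (A : EuclideanSpace ℝ (Fin n) →L[ℝ] ℝ) :
    ∃ M : EuclideanSpace ℝ (Fin n) →ₗ[ℝ] EuclideanSpace ℝ (Fin n),
      LinearMap.det M = areaDensity A ∧ ∀ x, ‖M x‖ = ‖snocPoint x (A x)‖ := by
  set a := (InnerProductSpace.toDual ℝ (EuclideanSpace ℝ (Fin n))).symm A with ha
  have hA : ∀ x, A x = inner ℝ a x := fun x => by
    rw [ha, InnerProductSpace.toDual_symm_apply]
  have hn : ‖a‖ = ‖A‖ := by rw [ha, LinearIsometryEquiv.norm_map]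
  set s := areaDensity A
  have hs1 : 1 ≤ s := one_le_areaDensity A
  have hs2 : s ^ 2 = 1 + ‖a‖ ^ 2 := by rw [hn]; exact areaDensity_sq A
  have haa : A a = ‖a‖ ^ 2 := by rw [hA, real_inner_self_eq_norm_sq]
  -- For x ↦ x + c A(x) a the squared norm is |x|² + (2c + c²|a|²) A(x)². The choice c = 1/(1 + s)
  -- with s² = 1 + |a|² makes the bracket 1, and the determinant 1 + c|a|² equals s.
  refine ⟨LinearMap.transvection ((1 + s)⁻¹ • A.toLinearMap) a, ?_, fun x => ?_⟩
  · rw [LinearMap.transvection.det]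
    simp only [LinearMap.smul_apply, ContinuousLinearMap.coe_coe, smul_eq_mul, haa]
    field_simp
    linarith
  · have h1 : ‖LinearMap.transvection ((1 + s)⁻¹ • A.toLinearMap) a x‖ ^ 2
        = ‖snocPoint x (A x)‖ ^ 2 := by
      rw [norm_snocPoint_sq, LinearMap.transvection.apply, norm_add_sq_real, norm_smul,
        inner_smul_right]
      simp only [LinearMap.smul_apply, ContinuousLinearMap.coe_coe, smul_eq_mul]
      rw [real_inner_comm, ← hA, mul_pow, Real.norm_eq_abs, sq_abs]
      have : ‖a‖ ^ 2 = s ^ 2 - 1 := by linarith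
      rw [this]
      field_simp
      ring
    exact (sq_eq_sq₀ (norm_nonneg _) (norm_nonneg _)).1 h1

open Measure in
lemma LipschitzOnWith.euclideanHausdorffMeasure_image_le {X Y : Type*} [EMetricSpace X]
    [EMetricSpace Y] [MeasurableSpace X] [BorelSpace X] [MeasurableSpace Y] [BorelSpace Y]
    {K : NNReal} {f : X → Y} {s : Set X} (h : LipschitzOnWith K f s) (d : ℕ) :
    μHE[d] (f '' s) ≤ (K : ENNReal) ^ d * μHE[d] s := by
  simp_rw [euclideanHausdorffMeasure_def, Measure.smul_apply]
  have := h.hausdorffMeasure_image_le (d := d) (by positivity)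
  rw [ENNReal.rpow_natCast] at this
  simp only [ENNReal.smul_def, smul_eq_mul]
  rw [mul_left_comm]
  exact mul_le_mul_right this _

/-- A chord of the graph and the chord of its linear model differ by a vertical vector of length at
most δ|x - y|, and |x - y| is at most the length of the model chord. -/
lemma norm_graphMap_sub {n : ℕ} {φ : EuclideanSpace ℝ (Fin n) → ℝ}
    {A : EuclideanSpace ℝ (Fin n) →L[ℝ] ℝ} {s : Set (EuclideanSpace ℝ (Fin n))} {δ : NNReal}
    (h : ApproximatesLinearOn φ A s δ) {x y : EuclideanSpace ℝ (Fin n)} (hx : x ∈ s) (hy : y ∈ s) :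
    |‖graphMap φ x - graphMap φ y‖ - ‖snocPoint (x - y) (A (x - y))‖|
      ≤ δ * ‖snocPoint (x - y) (A (x - y))‖ := by
  refine (abs_norm_sub_norm_le _ _).trans ?_
  have h1 : graphMap φ x - graphMap φ y - snocPoint (x - y) (A (x - y))
      = snocPoint 0 (φ x - φ y - A (x - y)) := by
    rw [graphMap, graphMap, ← snocPoint_sub, ← snocPoint_sub, sub_self]
  have h2 : ‖snocPoint (0 : EuclideanSpace ℝ (Fin n)) (φ x - φ y - A (x - y))‖
      = ‖φ x - φ y - A (x - y)‖ := by
    rw [← sq_eq_sq₀ (norm_nonneg _) (norm_nonneg _), norm_snocPoint_sq]; simp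
  rw [h1, h2]
  refine (h x hx y hy).trans ?_
  gcongr
  have := norm_tangentialPart_le (snocPoint (x - y) (A (x - y)))
  rwa [tangentialPart_snocPoint] at this

/-- The linear graph is replaced by its isometric copy `M '' s` in the base space, whose volume is
known. Passing from there to the true graph stretches lengths by at most `1 + δ`. -/
lemma hausdorff_graph_le {n : ℕ} {φ : EuclideanSpace ℝ (Fin n) → ℝ}
    {A : EuclideanSpace ℝ (Fin n) →L[ℝ] ℝ} {s : Set (EuclideanSpace ℝ (Fin n))} {δ : NNReal}
    (h : ApproximatesLinearOn φ A s δ) :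
    μHE[n] (graphMap φ '' s) ≤
      ((1 + δ : NNReal) : ENNReal) ^ n * (ENNReal.ofReal (areaDensity A) * volume s) := by
  obtain ⟨M, hdet, hM⟩ := exists_linearMap_norm_eq_graph A
  have hinj : Function.Injective M := by
    rw [← LinearMap.ker_eq_bot, LinearMap.ker_eq_bot']
    intro x hx
    have h1 := hM x
    rw [hx, norm_zero] at h1
    have := norm_snocPoint_sq x (A x)
    rw [← h1] at this
    have : ‖x‖ = 0 := by nlinarith [sq_nonneg ‖x‖, sq_nonneg (A x)]
    simpa using this
  have hvol : volume (M '' s) = ENNReal.ofReal (areaDensity A) * volume s := by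
    rw [Measure.addHaar_image_linearMap, hdet,
      abs_of_nonneg (zero_le_one.trans (one_le_areaDensity A))]
  rw [← hvol, ← EuclideanSpace.euclideanHausdorffMeasure_eq_volume]
  have hlip : LipschitzOnWith (1 + δ) (graphMap φ ∘ Function.invFun M) (M '' s) := by
    rw [lipschitzOnWith_iff_norm_sub_le]
    rintro _ ⟨x, hx, rfl⟩ _ ⟨y, hy, rfl⟩
    simp only [Function.comp, Function.leftInverse_invFun hinj _]
    rw [← map_sub, hM]
    have := (abs_le.1 (norm_graphMap_sub h hx hy)).2
    push_cast
    linarith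
  have h2 := hlip.euclideanHausdorffMeasure_image_le n
  rwa [image_image, show (fun x => (graphMap φ ∘ Function.invFun M) (M x)) = graphMap φ by
    funext x; simp [Function.leftInverse_invFun hinj x]] at h2

/-- The reverse comparison: the projection to the base followed by `M` maps the graph onto `M '' s`
and stretches lengths by at most `(1 - δ)⁻¹`. -/
lemma le_hausdorff_graph {n : ℕ} {φ : EuclideanSpace ℝ (Fin n) → ℝ}
    {A : EuclideanSpace ℝ (Fin n) →L[ℝ] ℝ} {s : Set (EuclideanSpace ℝ (Fin n))} {δ : NNReal}
    (hδ : δ < 1) (h : ApproximatesLinearOn φ A s δ) :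
    ENNReal.ofReal (areaDensity A) * volume s ≤
      (((1 - δ)⁻¹ : NNReal) : ENNReal) ^ n * μHE[n] (graphMap φ '' s) := by
  obtain ⟨M, hdet, hM⟩ := exists_linearMap_norm_eq_graph A
  have hvol : volume (M '' s) = ENNReal.ofReal (areaDensity A) * volume s := by
    rw [Measure.addHaar_image_linearMap, hdet,
      abs_of_nonneg (zero_le_one.trans (one_le_areaDensity A))]
  rw [← hvol, ← EuclideanSpace.euclideanHausdorffMeasure_eq_volume]
  have hlip : LipschitzOnWith (1 - δ)⁻¹ (fun y => M (tangentialPart y)) (graphMap φ '' s) := by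
    rw [lipschitzOnWith_iff_norm_sub_le]
    rintro _ ⟨x, hx, rfl⟩ _ ⟨y, hy, rfl⟩
    simp only [graphMap, tangentialPart_snocPoint]
    rw [← map_sub, hM]
    have := (abs_le.1 (norm_graphMap_sub h hx hy)).1
    have h1 : (0 : ℝ) < 1 - δ := by simpa using hδ
    rw [NNReal.coe_inv, NNReal.coe_sub hδ.le, NNReal.coe_one, ← div_eq_inv_mul, le_div_iff₀ h1]
    simp only [graphMap] at this
    linarith
  have h2 := hlip.euclideanHausdorffMeasure_image_le n
  rwa [image_image, show (fun x => M (tangentialPart (graphMap φ x))) = M by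
    funext x; simp [graphMap]] at h2

lemma ApproximatesLinearOn.norm_fderiv_real_sub_le {n : ℕ} {φ : EuclideanSpace ℝ (Fin n) → ℝ}
    {A : EuclideanSpace ℝ (Fin n) →L[ℝ] ℝ} {s : Set (EuclideanSpace ℝ (Fin n))} {δ : NNReal}
    (h : ApproximatesLinearOn φ A s δ) (hs : MeasurableSet s)
    (f' : EuclideanSpace ℝ (Fin n) → EuclideanSpace ℝ (Fin n) →L[ℝ] ℝ)
    (hf' : ∀ x ∈ s, HasFDerivWithinAt φ (f' x) s x) :
    ∀ᵐ x ∂volume.restrict s, ‖f' x - A‖ ≤ δ := by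
  rcases subsingleton_or_nontrivial (EuclideanSpace ℝ (Fin n)) with _ | _
  · refine Eventually.of_forall fun x => ?_
    rw [Subsingleton.elim (f' x) A]; simp
  -- Multiplication by a unit vector turns `φ` into a map of the space into itself without changing
  -- any norm, so the derivative estimate for such maps applies. A unit vector needs a nontrivial
  -- space; the case `n = 0` was settled above.
  obtain ⟨e, he⟩ := exists_norm_eq (EuclideanSpace ℝ (Fin n)) (zero_le_one)
  have h1 : ApproximatesLinearOn (fun x => φ x • e) (A.smulRight e) s δ := by
    intro x hx y hy
    have : φ x • e - φ y • e - (A.smulRight e) (x - y) = (φ x - φ y - A (x - y)) • e := by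
      simp [sub_smul]
    rw [this, norm_smul, he, mul_one]
    exact h x hx y hy
  filter_upwards [h1.norm_fderiv_sub_le volume hs (fun x => (f' x).smulRight e)
    (fun x hx => (hf' x hx).smul_const e)] with x hx
  have h2 : (f' x).smulRight e - A.smulRight e = (f' x - A).smulRight e := by
    ext1 y; simp [sub_smul]
  have h3 : ‖(f' x - A).smulRight e‖ ≤ δ := by rw [← h2]; exact_mod_cast hx
  rwa [ContinuousLinearMap.norm_smulRight_apply, he, mul_one] at h3

/-- The set is cut into countably many measurable pieces on which `φ` is `δ`-close to a linear map.
On each piece the two one-sided comparisons hold, with the constant density of the linear map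
exchanged for the true one at the cost of another factor `1 + δ`. -/
lemma hausdorff_graph_bounds {n : ℕ} {φ : EuclideanSpace ℝ (Fin n) → ℝ} (hc : Continuous φ)
    {s : Set (EuclideanSpace ℝ (Fin n))} (hs : MeasurableSet s)
    (hf : ∀ x ∈ s, DifferentiableAt ℝ φ x) {δ : NNReal} (h0 : 0 < δ) (hδ : δ < 1) :
    μHE[n] (graphMap φ '' s) ≤ ((1 + δ : NNReal) : ENNReal) ^ n * (((1 + δ : NNReal) : ENNReal) *
      ∫⁻ x in s, ENNReal.ofReal (areaDensity (fderiv ℝ φ x))) ∧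
    ∫⁻ x in s, ENNReal.ofReal (areaDensity (fderiv ℝ φ x)) ≤ ((1 + δ : NNReal) : ENNReal) *
      ((((1 - δ)⁻¹ : NNReal) : ENNReal) ^ n * μHE[n] (graphMap φ '' s)) := by
  obtain ⟨t, A, hd, ht, hst, hA, -⟩ := exists_partition_approximatesLinearOn_of_hasFDerivWithinAt
    φ s (fderiv ℝ φ) (fun x hx => (hf x hx).hasFDerivAt.hasFDerivWithinAt) (fun _ => δ)
    (fun _ => h0.ne')
  have hsu : s = ⋃ k, s ∩ t k := by rw [← inter_iUnion]; exact (inter_eq_left.2 hst).symm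
  have hdis : Pairwise (Function.onFun Disjoint fun k => s ∩ t k) := fun i j hij =>
    (hd hij).mono inter_subset_right inter_subset_right
  have hme : ∀ k, MeasurableSet (s ∩ t k) := fun k => hs.inter (ht k)
  have hG := measurableEmbedding_graphMap hc
  have hH : μHE[n] (graphMap φ '' s) = ∑' k, μHE[n] (graphMap φ '' (s ∩ t k)) := by
    conv_lhs => rw [hsu, image_iUnion]
    refine measure_iUnion (fun i j hij => ?_) fun k => hG.measurableSet_image.2 (hme k)
    exact (disjoint_image_iff (graphMap_injective φ)).2 (hdis hij)
  have hI : ∫⁻ x in s, ENNReal.ofReal (areaDensity (fderiv ℝ φ x))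
      = ∑' k, ∫⁻ x in s ∩ t k, ENNReal.ofReal (areaDensity (fderiv ℝ φ x)) := by
    conv_lhs => rw [hsu]
    exact lintegral_iUnion hme hdis _
  have hae : ∀ k, ∀ᵐ x ∂volume.restrict (s ∩ t k), ‖fderiv ℝ φ x - A k‖ ≤ δ := fun k =>
    (hA k).norm_fderiv_real_sub_le (hme k) _
      fun x hx => (hf x hx.1).hasFDerivAt.hasFDerivWithinAt
  have hcoe : ((1 + δ : NNReal) : ENNReal) = ENNReal.ofReal (1 + δ) := by
    rw [← ENNReal.ofReal_coe_nnreal]; simp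
  constructor
  · rw [hH, hI, ← ENNReal.tsum_mul_left, ← ENNReal.tsum_mul_left]
    refine ENNReal.tsum_le_tsum fun k => (hausdorff_graph_le (hA k)).trans (mul_le_mul_right ?_ _)
    rw [← lintegral_const_mul' _ _ ENNReal.coe_ne_top, ← setLIntegral_const]
    refine lintegral_mono_ae ?_
    filter_upwards [hae k] with x hx
    rw [hcoe, ← ENNReal.ofReal_mul (by positivity)]
    exact ENNReal.ofReal_le_ofReal (areaDensity_le (by rwa [norm_sub_rev]))
  · rw [hH, hI, ← ENNReal.tsum_mul_left, ← ENNReal.tsum_mul_left]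
    refine ENNReal.tsum_le_tsum fun k => ?_
    refine le_trans ?_ (mul_le_mul_right (le_hausdorff_graph hδ (hA k)) _)
    rw [← setLIntegral_const, ← lintegral_const_mul' _ _ ENNReal.coe_ne_top]
    refine lintegral_mono_ae ?_
    filter_upwards [hae k] with x hx
    rw [hcoe, ← ENNReal.ofReal_mul (by positivity)]
    exact ENNReal.ofReal_le_ofReal (areaDensity_le hx)

lemma lipschitzWith_graphMap {n : ℕ} {φ : EuclideanSpace ℝ (Fin n) → ℝ} {K : NNReal}
    (h : LipschitzWith K φ) : LipschitzWith (1 + K) (graphMap φ) := by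
  rw [lipschitzWith_iff_norm_sub_le] at h ⊢
  intro x y
  rw [graphMap, graphMap, ← snocPoint_sub]
  have h1 := norm_snocPoint_sq (x - y) (φ x - φ y)
  refine le_of_sq_le_sq ?_ (by positivity)
  rw [h1]
  have h2 : (φ x - φ y) ^ 2 ≤ (K * ‖x - y‖) ^ 2 := by
    rw [← sq_abs (φ x - φ y)]; gcongr; exact h x y
  push_cast
  nlinarith [mul_nonneg K.coe_nonneg (sq_nonneg ‖x - y‖)]

/-- **Area formula** for Lipschitz graphs, on measurable sets. -/
lemma hausdorff_graph_eq {n : ℕ} {φ : EuclideanSpace ℝ (Fin n) → ℝ} {K : NNReal}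
    (h : LipschitzWith K φ) {s : Set (EuclideanSpace ℝ (Fin n))} (hs : MeasurableSet s) :
    μHE[n] (graphMap φ '' s) = ∫⁻ x in s, ENNReal.ofReal (areaDensity (fderiv ℝ φ x)) := by
  set N := {x | DifferentiableAt ℝ φ x}
  have hN : MeasurableSet N := measurableSet_of_differentiableAt ℝ φ
  -- By Rademacher's theorem. The part of the graph over this null set is negligible too, because
  -- the graph map is Lipschitz.
  have hN0 : volume Nᶜ = 0 := h.ae_differentiableAt (μ := volume)
  have hG0 : μHE[n] (graphMap φ '' Nᶜ) = 0 := by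
    have := ((lipschitzWith_graphMap h).lipschitzOnWith (s := Nᶜ)).euclideanHausdorffMeasure_image_le n
    rw [EuclideanSpace.euclideanHausdorffMeasure_eq_volume, hN0, mul_zero] at this
    exact le_antisymm this (zero_le)
  have h1 : μHE[n] (graphMap φ '' s) = μHE[n] (graphMap φ '' (s ∩ N)) := by
    refine le_antisymm ?_ (measure_mono (image_mono inter_subset_left))
    calc _ ≤ μHE[n] (graphMap φ '' (s ∩ N) ∪ graphMap φ '' Nᶜ) := by
          refine measure_mono ?_
          rw [← image_union]
          refine image_mono fun x hx => ?_
          by_cases hxN : x ∈ N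
          · exact Or.inl ⟨hx, hxN⟩
          · exact Or.inr hxN
      _ ≤ _ := (measure_union_le _ _).trans (by rw [hG0, add_zero])
  have h2 : ∫⁻ x in s, ENNReal.ofReal (areaDensity (fderiv ℝ φ x))
      = ∫⁻ x in s ∩ N, ENNReal.ofReal (areaDensity (fderiv ℝ φ x)) := by
    refine setLIntegral_congr ?_
    refine (inter_ae_eq_left_of_ae_eq_univ ?_).symm
    rwa [ae_eq_univ]
  rw [h1, h2]
  set a := μHE[n] (graphMap φ '' (s ∩ N))
  set b := ∫⁻ x in s ∩ N, ENNReal.ofReal (areaDensity (fderiv ℝ φ x))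
  have hb := fun {δ : NNReal} => hausdorff_graph_bounds h.continuous (hs.inter hN)
    (fun x hx => hx.2) (δ := δ)
  have hev : ∀ᶠ δ : NNReal in 𝓝[>] 0, 0 < δ ∧ δ < 1 :=
    inter_mem self_mem_nhdsWithin (mem_nhdsWithin_of_mem_nhds (Iio_mem_nhds one_pos))
  have ht1 : Tendsto (fun δ : NNReal => ((1 + δ : NNReal) : ENNReal)) (𝓝[>] 0) (𝓝 1) := by
    refine tendsto_nhdsWithin_of_tendsto_nhds ?_
    have : Continuous fun δ : NNReal => ((1 + δ : NNReal) : ENNReal) := by fun_prop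
    simpa using this.tendsto 0
  have ht2 : Tendsto (fun δ : NNReal => (((1 - δ)⁻¹ : NNReal) : ENNReal)) (𝓝[>] 0) (𝓝 1) := by
    refine tendsto_nhdsWithin_of_tendsto_nhds ?_
    rw [← ENNReal.coe_one, ENNReal.tendsto_coe]
    have : ContinuousAt (fun δ : NNReal => (1 - δ)⁻¹) 0 := by
      refine ContinuousAt.inv₀ ?_ (by simp)
      fun_prop
    simpa using this.tendsto
  have hmul : ∀ {f : NNReal → ENNReal} {c : ENNReal} {l : Filter NNReal}, Tendsto f l (𝓝 1) →
      Tendsto (fun δ => f δ * c) l (𝓝 c) := fun {f c l} hf => by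
    have := ENNReal.Tendsto.mul_const hf (b := c) (Or.inl one_ne_zero)
    simpa using this
  -- Both factors in the two-sided bounds tend to 1 as `δ → 0`.
  apply le_antisymm
  · have hl : Tendsto (fun δ : NNReal => ((1 + δ : NNReal) : ENNReal) ^ n *
        (((1 + δ : NNReal) : ENNReal) * b)) (𝓝[>] 0) (𝓝 b) := by
      have := hmul (c := b) (f := fun δ : NNReal => ((1 + δ : NNReal) : ENNReal) ^ n *
        ((1 + δ : NNReal) : ENNReal)) (l := 𝓝[>] 0) (by
          simpa using! ENNReal.Tendsto.mul (ENNReal.Tendsto.pow (n := n) ht1) (by simp) ht1 (by simp))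
      simpa [mul_assoc] using this
    exact ge_of_tendsto hl (hev.mono fun δ hδ => (hb hδ.1 hδ.2).1)
  · have hl : Tendsto (fun δ : NNReal => ((1 + δ : NNReal) : ENNReal) *
        ((((1 - δ)⁻¹ : NNReal) : ENNReal) ^ n * a)) (𝓝[>] 0) (𝓝 a) := by
      have := hmul (c := a) (f := fun δ : NNReal => ((1 + δ : NNReal) : ENNReal) *
        (((1 - δ)⁻¹ : NNReal) : ENNReal) ^ n) (l := 𝓝[>] 0) (by
          simpa using! ENNReal.Tendsto.mul ht1 (by simp) (ENNReal.Tendsto.pow (n := n) ht2) (by simp))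
      simpa [mul_assoc] using this
    exact ge_of_tendsto hl (hev.mono fun δ hδ => (hb hδ.1 hδ.2).2)

/-- **Area formula** for Lipschitz graphs, as an identity of measures. -/
lemma map_graphMap_withDensity {n : ℕ} {φ : EuclideanSpace ℝ (Fin n) → ℝ} {K : NNReal}
    (h : LipschitzWith K φ) :
    (volume.withDensity fun x => ENNReal.ofReal (areaDensity (fderiv ℝ φ x))).map (graphMap φ)
      = (Measure.euclideanHausdorffMeasure n).restrict (range (graphMap φ)) := by
  have hG := measurableEmbedding_graphMap h.continuous
  rw [← hG.map_comap]
  congr 1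
  ext s hs
  rw [hG.comap_apply, withDensity_apply _ hs, hausdorff_graph_eq h hs]

/-! ### The divergence theorem on an epigraph -/

/-- The coordinates `(x, t) ↦ (x, φ x + t)` that straighten the graph of `φ`. -/
noncomputable def shearMap {n : ℕ} (φ : EuclideanSpace ℝ (Fin n) → ℝ)
    (z : EuclideanSpace ℝ (Fin n) × ℝ) : Space n := snocPoint z.1 (φ z.1 + z.2)

lemma continuous_shearMap {n : ℕ} {φ : EuclideanSpace ℝ (Fin n) → ℝ} (h : Continuous φ) :
    Continuous (shearMap φ) :=
  continuous_snocPoint.comp (continuous_fst.prodMk ((h.comp continuous_fst).add continuous_snd))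

lemma shearMap_injective {n : ℕ} (φ : EuclideanSpace ℝ (Fin n) → ℝ) :
    Function.Injective (shearMap φ) := fun x y h => by
  have h1 : x.1 = y.1 := by simpa [shearMap] using congrArg tangentialPart h
  have h2 : φ x.1 + x.2 = φ y.1 + y.2 := by
    simpa [shearMap] using congrArg (fun y : Space n => y (Fin.last n)) h
  exact Prod.ext h1 (by rw [h1] at h2; linarith)

/-- The shear translates each vertical line by a constant, so Fubini's theorem applies; Lipschitz
regularity is not needed. -/
lemma measurePreserving_shearMap {n : ℕ} {φ : EuclideanSpace ℝ (Fin n) → ℝ} (h : Continuous φ) :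
    MeasurePreserving (shearMap φ) volume volume := by
  have h1 : MeasurePreserving (fun z : EuclideanSpace ℝ (Fin n) × ℝ => (id z.1, φ z.1 + z.2))
      (volume.prod volume) (volume.prod volume) :=
    (MeasurePreserving.id _).skew_product
      (g := fun x t => φ x + t)
      (((h.comp continuous_fst).add continuous_snd).measurable)
      (Eventually.of_forall fun x => map_add_left_eq_self volume (φ x))
  exact (measurePreserving_snocEquiv n).comp h1

/-- In sheared coordinates the derivative along `v` splits into `a`, a derivative along the
translated graph through the point, and `b`, a vertical derivative. The first integrates to zero
over each translated graph; the second is evaluated by the fundamental theorem of calculus and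
leaves only the value on the graph itself. -/
lemma integral_epigraph_fderiv {n : ℕ} {φ : EuclideanSpace ℝ (Fin n) → ℝ} {K : NNReal}
    (h : LipschitzWith K φ) {ψ : Space n → ℝ} (hψ : ContDiff ℝ 1 ψ) (hc : HasCompactSupport ψ)
    (v : Space n) :
    ∫ y in {y : Space n | φ (tangentialPart y) < y (Fin.last n)}, fderiv ℝ ψ y v
      = ∫ x, ψ (graphMap φ x) * (fderiv ℝ φ x (tangentialPart v) - v (Fin.last n)) := by
  have hS := measurePreserving_shearMap h.continuous
  have hSc := continuous_shearMap h.continuous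
  have hSe : MeasurableEmbedding (shearMap φ) := hSc.measurableEmbedding (shearMap_injective φ)
  have hpre : shearMap φ ⁻¹' {y : Space n | φ (tangentialPart y) < y (Fin.last n)}
      = univ ×ˢ Ioi 0 := by
    ext z; simp [shearMap]
  have hdc : Continuous (fderiv ℝ ψ) := hψ.continuous_fderiv one_ne_zero
  have hgi : ∀ w : Space n, Integrable (fun z => fderiv ℝ ψ (shearMap φ z) w)
      (volume : Measure (EuclideanSpace ℝ (Fin n) × ℝ)) := fun w => by
    have : Integrable (fun y => fderiv ℝ ψ y w) volume :=
      (hdc.clm_apply continuous_const).integrable_of_hasCompactSupport (hc.fderiv_apply ℝ w)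
    exact (hS.integrable_comp_emb hSe).2 this
  set v' := tangentialPart v
  set e : Space n := snocPoint 0 1
  set m : EuclideanSpace ℝ (Fin n) → ℝ := fun x => fderiv ℝ φ x v'
  have hmm : Measurable m := measurable_fderiv_apply_const ℝ φ v'
  have hmb : ∀ x, ‖m x‖ ≤ K * ‖v'‖ := fun x =>
    ((fderiv ℝ φ x).le_opNorm v').trans (by gcongr; exact norm_fderiv_le_of_lipschitz ℝ h)
  set a : EuclideanSpace ℝ (Fin n) × ℝ → ℝ :=
    fun z => fderiv ℝ ψ (shearMap φ z) (snocPoint v' 0) + m z.1 * fderiv ℝ ψ (shearMap φ z) e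
  set b : EuclideanSpace ℝ (Fin n) × ℝ → ℝ :=
    fun z => (v (Fin.last n) - m z.1) * fderiv ℝ ψ (shearMap φ z) e
  have hbi : Integrable b volume := by
    refine (hgi e).bdd_mul (c := |v (Fin.last n)| + K * ‖v'‖) ?_ (Eventually.of_forall fun z => ?_)
    · exact ((measurable_const.sub hmm).comp measurable_fst).aestronglyMeasurable
    · exact (norm_sub_le _ _).trans (add_le_add le_rfl (hmb _))
  have hai : Integrable a volume := by
    refine (hgi _).add ((hgi e).bdd_mul (c := K * ‖v'‖) ?_ (Eventually.of_forall fun z => hmb _))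
    exact (hmm.comp measurable_fst).aestronglyMeasurable
  have hab : ∀ z, fderiv ℝ ψ (shearMap φ z) v = a z + b z := fun z => by
    have hv : v = snocPoint v' 0 + v (Fin.last n) • e := by
      rw [← snocPoint_smul, ← snocPoint_add]; simp [v']
    conv_lhs => rw [hv, map_add, map_smul]
    simp only [a, b, smul_eq_mul]; ring
  have hprod : (volume : Measure (EuclideanSpace ℝ (Fin n) × ℝ)).restrict (univ ×ˢ Ioi 0)
      = volume.prod (volume.restrict (Ioi 0)) := by
    rw [Measure.volume_eq_prod, ← Measure.prod_restrict, Measure.restrict_univ]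
  have ha' : Integrable a (volume.prod (volume.restrict (Ioi 0))) := by
    rw [← hprod]; exact hai.restrict
  have hb' : Integrable b (volume.prod (volume.restrict (Ioi 0))) := by
    rw [← hprod]; exact hbi.restrict
  rw [← hS.setIntegral_preimage_emb hSe, hpre, hprod]
  simp_rw [hab]
  rw [integral_add ha' hb', integral_prod_symm _ ha', integral_prod _ hb']
  have hzero : ∀ t, ∫ x, a (x, t) = 0 := fun t => by
    set F : EuclideanSpace ℝ (Fin n) → ℝ := fun x => ψ (snocPoint x (φ x + t))
    obtain ⟨C, hC⟩ := hψ.lipschitzWith_of_hasCompactSupport hc one_ne_zero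
    have h1 : LipschitzWith K fun x => φ x + t := fun x y => by simpa using h x y
    have hF : LipschitzWith (C * (1 + K)) F := hC.comp (lipschitzWith_graphMap h1)
    have hFc : HasCompactSupport F := by
      refine HasCompactSupport.intro (hc.isCompact.image continuous_tangentialPart) fun x hx => ?_
      by_contra h0
      exact hx ⟨_, subset_tsupport _ h0, by simp⟩
    -- Integration by parts against the constant function 1. The function `F` is only Lipschitz, but
    -- has compact support, so the integral of its directional derivative vanishes.
    have h2 := (LipschitzWith.const' (α := EuclideanSpace ℝ (Fin n)) (1 : ℝ)).integral_lineDeriv_mul_eq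
      (μ := volume) (C := 0) hF hFc (-v')
    simp only [neg_neg, mul_one] at h2
    rw [show (∫ x, lineDeriv ℝ (fun _ : EuclideanSpace ℝ (Fin n) => (1 : ℝ)) x (-v') * F x) = 0 by
      simp [lineDeriv]] at h2
    rw [h2]
    refine integral_congr_ae ?_
    filter_upwards [h.ae_differentiableAt (μ := volume)] with x hx
    have h3 : HasFDerivAt (fun x => snocPointL n (x, φ x + t))
        ((snocPointL n).comp ((ContinuousLinearMap.id ℝ _).prod (fderiv ℝ φ x))) x :=
      (snocPointL n).hasFDerivAt.comp x ((hasFDerivAt_id x).prodMk (hx.hasFDerivAt.add_const t))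
    have h4 : HasFDerivAt F _ x :=
      ((hψ.differentiable one_ne_zero) _).hasFDerivAt.comp x h3
    rw [h4.hasLineDerivAt v' |>.lineDeriv]
    simp only [a, shearMap, m, ContinuousLinearMap.comp_apply, ContinuousLinearMap.prod_apply,
      snocPointL_apply, ContinuousLinearMap.id_apply]
    rw [← smul_eq_mul, ← map_smul, ← map_add, ← snocPoint_smul, ← snocPoint_add]
    simp
  have hvert : ∀ x, ∫ t in Ioi 0, b (x, t) = ψ (graphMap φ x) * (m x - v (Fin.last n)) := fun x => by
    simp only [b]
    rw [integral_const_mul]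
    have h1 : ∀ t, HasDerivAt (fun t => ψ (snocPoint x (φ x + t)))
        (fderiv ℝ ψ (shearMap φ (x, t)) e) t := fun t => by
      have h3 : HasDerivAt (fun t => snocPointL n (x, φ x + t)) (snocPointL n (0, 1)) t :=
        (snocPointL n).hasFDerivAt.comp_hasDerivAt t
          ((hasDerivAt_const t x).prodMk ((hasDerivAt_id t).const_add (φ x)))
      exact ((hψ.differentiable one_ne_zero) _).hasFDerivAt.comp_hasDerivAt t h3
    have h2 : ContDiff ℝ 1 (fun t => ψ (snocPoint x (φ x + t))) := by
      have : ContDiff ℝ 1 (fun t : ℝ => snocPointL n (x, φ x + t)) :=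
        (snocPointL n).contDiff.comp (contDiff_const.prodMk (contDiff_const.add contDiff_id))
      exact hψ.comp this
    have h4 : HasCompactSupport (fun t => ψ (snocPoint x (φ x + t))) := by
      refine HasCompactSupport.intro (hc.isCompact.image
        (f := fun y : Space n => y (Fin.last n) - φ x) (by fun_prop)) fun t ht => ?_
      by_contra h0
      exact ht ⟨_, subset_tsupport _ h0, by simp⟩
    have h5 := h4.integral_Ioi_deriv_eq h2 0
    rw [show (∫ t in Ioi 0, fderiv ℝ ψ (shearMap φ (x, t)) e)
      = ∫ t in Ioi 0, deriv (fun t => ψ (snocPoint x (φ x + t))) t by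
        simp_rw [fun t => (h1 t).deriv], h5]
    simp only [graphMap, add_zero]; ring
  simp_rw [hzero, hvert]
  simp [m]

/-! ### Lipschitz charts of the boundary -/

/-- Near `x₀`, in the rigid coordinates `y ↦ x₀ + R y`, the set `A` is the epigraph of the globally
Lipschitz function `φ`. -/
structure IsLipschitzChart {n : ℕ} (A : Set (Space n)) (x₀ : Space n)
    (R : Space n ≃ₗᵢ[ℝ] Space n) (φ : EuclideanSpace ℝ (Fin n) → ℝ) (K : NNReal) (r : ℝ) :
    Prop where
  pos : 0 < r
  lip : LipschitzWith K φ
  mem_iff : ∀ y : Space n, ‖y‖ < r → (x₀ + R y ∈ A ↔ φ (tangentialPart y) < y (Fin.last n))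

/-- Every boundary point of `A` has a Lipschitz chart. -/
def HasLipschitzBoundary {n : ℕ} (A : Set (Space n)) : Prop :=
  ∀ x₀ ∈ frontier A, ∃ R φ K r, IsLipschitzChart A x₀ R φ K r

/-- For `k = 0`, `α = 1` the Hölder seminorm is itself a Lipschitz constant; for `k ≥ 1` the bound
on the first derivative serves, since the ball is convex. -/
lemma IsBoundaryGraph.exists_lipschitzOnWith {n k : ℕ} {α ρ M : ℝ}
    {φ : EuclideanSpace ℝ (Fin n) → ℝ} (h : IsBoundaryGraph k α ρ M φ)
    (hk : (k = 0 ∧ α = 1) ∨ 1 ≤ k) : ∃ K, LipschitzOnWith K φ (Metric.ball 0 ρ) := by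
  obtain ⟨b, c, hb, hc, -⟩ := h.norm_le
  rcases hk with ⟨rfl, rfl⟩ | hk
  · refine ⟨c.toNNReal, lipschitzOnWith_iff_norm_sub_le.2 fun x hx y hy => ?_⟩
    have := hc x hx y hy
    rw [Real.rpow_one, iteratedFDeriv_zero_eq_comp] at this
    simp only [Function.comp_apply] at this
    rw [← map_sub, LinearIsometryEquiv.norm_map] at this
    exact this.trans (by gcongr; exact Real.le_coe_toNNReal c)
  · refine ⟨(b 1).toNNReal, (convex_ball 0 ρ).lipschitzOnWith_of_nnnorm_fderivWithin_le (𝕜 := ℝ)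
      (h.contDiffOn.differentiableOn (by exact_mod_cast (by omega : k ≠ 0))) fun x hx => ?_⟩
    rw [fderivWithin_of_isOpen Metric.isOpen_ball hx, ← NNReal.coe_le_coe, coe_nnnorm,
      ← norm_iteratedFDeriv_one]
    exact (hb 1 hk x hx).trans (Real.le_coe_toNNReal _)

lemma IsDomainOfClass.hasLipschitzBoundary {n k : ℕ} {α ρ M : ℝ} {A : Set (Space n)}
    (h : IsDomainOfClass k α ρ M A) (hk : (k = 0 ∧ α = 1) ∨ 1 ≤ k) : HasLipschitzBoundary A := by
  intro x₀ hx₀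
  obtain ⟨R, φ, hφ, hA⟩ := h.graph x₀ hx₀
  obtain ⟨K, hK⟩ := hφ.exists_lipschitzOnWith hk
  -- Extending `φ` to a globally Lipschitz function does not change the chart: for `‖y‖ < ρ` the
  -- tangential part stays in the ball where both agree.
  obtain ⟨g, hg, he⟩ := hK.extend_real
  refine ⟨R, g, K, ρ, h.rho_pos, hg, fun y hy => ?_⟩
  rw [hA y hy, he]
  simpa using (norm_tangentialPart_le y).trans_lt hy

lemma tangentialPart_sub {n : ℕ} (x y : Space n) :
    tangentialPart (x - y) = tangentialPart x - tangentialPart y := map_sub (tangentialPartL n) x y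

lemma frontier_epigraph {n : ℕ} {φ : EuclideanSpace ℝ (Fin n) → ℝ} (hφ : Continuous φ) :
    frontier {y : Space n | φ (tangentialPart y) < y (Fin.last n)} = range (graphMap φ) := by
  have h1 : Continuous fun y : Space n => φ (tangentialPart y) := hφ.comp continuous_tangentialPart
  have h2 : Continuous fun y : Space n => y (Fin.last n) := by fun_prop
  ext y
  constructor
  · intro hy
    have : φ (tangentialPart y) = y (Fin.last n) := frontier_lt_subset_eq h1 h2 hy
    exact ⟨tangentialPart y, by simp [graphMap, this]⟩
  · rintro ⟨x, rfl⟩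
    rw [frontier, (isOpen_lt h1 h2).interior_eq]
    refine ⟨?_, by simp [graphMap]⟩
    have h3 : Tendsto (fun t : ℝ => snocPoint x (φ x + t)) (𝓝[>] 0) (𝓝 (graphMap φ x)) := by
      have : Continuous fun t : ℝ => snocPoint x (φ x + t) :=
        continuous_snocPoint.comp (continuous_const.prodMk (by fun_prop))
      simpa [graphMap] using (this.tendsto 0).mono_left nhdsWithin_le_nhds
    refine mem_closure_of_tendsto h3 ?_
    filter_upwards [self_mem_nhdsWithin] with t ht
    simpa using ht

/-- The rigid motion `y ↦ x₀ + R y`. -/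
noncomputable def rigidMotion {n : ℕ} (x₀ : Space n) (R : Space n ≃ₗᵢ[ℝ] Space n) :
    Space n ≃ᵢ Space n := R.toIsometryEquiv.trans (IsometryEquiv.addLeft x₀)

@[simp] lemma rigidMotion_apply {n : ℕ} (x₀ : Space n) (R : Space n ≃ₗᵢ[ℝ] Space n) (y : Space n) :
    rigidMotion x₀ R y = x₀ + R y := rfl

lemma measurePreserving_rigidMotion {n : ℕ} (x₀ : Space n) (R : Space n ≃ₗᵢ[ℝ] Space n) :
    MeasurePreserving (rigidMotion x₀ R) volume volume :=
  (measurePreserving_add_left volume x₀).comp R.measurePreserving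

lemma rigidMotion_mem_ball {n : ℕ} {x₀ : Space n} {R : Space n ≃ₗᵢ[ℝ] Space n} {y : Space n}
    {r : ℝ} : rigidMotion x₀ R y ∈ Metric.ball x₀ r ↔ ‖y‖ < r := by
  simp [dist_eq_norm]

/-- The parametrisation of the boundary by a chart. -/
noncomputable def boundaryMap {n : ℕ} (x₀ : Space n) (R : Space n ≃ₗᵢ[ℝ] Space n)
    (φ : EuclideanSpace ℝ (Fin n) → ℝ) (x : EuclideanSpace ℝ (Fin n)) : Space n :=
  rigidMotion x₀ R (graphMap φ x)

lemma measurableEmbedding_boundaryMap {n : ℕ} (x₀ : Space n) (R : Space n ≃ₗᵢ[ℝ] Space n)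
    {φ : EuclideanSpace ℝ (Fin n) → ℝ} (hφ : Continuous φ) :
    MeasurableEmbedding (boundaryMap x₀ R φ) :=
  (rigidMotion x₀ R).toHomeomorph.measurableEmbedding.comp (measurableEmbedding_graphMap hφ)

lemma map_boundaryMap_withDensity {n : ℕ} (x₀ : Space n) (R : Space n ≃ₗᵢ[ℝ] Space n)
    {φ : EuclideanSpace ℝ (Fin n) → ℝ} {K : NNReal} (h : LipschitzWith K φ) :
    (volume.withDensity fun x => ENNReal.ofReal (areaDensity (fderiv ℝ φ x))).map
      (boundaryMap x₀ R φ)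
      = (Measure.euclideanHausdorffMeasure n).restrict (range (boundaryMap x₀ R φ)) := by
  have hT : MeasurableEmbedding (rigidMotion x₀ R) :=
    (rigidMotion x₀ R).toHomeomorph.measurableEmbedding
  have hG := measurableEmbedding_graphMap h.continuous
  have h1 : boundaryMap x₀ R φ = (rigidMotion x₀ R) ∘ graphMap φ := rfl
  rw [h1, ← Measure.map_map hT.measurable hG.measurable, map_graphMap_withDensity h]
  conv_rhs => rw [← ((rigidMotion x₀ R).measurePreserving_euclideanHausdorffMeasure n).map_eq,
    hT.restrict_map, range_comp, (rigidMotion x₀ R).injective.preimage_image]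

/-- The exterior unit normal to the epigraph of `φ`, in the chart. -/
noncomputable def chartNormal {n : ℕ} (R : Space n ≃ₗᵢ[ℝ] Space n)
    (φ : EuclideanSpace ℝ (Fin n) → ℝ) (x : EuclideanSpace ℝ (Fin n)) : Space n :=
  (areaDensity (fderiv ℝ φ x))⁻¹ •
    R (snocPoint ((InnerProductSpace.toDual ℝ (EuclideanSpace ℝ (Fin n))).symm (fderiv ℝ φ x)) (-1))

lemma areaDensity_pos {E : Type*} [NormedAddCommGroup E] [NormedSpace ℝ E]
    (A : E →L[ℝ] ℝ) : 0 < areaDensity A := zero_lt_one.trans_le (one_le_areaDensity A)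

lemma continuous_areaDensity {E : Type*} [NormedAddCommGroup E] [NormedSpace ℝ E] :
    Continuous (areaDensity (E := E)) := by
  unfold areaDensity; fun_prop

/-- Links the boundary term of `integral_epigraph_fderiv` with geometry: its weight is the area
density times the normal component of the direction. -/
lemma inner_chartNormal {n : ℕ} (R : Space n ≃ₗᵢ[ℝ] Space n)
    (φ : EuclideanSpace ℝ (Fin n) → ℝ) (x : EuclideanSpace ℝ (Fin n)) (v : Space n) :
    areaDensity (fderiv ℝ φ x) * inner ℝ (R v) (chartNormal R φ x)
      = fderiv ℝ φ x (tangentialPart v) - v (Fin.last n) := by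
  have h0 := (areaDensity_pos (fderiv ℝ φ x)).ne'
  rw [chartNormal, inner_smul_right, LinearIsometryEquiv.inner_map_map, inner_split,
    tangentialPart_snocPoint, snocPoint_last, real_inner_comm, InnerProductSpace.toDual_symm_apply]
  field_simp
  ring

lemma norm_chartNormal {n : ℕ} (R : Space n ≃ₗᵢ[ℝ] Space n)
    (φ : EuclideanSpace ℝ (Fin n) → ℝ) (x : EuclideanSpace ℝ (Fin n)) :
    ‖chartNormal R φ x‖ = 1 := by
  have h0 := areaDensity_pos (fderiv ℝ φ x)
  rw [chartNormal, norm_smul, LinearIsometryEquiv.norm_map, norm_inv, Real.norm_of_nonneg h0.le]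
  rw [inv_mul_eq_one₀ h0.ne', ← sq_eq_sq₀ h0.le (norm_nonneg _), norm_snocPoint_sq, areaDensity_sq,
    LinearIsometryEquiv.norm_map]
  ring

lemma measurable_chartNormal {n : ℕ} (R : Space n ≃ₗᵢ[ℝ] Space n)
    (φ : EuclideanSpace ℝ (Fin n) → ℝ) : Measurable (chartNormal R φ) := by
  have h1 : Measurable (fderiv ℝ φ) := measurable_fderiv ℝ φ
  refine Measurable.smul (continuous_areaDensity.measurable.comp h1).inv ?_
  have h2 : Measurable fun x => ((InnerProductSpace.toDual ℝ (EuclideanSpace ℝ (Fin n))).symm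
      (fderiv ℝ φ x), (-1 : ℝ)) :=
    (((InnerProductSpace.toDual ℝ (EuclideanSpace ℝ (Fin n))).symm.continuous.measurable.comp
      h1).prodMk measurable_const)
  exact R.continuous.measurable.comp (continuous_snocPoint.measurable.comp h2)

/-- If ν ≠ ν', then d = ν - ν' satisfies d · ν = |d|²/2 and d · ν' = -|d|²/2. A short step from `x`
along d would leave `A` according to ν and enter it according to ν'. -/
lemma IsOuterNormal.unique {n : ℕ} {A : Set (Space n)} {x ν ν' : Space n}
    (h : IsOuterNormal A x ν) (h' : IsOuterNormal A x ν') : ν = ν' := by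
  by_contra hne
  set d := ν - ν'
  have hd : 0 < ‖d‖ := norm_pos_iff.2 (sub_ne_zero.2 hne)
  have h1 : inner ℝ d ν = ‖d‖ ^ 2 / 2 := by
    rw [norm_sub_sq_real, inner_sub_left, real_inner_self_eq_norm_sq, h.1, h'.1,
      real_inner_comm ν' ν]; ring
  have h2 : inner ℝ d ν' = -(‖d‖ ^ 2 / 2) := by
    rw [norm_sub_sq_real, inner_sub_left, real_inner_self_eq_norm_sq, h.1, h'.1]; ring
  have ht : Tendsto (fun s : ℝ => x + s • d) (𝓝[>] 0) (𝓝 x) := by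
    have : Continuous fun s : ℝ => x + s • d := by fun_prop
    simpa using (this.tendsto 0).mono_left nhdsWithin_le_nhds
  have hε : 0 < ‖d‖ / 4 := by positivity
  obtain ⟨s, ⟨ha, hb⟩, hs⟩ := ((ht.eventually (h.2 _ hε)).and
    (ht.eventually (h'.2 _ hε)) |>.and self_mem_nhdsWithin).exists
  have hs : 0 < s := hs
  simp only [add_sub_cancel_left, norm_smul, Real.norm_of_nonneg hs.le, inner_smul_left] at ha hb
  simp only [conj_trivial, h1, h2] at ha hb
  have hpos : 0 < s * ‖d‖ ^ 2 := by positivity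
  exact ha.2 (by nlinarith) (hb.1 (by nlinarith))

lemma outerNormal_eq {n : ℕ} {A : Set (Space n)} {x ν : Space n} (h : IsOuterNormal A x ν) :
    outerNormal A x = ν := by
  have h1 : ∃ ν, IsOuterNormal A x ν := ⟨ν, h⟩
  rw [outerNormal, dif_pos h1]
  exact h1.choose_spec.unique h

lemma norm_outerNormal_le {n : ℕ} (A : Set (Space n)) (x : Space n) : ‖outerNormal A x‖ ≤ 1 := by
  rw [outerNormal]
  split_ifs with h
  · exact h.choose_spec.1.le
  · simp

/-! ### Normal, surface measure and divergence theorem inside one chart -/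

namespace IsLipschitzChart

variable {n : ℕ} {A : Set (Space n)} {x₀ : Space n} {R : Space n ≃ₗᵢ[ℝ] Space n}
  {φ : EuclideanSpace ℝ (Fin n) → ℝ} {K : NNReal} {r : ℝ}

lemma frontier_inter_ball (h : IsLipschitzChart A x₀ R φ K r) :
    frontier A ∩ Metric.ball x₀ r = range (boundaryMap x₀ R φ) ∩ Metric.ball x₀ r := by
  set T := (rigidMotion x₀ R).toHomeomorph
  have h1 : T ⁻¹' A ∩ Metric.ball 0 r =
      {y : Space n | φ (tangentialPart y) < y (Fin.last n)} ∩ Metric.ball 0 r := by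
    ext y
    simp only [mem_inter_iff, mem_preimage, mem_ofPred_eq, mem_ball_zero_iff]
    exact and_congr_left (h.mem_iff y)
  have h2 : T ⁻¹' frontier A ∩ Metric.ball 0 r = range (graphMap φ) ∩ Metric.ball 0 r := by
    rw [T.preimage_frontier, ← frontier_inter_open_inter Metric.isOpen_ball, h1,
      frontier_inter_open_inter Metric.isOpen_ball, frontier_epigraph h.lip.continuous]
  ext x
  obtain ⟨y, rfl⟩ := T.surjective x
  have h3 := Set.ext_iff.1 h2 y
  simp only [mem_inter_iff, mem_preimage, mem_ball_zero_iff] at h3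
  have h4 : T y ∈ Metric.ball x₀ r ↔ ‖y‖ < r := rigidMotion_mem_ball
  have h5 : T y ∈ range (boundaryMap x₀ R φ) ↔ y ∈ range (graphMap φ) :=
    ⟨fun ⟨x, hx⟩ => ⟨x, T.injective hx⟩, fun ⟨x, hx⟩ => ⟨x, congrArg T hx⟩⟩
  rw [mem_inter_iff, mem_inter_iff, h4, h5, h3]

/-- At a point of differentiability, φ(w') - w_d equals the area density times the normal component
of the displacement, up to ε times its length. The density is at least 1, so a normal component
larger than that error decides the side of the graph. -/
lemma isOuterNormal (h : IsLipschitzChart A x₀ R φ K r) {x : EuclideanSpace ℝ (Fin n)}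
    (hx : DifferentiableAt ℝ φ x) (hr : boundaryMap x₀ R φ x ∈ Metric.ball x₀ r) :
    IsOuterNormal A (boundaryMap x₀ R φ x) (chartNormal R φ x) := by
  refine ⟨norm_chartNormal R φ x, fun ε hε => ?_⟩
  set T := (rigidMotion x₀ R).toHomeomorph
  have hTs : Tendsto T.symm (𝓝 (boundaryMap x₀ R φ x)) (𝓝 (graphMap φ x)) := by
    have := T.symm.continuous.tendsto (boundaryMap x₀ R φ x)
    rwa [show T.symm (boundaryMap x₀ R φ x) = graphMap φ x from T.symm_apply_apply _] at this
  have ho : ∀ᶠ x' in 𝓝 x, ‖φ x' - φ x - fderiv ℝ φ x (x' - x)‖ ≤ ε * ‖x' - x‖ :=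
    (hasFDerivAt_iff_isLittleO.1 hx.hasFDerivAt).def hε
  have ht : Tendsto (tangentialPart (n := n)) (𝓝 (graphMap φ x)) (𝓝 x) := by
    simpa [graphMap] using (continuous_tangentialPart (n := n)).tendsto (graphMap φ x)
  filter_upwards [hTs.eventually (ht.eventually ho), Metric.isOpen_ball.mem_nhds hr] with z hz hzr
  obtain ⟨w, rfl⟩ := T.surjective z
  rw [T.symm_apply_apply] at hz
  have hwr : ‖w‖ < r := rigidMotion_mem_ball.1 hzr
  have hA := h.mem_iff w hwr
  have hsub : T w - boundaryMap x₀ R φ x = R (w - graphMap φ x) := by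
    simp [T, boundaryMap]
  rw [hsub, LinearIsometryEquiv.norm_map]
  set c := inner ℝ (R (w - graphMap φ x)) (chartNormal R φ x)
  have hc := inner_chartNormal R φ x (w - graphMap φ x)
  set J := areaDensity (fderiv ℝ φ x)
  have hJ : 1 ≤ J := one_le_areaDensity _
  have hnorm : ‖tangentialPart w - x‖ ≤ ‖w - graphMap φ x‖ := by
    have := norm_tangentialPart_le (w - graphMap φ x)
    rwa [tangentialPart_sub, graphMap, tangentialPart_snocPoint] at this
  rw [tangentialPart_sub] at hc
  simp only [graphMap, tangentialPart_snocPoint, PiLp.sub_apply, snocPoint_last] at hc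
  rw [Real.norm_eq_abs, abs_le] at hz
  set N := ‖w - graphMap φ x‖
  have hN : 0 ≤ N := norm_nonneg _
  have h1 : ε * ‖tangentialPart w - x‖ ≤ ε * N := by gcongr
  have h2 : ε * N ≤ J * (ε * N) := le_mul_of_one_le_left (by positivity) hJ
  have hT : T w = x₀ + R w := rfl
  rw [hT, hA]
  change (c < -(ε * N) → _) ∧ (ε * N < c → _)
  constructor
  · intro h3
    have : J * c < J * -(ε * N) := by gcongr
    have e : J * inner ℝ (R (w - graphMap φ x)) (chartNormal R φ x) = J * c := rfl
    simp only [graphMap] at e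
    rw [e] at hc
    linarith
  · intro h3
    have : J * (ε * N) < J * c := by gcongr
    have e : J * inner ℝ (R (w - graphMap φ x)) (chartNormal R φ x) = J * c := rfl
    simp only [graphMap] at e
    rw [e] at hc
    linarith

lemma outerNormal_boundaryMap (h : IsLipschitzChart A x₀ R φ K r) :
    ∀ᵐ x, boundaryMap x₀ R φ x ∈ Metric.ball x₀ r →
      outerNormal A (boundaryMap x₀ R φ x) = chartNormal R φ x := by
  filter_upwards [h.lip.ae_differentiableAt (μ := volume)] with x hx hr
  exact outerNormal_eq (h.isOuterNormal hx hr)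

lemma aestronglyMeasurable_outerNormal (h : IsLipschitzChart A x₀ R φ K r) :
    AEStronglyMeasurable (outerNormal A)
      ((Measure.euclideanHausdorffMeasure n).restrict (frontier A ∩ Metric.ball x₀ r)) := by
  have hB := measurableEmbedding_boundaryMap x₀ R h.lip.continuous
  set D := volume.withDensity fun x => ENNReal.ofReal (areaDensity (fderiv ℝ φ x))
  have hmap := map_boundaryMap_withDensity x₀ R h.lip
  have hm : Measurable fun z => chartNormal R φ (tangentialPart ((rigidMotion x₀ R).symm z)) :=
    (measurable_chartNormal R φ).comp (continuous_tangentialPart.measurable.comp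
      (rigidMotion x₀ R).symm.continuous.measurable)
  refine ⟨_, hm.stronglyMeasurable, ?_⟩
  rw [h.frontier_inter_ball, inter_comm, ← Measure.restrict_restrict measurableSet_ball, ← hmap,
    Filter.EventuallyEq, ae_restrict_iff' measurableSet_ball, hB.ae_map_iff]
  have hac : D ≪ volume := withDensity_absolutelyContinuous _ _
  filter_upwards [hac.ae_le h.outerNormal_boundaryMap] with x hx hr
  rw [hx hr, boundaryMap, IsometryEquiv.symm_apply_apply, graphMap, tangentialPart_snocPoint]

lemma hausdorff_frontier_inter_ball_lt_top (h : IsLipschitzChart A x₀ R φ K r) :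
    Measure.euclideanHausdorffMeasure n (frontier A ∩ Metric.ball x₀ r) < ⊤ := by
  have hsub : frontier A ∩ Metric.ball x₀ r ⊆
      rigidMotion x₀ R '' (graphMap φ '' Metric.ball 0 r) := by
    rw [h.frontier_inter_ball]
    rintro _ ⟨⟨x, rfl⟩, hx⟩
    refine ⟨_, ⟨x, ?_, rfl⟩, rfl⟩
    have h1 : ‖graphMap φ x‖ < r := rigidMotion_mem_ball.1 hx
    rw [mem_ball_zero_iff]
    have := norm_tangentialPart_le (graphMap φ x)
    simp only [graphMap, tangentialPart_snocPoint] at this h1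
    linarith
  refine (measure_mono hsub).trans_lt ?_
  rw [(rigidMotion x₀ R).isometry.euclideanHausdorffMeasure_image]
  refine (((lipschitzWith_graphMap h.lip).lipschitzOnWith
    (s := Metric.ball 0 r)).euclideanHausdorffMeasure_image_le n).trans_lt ?_
  rw [EuclideanSpace.euclideanHausdorffMeasure_eq_volume]
  exact ENNReal.mul_lt_top (ENNReal.pow_lt_top ENNReal.coe_lt_top) measure_ball_lt_top

/-- The divergence theorem for functions supported in the domain of a chart. -/
lemma integral_fderiv (h : IsLipschitzChart A x₀ R φ K r) (hA : MeasurableSet A) {ψ : Space n → ℝ}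
    (hψ : ContDiff ℝ 1 ψ) (hc : HasCompactSupport ψ) (hs : tsupport ψ ⊆ Metric.ball x₀ r)
    (v : Space n) :
    ∫ x in A, fderiv ℝ ψ x v = ∫ x, ψ x * inner ℝ v (outerNormal A x) ∂surfaceMeasure (frontier A) := by
  set T := (rigidMotion x₀ R).toHomeomorph
  have hTe := T.measurableEmbedding
  have hTm : MeasurePreserving T volume volume := measurePreserving_rigidMotion x₀ R
  set v' := R.symm v
  have hv : R v' = v := R.apply_symm_apply v
  have hz : ∀ x, x ∉ Metric.ball x₀ r → ψ x = 0 := fun x hx =>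
    image_eq_zero_of_notMem_tsupport fun h => hx (hs h)
  have hT1 : ∀ y, HasFDerivAt T (R : Space n →L[ℝ] Space n) y := fun y =>
    (R : Space n →L[ℝ] Space n).hasFDerivAt.const_add x₀
  have hTc : ContDiff ℝ 1 T := contDiff_const.add R.contDiff
  have hψT : ∀ y, fderiv ℝ ψ (T y) v = fderiv ℝ (ψ ∘ T) y v' := fun y => by
    rw [((hψ.differentiable one_ne_zero _).hasFDerivAt.comp y (hT1 y)).fderiv, ← hv]; rfl
  have hsupp : ∀ y, y ∉ Metric.ball 0 r → fderiv ℝ ψ (T y) v = 0 := fun y hy => by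
    rw [fderiv_of_notMem_tsupport ℝ fun h => hy ?_]; · rfl
    exact mem_ball_zero_iff.2 (rigidMotion_mem_ball.1 (hs h))
  have hle : MeasurableSet {y : Space n | φ (tangentialPart y) < y (Fin.last n)} :=
    measurableSet_lt (h.lip.continuous.comp continuous_tangentialPart).measurable
      (Continuous.measurable (by fun_prop))
  have hL : ∫ x in A, fderiv ℝ ψ x v
      = ∫ x, ψ (boundaryMap x₀ R φ x) *
        (fderiv ℝ φ x (tangentialPart v') - v' (Fin.last n)) := by
    rw [← hTm.setIntegral_preimage_emb hTe,
      ← integral_indicator (hTe.measurable hA)]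
    -- The set and the epigraph agree inside the ball, and the derivative of `ψ` vanishes outside
    -- it.
    have : (T ⁻¹' A).indicator (fun y => fderiv ℝ ψ (T y) v)
        = {y : Space n | φ (tangentialPart y) < y (Fin.last n)}.indicator
          (fun y => fderiv ℝ (ψ ∘ T) y v') := by
      classical
      funext y
      rw [indicator_apply, indicator_apply, ← hψT]
      by_cases hy : y ∈ Metric.ball 0 r
      · have := h.mem_iff y (mem_ball_zero_iff.1 hy)
        have e : (y ∈ T ⁻¹' A) = (y ∈ {y : Space n | φ (tangentialPart y) < y (Fin.last n)}) :=
          propext this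
        simp only [e]
      · simp [hsupp y hy]
    rw [this, integral_indicator hle, integral_epigraph_fderiv h.lip (hψ.comp hTc)
      (hc.comp_homeomorph T)]
    rfl
  have hRHS : ∫ x, ψ x * inner ℝ v (outerNormal A x) ∂surfaceMeasure (frontier A)
      = ∫ x in range (boundaryMap x₀ R φ), ψ x * inner ℝ v (outerNormal A x)
        ∂Measure.euclideanHausdorffMeasure n := by
    have : (fun x => ψ x * inner ℝ v (outerNormal A x))
        = (Metric.ball x₀ r).indicator (fun x => ψ x * inner ℝ v (outerNormal A x)) := by
      funext x
      by_cases hx : x ∈ Metric.ball x₀ r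
      · simp [hx]
      · simp [hx, hz x hx]
    rw [surfaceMeasure, this, setIntegral_indicator measurableSet_ball, h.frontier_inter_ball,
      ← setIntegral_indicator measurableSet_ball]
  rw [hL, hRHS, ← map_boundaryMap_withDensity x₀ R h.lip,
    (measurableEmbedding_boundaryMap x₀ R h.lip.continuous).integral_map,
    integral_withDensity_eq_integral_toReal_smul
      (f := fun x => ENNReal.ofReal (areaDensity (fderiv ℝ φ x)))
      ((continuous_areaDensity.measurable.comp (measurable_fderiv ℝ φ)).ennreal_ofReal)
      (Eventually.of_forall fun x => ENNReal.ofReal_lt_top)]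
  refine integral_congr_ae ?_
  filter_upwards [h.outerNormal_boundaryMap] with x hx
  rw [ENNReal.toReal_ofReal (areaDensity_pos _).le, smul_eq_mul]
  by_cases hr : boundaryMap x₀ R φ x ∈ Metric.ball x₀ r
  · rw [hx hr, ← inner_chartNormal R φ x, hv]; ring
  · rw [hz _ hr]; ring

end IsLipschitzChart

/-! ### The divergence theorem on Lipschitz domains -/

lemma exists_cutoff {n : ℕ} {K W : Set (Space n)} (hK : IsCompact K) (hW : IsOpen W)
    (hKW : K ⊆ W) : ∃ χ : Space n → ℝ, ContDiff ℝ ∞ χ ∧ HasCompactSupport χ ∧ tsupport χ ⊆ W ∧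
      ∀ᶠ x in 𝓝ˢ K, χ x = 1 := by
  obtain ⟨L, hL, hKL, hLW⟩ := exists_compact_between hK hW hKW
  obtain ⟨f, h1, h0, -⟩ := exists_contMDiffMap_one_nhds_of_subset_interior (n := ⊤)
    (modelWithCornersSelf ℝ (Space n)) hK.isClosed hKL
  have hs : tsupport f ⊆ L := closure_minimal (fun x hx => by
    by_contra h; exact hx (h0 x h)) hL.isClosed
  exact ⟨f, f.contMDiff.contDiff, HasCompactSupport.of_support_subset_isCompact hL
    ((subset_tsupport _).trans hs), hs.trans hLW, h1⟩

lemma inner_single_left {n : ℕ} (j : Fin (n + 1)) (x : Space n) :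
    inner ℝ (EuclideanSpace.single j (1 : ℝ)) x = x j := by
  simp [EuclideanSpace.inner_single_left]

lemma partialDeriv_mul {n : ℕ} {f g : Space n → ℝ} (hf : ContDiff ℝ ∞ f) (hg : ContDiff ℝ ∞ g)
    (j : Fin (n + 1)) (x : Space n) : partialDeriv j (fun x => f x * g x) x
      = f x * partialDeriv j g x + g x * partialDeriv j f x := by
  rw [partialDeriv, fderiv_fun_mul (hf.differentiable (by simp) x) (hg.differentiable (by simp) x)]
  simp [partialDeriv]

lemma contDiff_partialDeriv {n : ℕ} {f : Space n → ℝ} (hf : ContDiff ℝ ∞ f) (j : Fin (n + 1)) :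
    ContDiff ℝ ∞ (partialDeriv j f) :=
  (hf.fderiv_right (m := ∞) (by simp)).clm_apply contDiff_const

lemma partialDeriv_congr {n : ℕ} {f g : Space n → ℝ} {x : Space n} (h : f =ᶠ[𝓝 x] g)
    (j : Fin (n + 1)) : partialDeriv j f x = partialDeriv j g x := by
  rw [partialDeriv, h.fderiv_eq, partialDeriv]

namespace HasLipschitzBoundary

variable {n : ℕ} {A : Set (Space n)}

lemma isFiniteMeasure_surfaceMeasure (h : HasLipschitzBoundary A) (hb : Bornology.IsBounded A) :
    IsFiniteMeasure (surfaceMeasure (frontier A)) := by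
  refine ⟨?_⟩
  rw [surfaceMeasure, Measure.restrict_apply_univ]
  have hc : IsCompact (frontier A) := hb.isCompact_closure.of_isClosed_subset isClosed_frontier
    frontier_subset_closure
  refine hc.measure_lt_top_of_nhdsWithin fun x hx => ?_
  obtain ⟨R, φ, K, r, hr⟩ := h x hx
  exact ⟨_, inter_mem self_mem_nhdsWithin
    (mem_nhdsWithin_of_mem_nhds (Metric.ball_mem_nhds x hr.pos)),
    hr.hausdorff_frontier_inter_ball_lt_top⟩

/-- A set of finite `n`-dimensional Hausdorff measure has zero measure in dimension `n + 1`. -/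
lemma volume_frontier (h : HasLipschitzBoundary A) (hb : Bornology.IsBounded A) :
    volume (frontier A) = 0 := by
  have h1 := (h.isFiniteMeasure_surfaceMeasure hb).measure_univ_lt_top
  rw [surfaceMeasure, Measure.restrict_apply_univ] at h1
  rw [← EuclideanSpace.euclideanHausdorffMeasure_eq_volume]
  exact (Measure.euclideanHausdorffMeasure_zero_or_top (Nat.lt_succ_self n) _).resolve_right h1.ne

lemma aestronglyMeasurable_outerNormal (h : HasLipschitzBoundary A)
    (hb : Bornology.IsBounded A) :
    AEStronglyMeasurable (outerNormal A) (surfaceMeasure (frontier A)) := by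
  have hc : IsCompact (frontier A) := hb.isCompact_closure.of_isClosed_subset isClosed_frontier
    frontier_subset_closure
  refine hc.induction_on (p := fun s => AEStronglyMeasurable (outerNormal A)
    ((Measure.euclideanHausdorffMeasure n).restrict s)) (by simp) ?_ ?_ fun x hx => ?_
  · exact fun s t hst ht => ht.mono_measure (Measure.restrict_mono_set _ hst)
  · exact fun s t hs ht => aestronglyMeasurable_union_iff.2 ⟨hs, ht⟩
  · obtain ⟨R, φ, K, r, hr⟩ := h x hx
    exact ⟨_, inter_mem self_mem_nhdsWithin
      (mem_nhdsWithin_of_mem_nhds (Metric.ball_mem_nhds x hr.pos)),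
      hr.aestronglyMeasurable_outerNormal⟩

lemma integrable_mul_outerNormal (h : HasLipschitzBoundary A) (hb : Bornology.IsBounded A)
    {ψ : Space n → ℝ} (hψ : Continuous ψ) (hc : HasCompactSupport ψ) (j : Fin (n + 1)) :
    Integrable (fun x => ψ x * outerNormal A x j) (surfaceMeasure (frontier A)) := by
  have := h.isFiniteMeasure_surfaceMeasure hb
  have hm := h.aestronglyMeasurable_outerNormal hb
  obtain ⟨C, hC⟩ := hψ.bounded_above_of_compact_support hc
  refine Integrable.of_bound (C := C * 1) (hψ.aestronglyMeasurable.mul ?_)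
    (Eventually.of_forall fun x => ?_)
  · exact (by fun_prop : Continuous fun y : Space n => y j).comp_aestronglyMeasurable hm
  · rw [norm_mul]
    have := (PiLp.norm_apply_le (outerNormal A x) j).trans (norm_outerNormal_le A x)
    have := (norm_nonneg (ψ x)).trans (hC x)
    gcongr
    exact hC x

/-- The divergence theorem on a Lipschitz domain, for compactly supported functions. -/
lemma integral_partialDeriv_of_hasCompactSupport (h : HasLipschitzBoundary A) (ho : IsOpen A)
    (hb : Bornology.IsBounded A) {ψ : Space n → ℝ} (hψ : ContDiff ℝ ∞ ψ)
    (hc : HasCompactSupport ψ) (j : Fin (n + 1)) :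
    ∫ x in A, partialDeriv j ψ x = ∫ x, ψ x * outerNormal A x j ∂surfaceMeasure (frontier A) := by
  -- The formula is proved for all functions supported in some open neighbourhood of the compact
  -- support of `ψ`. In this form the property is stable under unions and need only be verified near
  -- each point.
  have key : ∃ W : Set (Space n), IsOpen W ∧ tsupport ψ ⊆ W ∧ ∀ f : Space n → ℝ,
      ContDiff ℝ ∞ f → HasCompactSupport f → tsupport f ⊆ W →
      ∫ x in A, partialDeriv j f x
        = ∫ x, f x * outerNormal A x j ∂surfaceMeasure (frontier A) := by
    refine IsCompact.induction_on (s := tsupport ψ) hc (p := fun s => ∃ W : Set (Space n),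
      IsOpen W ∧ s ⊆ W ∧ ∀ f : Space n → ℝ, ContDiff ℝ ∞ f → HasCompactSupport f → tsupport f ⊆ W →
      ∫ x in A, partialDeriv j f x
        = ∫ x, f x * outerNormal A x j ∂surfaceMeasure (frontier A)) ?_ ?_ ?_ ?_
    · refine ⟨∅, isOpen_empty, Subset.rfl, fun f _ _ hf => ?_⟩
      obtain rfl : f = 0 := tsupport_eq_empty_iff.1 (subset_empty_iff.1 hf)
      simp [partialDeriv]
    · rintro s t hst ⟨W, hW, htW, hf⟩
      exact ⟨W, hW, hst.trans htW, hf⟩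
    · rintro s t ⟨W, hW, hsW, hfW⟩ ⟨V, hV, htV, hfV⟩
      refine ⟨W ∪ V, hW.union hV, union_subset_union hsW htV, fun f hf hfc hfs => ?_⟩
      -- A partition of unity with two members: `χ` is 1 near the part of the support outside `V`,
      -- hence `χ f` lives in `W` and `(1 - χ) f` in `V`.
      obtain ⟨χ, hχ, -, hχW, hχ1⟩ := exists_cutoff (K := tsupport f \ V) (hfc.isCompact.diff hV) hW
        (fun x hx => (hfs hx.1).resolve_right hx.2)
      have hg1 : ContDiff ℝ ∞ fun x => χ x * f x := hχ.mul hf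
      have hg2 : ContDiff ℝ ∞ fun x => (1 - χ x) * f x := (contDiff_const.sub hχ).mul hf
      have hc1 : HasCompactSupport fun x => χ x * f x := hfc.mul_left
      have hc2 : HasCompactSupport fun x => (1 - χ x) * f x := hfc.mul_left
      have hs1 : tsupport (fun x => χ x * f x) ⊆ W := (tsupport_mul_subset_left).trans hχW
      have hs2 : tsupport (fun x => (1 - χ x) * f x) ⊆ V := by
        intro x hx
        by_contra hxV
        have hxf : x ∈ tsupport f := tsupport_mul_subset_right hx
        have h1 := hχ1.filter_mono (nhds_le_nhdsSet (show x ∈ tsupport f \ V from ⟨hxf, hxV⟩))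
        refine notMem_tsupport_iff_eventuallyEq.2 ?_ hx
        filter_upwards [h1] with y hy
        simp [hy]
      have hsum : ∀ x, f x = χ x * f x + (1 - χ x) * f x := fun x => by ring
      have hd : ∀ x, partialDeriv j f x = partialDeriv j (fun x => χ x * f x) x
          + partialDeriv j (fun x => (1 - χ x) * f x) x := fun x => by
        rw [partialDeriv, show f = fun x => χ x * f x + (1 - χ x) * f x from funext hsum,
          fderiv_fun_add (hg1.differentiable (by simp) x) (hg2.differentiable (by simp) x)]
        simp only [partialDeriv, ← hsum]
        rfl
      have hi : ∀ {g : Space n → ℝ}, ContDiff ℝ ∞ g → HasCompactSupport g →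
          IntegrableOn (partialDeriv j g) A := fun {g} hg hgc =>
        ((contDiff_partialDeriv hg j).continuous.integrable_of_hasCompactSupport
          (hgc.fderiv_apply ℝ _)).integrableOn
      simp_rw [hd]
      rw [integral_add (hi hg1 hc1) (hi hg2 hc2), hfW _ hg1 hc1 hs1, hfV _ hg2 hc2 hs2,
        ← integral_add (h.integrable_mul_outerNormal hb hg1.continuous hc1 j)
          (h.integrable_mul_outerNormal hb hg2.continuous hc2 j)]
      refine integral_congr_ae (Eventually.of_forall fun x => ?_)
      ring
    · intro x _
      by_cases hxA : x ∈ frontier A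
      · obtain ⟨R, φ, K, r, hr⟩ := h x hxA
        refine ⟨_, mem_nhdsWithin_of_mem_nhds (Metric.ball_mem_nhds x hr.pos), _,
          Metric.isOpen_ball, Subset.rfl, fun f hf hfc hfs => ?_⟩
        have := hr.integral_fderiv ho.measurableSet (hf.of_le (by simp)) hfc hfs
          (EuclideanSpace.single j 1)
        simp only [inner_single_left] at this
        exact this
      · refine ⟨(frontier A)ᶜ, mem_nhdsWithin_of_mem_nhds
          (isClosed_frontier.isOpen_compl.mem_nhds hxA), (frontier A)ᶜ,
          isClosed_frontier.isOpen_compl, Subset.rfl, fun f hf hfc hfs => ?_⟩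
        have hz : ∀ x ∈ frontier A, f x = 0 := fun x hx =>
          image_eq_zero_of_notMem_tsupport fun h => hfs h hx
        have hr : ∫ x, f x * outerNormal A x j ∂surfaceMeasure (frontier A) = 0 := by
          rw [surfaceMeasure, setIntegral_congr_fun isClosed_frontier.measurableSet
            (g := fun _ => 0) fun x hx => by simp [hz x hx]]
          simp
        rw [hr]
        -- The support of `f` avoids the boundary of `A`, so cutting `f` off to `A` keeps it smooth
        -- and compactly supported. The integral of its derivative over the whole space is therefore
        -- zero.
        set g := A.indicator f
        have hgf : ∀ x ∈ tsupport f, (x ∈ A → g =ᶠ[𝓝 x] f) ∧ (x ∉ A → g =ᶠ[𝓝 x] 0) := by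
          intro x hx
          constructor
          · intro hA
            filter_upwards [ho.mem_nhds hA] with y hy
            simp [g, hy]
          · intro hA
            have : x ∉ closure A := fun hcl => hfs hx ⟨hcl, by rwa [ho.interior_eq]⟩
            filter_upwards [isClosed_closure.isOpen_compl.mem_nhds this] with y hy
            exact indicator_of_notMem (fun h => hy (subset_closure h)) f
        have hge : ∀ x, (x ∈ A → g =ᶠ[𝓝 x] f) ∧ (x ∉ A → g =ᶠ[𝓝 x] 0) := by
          intro x
          by_cases hx : x ∈ tsupport f
          · exact hgf x hx
          · have h0 : f =ᶠ[𝓝 x] 0 := notMem_tsupport_iff_eventuallyEq.1 hx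
            have : g =ᶠ[𝓝 x] 0 := h0.mono fun y hy => by
              exact indicator_apply_eq_zero.2 fun _ => hy
            exact ⟨fun _ => this.trans h0.symm, fun _ => this⟩
        have hgd : ContDiff ℝ ∞ g := contDiff_iff_contDiffAt.2 fun x => by
          by_cases hx : x ∈ A
          · exact hf.contDiffAt.congr_of_eventuallyEq ((hge x).1 hx)
          · exact contDiffAt_const.congr_of_eventuallyEq ((hge x).2 hx)
        have hgc : HasCompactSupport g := hfc.mono (by
          intro x hx
          by_contra h
          exact hx (indicator_apply_eq_zero.2 fun _ => Function.notMem_support.1 h))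
        have hind : A.indicator (partialDeriv j f) = partialDeriv j g := by
          funext x
          by_cases hx : x ∈ A
          · rw [indicator_of_mem hx, partialDeriv_congr ((hge x).1 hx)]
          · rw [indicator_of_notMem hx, partialDeriv_congr ((hge x).2 hx)]
            simp [partialDeriv]
        rw [← integral_indicator ho.measurableSet, hind]
        have h1 := integral_mul_fderiv_eq_neg_fderiv_mul_of_integrable (μ := volume)
          (f := fun _ : Space n => (1 : ℝ)) (g := g) (v := EuclideanSpace.single j (1 : ℝ))
          (by simp) (by
            have := (contDiff_partialDeriv hgd j).continuous.integrable_of_hasCompactSupport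
              (μ := volume) (hgc.fderiv_apply ℝ _)
            simp only [one_mul]
            exact this)
          (by simpa using hgd.continuous.integrable_of_hasCompactSupport hgc)
          (fun x _ => differentiableAt_const _)
          (fun x _ => (hgd.differentiable (by simp) x))
        simpa [partialDeriv] using h1
  obtain ⟨W, -, hψW, hW⟩ := key
  exact hW ψ hψ hc hψW

/-- The **divergence theorem** on a bounded Lipschitz domain. -/
theorem integral_partialDeriv (h : HasLipschitzBoundary A) (ho : IsOpen A)
    (hb : Bornology.IsBounded A) {ψ : Space n → ℝ} (hψ : ContDiff ℝ ∞ ψ) (j : Fin (n + 1)) :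
    ∫ x in A, partialDeriv j ψ x = ∫ x, ψ x * outerNormal A x j ∂surfaceMeasure (frontier A) := by
  obtain ⟨χ, hχ, hχc, -, hχ1⟩ := exists_cutoff hb.isCompact_closure isOpen_univ (subset_univ _)
  have h1 : ∀ x ∈ closure A, (fun x => χ x * ψ x) =ᶠ[𝓝 x] ψ := fun x hx => by
    filter_upwards [hχ1.filter_mono (nhds_le_nhdsSet hx)] with y hy
    simp [hy]
  have h2 := h.integral_partialDeriv_of_hasCompactSupport ho hb (hχ.mul hψ) hχc.mul_right j
  rw [setIntegral_congr_fun ho.measurableSet fun x hx =>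
    partialDeriv_congr (h1 x (subset_closure hx)) j] at h2
  rw [h2]
  refine setIntegral_congr_fun isClosed_frontier.measurableSet fun x hx => ?_
  exact congrArg (· * outerNormal A x j) (h1 x (frontier_subset_closure hx)).eq_of_nhds

end HasLipschitzBoundary

/-! ### Green pairs -/

/-- The divergence theorem on `U`, localised by `χ` to the part `Γ` of the boundary, where the
normal field is `ν`. -/
structure IsGreenPair {n : ℕ} (U Γ : Set (Space n)) (ν : Space n → Space n) (χ : Space n → ℝ) :
    Prop where
  isOpen : IsOpen U
  isBounded : Bornology.IsBounded U
  finite : IsFiniteMeasure (surfaceMeasure Γ)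
  aestronglyMeasurable : AEStronglyMeasurable ν (surfaceMeasure Γ)
  norm_le : ∀ x, ‖ν x‖ ≤ 1
  contDiff : ContDiff ℝ ∞ χ
  green : ∀ ψ : Space n → ℝ, ContDiff ℝ ∞ ψ → ∀ j,
    ∫ x in U, partialDeriv j (fun x => χ x * ψ x) x = ∫ x, ψ x * ν x j ∂surfaceMeasure Γ

lemma HasLipschitzBoundary.isGreenPair {n : ℕ} {A : Set (Space n)} (h : HasLipschitzBoundary A)
    (ho : IsOpen A) (hb : Bornology.IsBounded A) :
    IsGreenPair A (frontier A) (outerNormal A) (fun _ => 1) where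
  isOpen := ho
  isBounded := hb
  finite := h.isFiniteMeasure_surfaceMeasure hb
  aestronglyMeasurable := h.aestronglyMeasurable_outerNormal hb
  norm_le := norm_outerNormal_le A
  contDiff := contDiff_const
  green ψ hψ j := by simpa using h.integral_partialDeriv ho hb hψ j

/-! ### Domains with a hole -/

/-- Points just below the graph lie in an open set disjoint from `A`, hence outside its closure.
Thus a Lipschitz domain lies on one side of its boundary, and taking the closure loses no boundary
point. -/
lemma IsLipschitzChart.center_notMem_interior_closure {n : ℕ} {A : Set (Space n)} {x₀ : Space n}
    {R : Space n ≃ₗᵢ[ℝ] Space n} {φ : EuclideanSpace ℝ (Fin n) → ℝ} {K : NNReal} {r : ℝ}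
    (h : IsLipschitzChart A x₀ R φ K r) (hx₀ : x₀ ∈ frontier A) :
    x₀ ∉ interior (closure A) := by
  have h0 : φ 0 = 0 := by
    have h1 : x₀ ∈ frontier A ∩ Metric.ball x₀ r := ⟨hx₀, Metric.mem_ball_self h.pos⟩
    rw [h.frontier_inter_ball] at h1
    obtain ⟨x, hx⟩ := h1.1
    have h2 : graphMap φ x = 0 := by
      simpa [boundaryMap] using hx
    have h3 := congrArg tangentialPart h2
    have h4 := congrArg (fun y : Space n => y (Fin.last n)) h2
    simp only [graphMap, tangentialPart_snocPoint, snocPoint_last, PiLp.zero_apply] at h3 h4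
    rw [← h4, h3]
    congr 1
  intro hi
  set T := (rigidMotion x₀ R).toHomeomorph
  have hV : IsOpen {y : Space n | y (Fin.last n) < φ (tangentialPart y) ∧ ‖y‖ < r} :=
    (isOpen_lt (by fun_prop) (h.lip.continuous.comp continuous_tangentialPart)).inter
      (isOpen_lt continuous_norm continuous_const)
  have hdis : Disjoint (T '' {y : Space n | y (Fin.last n) < φ (tangentialPart y) ∧ ‖y‖ < r})
      (closure A) := by
    refine Disjoint.closure_right ?_ (T.isOpenMap _ hV)
    rw [disjoint_left]
    rintro _ ⟨y, ⟨hy1, hy2⟩, rfl⟩ hA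
    exact lt_asymm hy1 ((h.mem_iff y hy2).1 hA)
  have ht : Tendsto (fun t : ℝ => snocPoint (0 : EuclideanSpace ℝ (Fin n)) (-t)) (𝓝[>] 0)
      (𝓝 0) := by
    have hc : Continuous fun t : ℝ => snocPoint (0 : EuclideanSpace ℝ (Fin n)) (-t) :=
      continuous_snocPoint.comp (continuous_const.prodMk (by fun_prop))
    have := (hc.tendsto 0).mono_left (nhdsWithin_le_nhds (s := Ioi 0))
    rwa [show snocPoint (0 : EuclideanSpace ℝ (Fin n)) (-0) = 0 from by
      rw [neg_zero]; exact map_zero (snocPointL n)] at this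
  have ht2 : Tendsto (fun t : ℝ => T (snocPoint (0 : EuclideanSpace ℝ (Fin n)) (-t))) (𝓝[>] 0)
      (𝓝 x₀) := by
    have := (T.continuous.tendsto 0).comp ht
    rwa [show T 0 = x₀ by simp [T]] at this
  obtain ⟨t, ⟨h1, h2⟩, h3⟩ := ((ht2.eventually (isOpen_interior.mem_nhds hi)).and
    (ht.eventually (Metric.ball_mem_nhds 0 h.pos)) |>.and self_mem_nhdsWithin).exists
  refine disjoint_left.1 hdis ⟨_, ⟨?_, mem_ball_zero_iff.1 h2⟩, rfl⟩ (interior_subset h1)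
  have : (0 : ℝ) < t := h3
  simp [h0, this]

lemma HasLipschitzBoundary.frontier_closure {n : ℕ} {A : Set (Space n)}
    (h : HasLipschitzBoundary A) : frontier (closure A) = frontier A := by
  refine Subset.antisymm frontier_closure_subset fun x hx => ?_
  obtain ⟨R, φ, K, r, hr⟩ := h x hx
  exact ⟨subset_closure (frontier_subset_closure hx), hr.center_notMem_interior_closure hx⟩

/-- A bounded Lipschitz domain `Ω` together with a Lipschitz domain `D` whose closure is in `Ω`. -/
structure IsLipschitzHole {n : ℕ} (Ω D : Set (Space n)) : Prop where
  isOpen : IsOpen Ω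
  isBounded : Bornology.IsBounded Ω
  lipschitz : HasLipschitzBoundary Ω
  isOpen_hole : IsOpen D
  lipschitz_hole : HasLipschitzBoundary D
  closure_subset : closure D ⊆ Ω

lemma IsCavity.isLipschitzHole {n : ℕ} {Ω D : Set (Space n)} {ρ M : ℝ}
    (hΩ : IsDomainOfClass 0 1 ρ M Ω) (h : IsCavity Ω D) : IsLipschitzHole Ω D := by
  obtain ⟨α, ρ', L, -, -, hD⟩ := h.smooth
  refine ⟨hΩ.isOpen, hΩ.isBounded, hΩ.hasLipschitzBoundary (Or.inl ⟨rfl, rfl⟩), hD.isOpen,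
    hD.hasLipschitzBoundary (Or.inr (by norm_num)), fun x hx => ?_⟩
  by_contra hxΩ
  have hxf : x ∈ frontier Ω := ⟨closure_mono h.subset hx, by rwa [hΩ.isOpen.interior_eq]⟩
  obtain ⟨d, hd, hdist⟩ := h.dist_pos
  obtain ⟨y, hy, hxy⟩ := Metric.mem_closure_iff.1 hx d hd
  have := hdist y hy x hxf
  rw [dist_comm] at this
  linarith

namespace IsLipschitzHole

variable {n : ℕ} {Ω D : Set (Space n)}

lemma isBounded_hole (h : IsLipschitzHole Ω D) : Bornology.IsBounded D :=
  h.isBounded.subset (subset_closure.trans h.closure_subset)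

lemma isOpen_diff (h : IsLipschitzHole Ω D) : IsOpen (Ω \ closure D) :=
  h.isOpen.sdiff isClosed_closure

lemma isBounded_diff (h : IsLipschitzHole Ω D) : Bornology.IsBounded (Ω \ closure D) :=
  h.isBounded.subset sdiff_subset

lemma notMem_frontier (h : IsLipschitzHole Ω D) {x : Space n} (hx : x ∈ Ω) : x ∉ frontier Ω :=
  fun hf => hf.2 (by rwa [h.isOpen.interior_eq])

lemma disjoint_frontier (h : IsLipschitzHole Ω D) : Disjoint (frontier D) (frontier Ω) :=
  disjoint_left.2 fun _ hx => h.notMem_frontier (h.closure_subset (frontier_subset_closure hx))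

lemma frontier_diff (h : IsLipschitzHole Ω D) :
    frontier (Ω \ closure D) = frontier Ω ∪ frontier D := by
  rw [sdiff_eq]
  refine Subset.antisymm ?_ (union_subset ?_ ?_)
  · refine (frontier_inter_subset _ _).trans (union_subset_union inter_subset_left ?_)
    rw [frontier_compl, h.lipschitz_hole.frontier_closure]
    exact inter_subset_right
  · intro x hx
    have : x ∈ frontier Ω ∩ (closure D)ᶜ :=
      ⟨hx, fun hc => h.notMem_frontier (h.closure_subset hc) hx⟩
    rw [← frontier_inter_open_inter isClosed_closure.isOpen_compl] at this
    exact this.1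
  · intro x hx
    have : x ∈ frontier (closure D)ᶜ ∩ Ω := by
      rw [frontier_compl, h.lipschitz_hole.frontier_closure]
      exact ⟨hx, h.closure_subset (frontier_subset_closure hx)⟩
    rw [← frontier_inter_open_inter h.isOpen, inter_comm] at this
    rw [inter_comm]
    exact this.2

lemma frontier_diff_sdiff_outer (h : IsLipschitzHole Ω D) :
    frontier (Ω \ closure D) \ frontier Ω = frontier D := by
  rw [h.frontier_diff, union_sdiff_left, h.disjoint_frontier.sdiff_eq_left]

lemma frontier_diff_sdiff_inner (h : IsLipschitzHole Ω D) :
    frontier (Ω \ closure D) \ frontier D = frontier Ω := by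
  rw [h.frontier_diff, union_sdiff_right, h.disjoint_frontier.symm.sdiff_eq_left]

/-- Cut-off functions of the hole: `χ` is `1` near the closure of `D` and has compact support
in `Ω`. -/
lemma exists_cutoff_hole (h : IsLipschitzHole Ω D) :
    ∃ χ : Space n → ℝ, ContDiff ℝ ∞ χ ∧ HasCompactSupport χ ∧ tsupport χ ⊆ Ω ∧
      (∀ᶠ x in 𝓝ˢ (closure D), χ x = 1) ∧ ∀ᶠ x in 𝓝ˢ (frontier Ω), χ x = 0 := by
  obtain ⟨χ, h1, h2, h3, h4⟩ :=
    exists_cutoff h.isBounded_hole.isCompact_closure h.isOpen h.closure_subset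
  refine ⟨χ, h1, h2, h3, h4, ?_⟩
  rw [eventually_nhdsSet_iff_forall]
  intro x hx
  exact notMem_tsupport_iff_eventuallyEq.1 fun hs => h.notMem_frontier (h3 hs) hx

lemma closure_ae_eq (h : IsLipschitzHole Ω D) : closure D =ᵐ[volume] D := by
  have h1 : closure D = D ∪ frontier D := by rw [closure_eq_self_union_frontier]
  rw [h1]
  exact union_ae_eq_left_of_ae_eq_empty (ae_eq_empty.2
    (h.lipschitz_hole.volume_frontier h.isBounded_hole))

lemma integral_diff_partialDeriv (h : IsLipschitzHole Ω D) {ψ : Space n → ℝ}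
    (hψ : ContDiff ℝ ∞ ψ) (j : Fin (n + 1)) :
    ∫ x in Ω \ closure D, partialDeriv j ψ x
      = ∫ x, ψ x * outerNormal Ω x j ∂surfaceMeasure (frontier Ω)
        - ∫ x, ψ x * outerNormal D x j ∂surfaceMeasure (frontier D) := by
  have hi : IntegrableOn (partialDeriv j ψ) Ω :=
    (((contDiff_partialDeriv hψ j).continuous.continuousOn.integrableOn_compact
      h.isBounded.isCompact_closure).mono_set subset_closure)
  rw [setIntegral_sdiff isClosed_closure.measurableSet hi h.closure_subset,
    setIntegral_congr_set h.closure_ae_eq,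
    h.lipschitz.integral_partialDeriv h.isOpen h.isBounded hψ,
    h.lipschitz_hole.integral_partialDeriv h.isOpen_hole h.isBounded_hole hψ]

/-- The cut-off removes the boundary term on `∂D` from the divergence theorem on the domain with the
hole. -/
lemma isGreenPair_outer (h : IsLipschitzHole Ω D) {χ : Space n → ℝ} (hχ : ContDiff ℝ ∞ χ)
    (h1 : ∀ᶠ x in 𝓝ˢ (frontier Ω), χ x = 1) (h0 : ∀ᶠ x in 𝓝ˢ (frontier D), χ x = 0) :
    IsGreenPair (Ω \ closure D) (frontier Ω) (outerNormal Ω) χ where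
  isOpen := h.isOpen_diff
  isBounded := h.isBounded_diff
  finite := h.lipschitz.isFiniteMeasure_surfaceMeasure h.isBounded
  aestronglyMeasurable := h.lipschitz.aestronglyMeasurable_outerNormal h.isBounded
  norm_le := norm_outerNormal_le Ω
  contDiff := hχ
  green ψ hψ j := by
    rw [h.integral_diff_partialDeriv (hχ.mul hψ) j, surfaceMeasure, surfaceMeasure,
      setIntegral_congr_fun (g := fun x => ψ x * outerNormal Ω x j)
        isClosed_frontier.measurableSet fun x hx => by simp [h1.self_of_nhdsSet x hx],
      setIntegral_congr_fun (s := frontier D) (g := fun x => 0)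
        isClosed_frontier.measurableSet fun x hx => by simp [h0.self_of_nhdsSet x hx]]
    simp

/-- The counterpart on `∂D`. The sign of the normal changes because the exterior of the domain with
the hole is the interior of `D`. -/
lemma isGreenPair_inner (h : IsLipschitzHole Ω D) {χ : Space n → ℝ} (hχ : ContDiff ℝ ∞ χ)
    (h1 : ∀ᶠ x in 𝓝ˢ (frontier D), χ x = 1) (h0 : ∀ᶠ x in 𝓝ˢ (frontier Ω), χ x = 0) :
    IsGreenPair (Ω \ closure D) (frontier D) (fun x => -outerNormal D x) χ where
  isOpen := h.isOpen_diff
  isBounded := h.isBounded_diff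
  finite := h.lipschitz_hole.isFiniteMeasure_surfaceMeasure h.isBounded_hole
  aestronglyMeasurable :=
    (h.lipschitz_hole.aestronglyMeasurable_outerNormal h.isBounded_hole).neg
  norm_le x := by rw [norm_neg]; exact norm_outerNormal_le D x
  contDiff := hχ
  green ψ hψ j := by
    rw [h.integral_diff_partialDeriv (hχ.mul hψ) j, surfaceMeasure, surfaceMeasure,
      setIntegral_congr_fun (s := frontier D) (g := fun x => ψ x * outerNormal D x j)
        isClosed_frontier.measurableSet fun x hx => by simp [h1.self_of_nhdsSet x hx],
      setIntegral_congr_fun (s := frontier Ω) (g := fun x => 0)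
        isClosed_frontier.measurableSet fun x hx => by simp [h0.self_of_nhdsSet x hx]]
    simp [integral_neg]

end IsLipschitzHole

/-! ### Convergence in `L²` -/

/-- `φ k → f` in `L²(μ)`. -/
def L2Tendsto {X : Type*} [MeasurableSpace X] (μ : Measure X) (φ : ℕ → X → ℝ) (f : X → ℝ) : Prop :=
  Tendsto (fun k => eLpNorm (fun x => φ k x - f x) 2 μ) atTop (𝓝 0)

namespace L2Tendsto

variable {X : Type*} [MeasurableSpace X] {μ ν : Measure X} {φ ψ : ℕ → X → ℝ} {f g : X → ℝ}

lemma mono_measure (h : L2Tendsto μ φ f) (hν : ν ≤ μ) : L2Tendsto ν φ f :=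
  tendsto_of_tendsto_of_tendsto_of_le_of_le tendsto_const_nhds h (fun _ => zero_le)
    fun _ => eLpNorm_mono_measure _ hν

lemma const (f : X → ℝ) : L2Tendsto μ (fun _ => f) f := by
  simp [L2Tendsto]

lemma congr' (h : L2Tendsto μ φ f) (hφ : ∀ k, φ k =ᵐ[μ] ψ k) (hf : f =ᵐ[μ] g) :
    L2Tendsto μ ψ g := by
  refine Tendsto.congr (fun k => eLpNorm_congr_ae ?_) h
  filter_upwards [hφ k, hf] with x h1 h2
  rw [h1, h2]

lemma of_bound {C : ℝ} (h : L2Tendsto μ φ f)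
    (hb : ∀ k, ∀ᵐ x ∂μ, |ψ k x - g x| ≤ C * |φ k x - f x|) : L2Tendsto μ ψ g := by
  have h1 : Tendsto (fun k => ENNReal.ofReal C * eLpNorm (fun x => φ k x - f x) 2 μ) atTop
      (𝓝 (ENNReal.ofReal C * 0)) := ENNReal.Tendsto.const_mul h (Or.inr ENNReal.ofReal_ne_top)
  rw [mul_zero] at h1
  exact tendsto_of_tendsto_of_tendsto_of_le_of_le tendsto_const_nhds h1 (fun _ => zero_le)
    fun k => eLpNorm_le_mul_eLpNorm_of_ae_le_mul (hb k) 2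

lemma mul_left {c : X → ℝ} {C : ℝ} (h : L2Tendsto μ φ f) (hc : ∀ᵐ x ∂μ, |c x| ≤ C) :
    L2Tendsto μ (fun k x => c x * φ k x) (fun x => c x * f x) :=
  h.of_bound (C := C) fun k => by
    filter_upwards [hc] with x hx
    rw [← mul_sub, abs_mul]
    gcongr

lemma add (h : L2Tendsto μ φ f) (h' : L2Tendsto μ ψ g)
    (hφ : ∀ k, AEStronglyMeasurable (fun x => φ k x - f x) μ)
    (hψ : ∀ k, AEStronglyMeasurable (fun x => ψ k x - g x) μ) :
    L2Tendsto μ (fun k x => φ k x + ψ k x) (fun x => f x + g x) := by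
  have h1 := Tendsto.add h h'
  rw [add_zero] at h1
  refine tendsto_of_tendsto_of_tendsto_of_le_of_le tendsto_const_nhds h1 (fun _ => zero_le)
    fun k => ?_
  refine le_trans (le_of_eq ?_) (eLpNorm_add_le (hφ k) (hψ k) (by norm_num))
  congr 1
  funext x
  simp only [Pi.add_apply]; ring

/-- Products of sequences that converge in `L²` have convergent integrals. -/
lemma integral_mul (h : L2Tendsto μ φ f) (h' : L2Tendsto μ ψ g) (hφ : ∀ k, MemLp (φ k) 2 μ)
    (hψ : ∀ k, MemLp (ψ k) 2 μ) (hf : MemLp f 2 μ) (hg : MemLp g 2 μ) :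
    Tendsto (fun k => ∫ x, φ k x * ψ k x ∂μ) atTop (𝓝 (∫ x, f x * g x ∂μ)) := by
  have h1 := (Lp.tendsto_Lp_iff_tendsto_eLpNorm'' φ hφ f hf).2 h
  have h2 := (Lp.tendsto_Lp_iff_tendsto_eLpNorm'' ψ hψ g hg).2 h'
  have key : ∀ {a b : X → ℝ} (ha : MemLp a 2 μ) (hb : MemLp b 2 μ),
      inner ℝ (ha.toLp) (hb.toLp) = ∫ x, a x * b x ∂μ := fun {a b} ha hb => by
    rw [L2.inner_def]
    refine integral_congr_ae ?_
    filter_upwards [ha.coeFn_toLp, hb.coeFn_toLp] with x h1 h2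
    rw [h1, h2]
    simp [mul_comm]
  have h3 := h1.inner (𝕜 := ℝ) h2
  simpa only [key] using h3

end L2Tendsto

/-! ### Mollification in `L²` -/

lemma sq_eLpNorm_two {X : Type*} [MeasurableSpace X] {μ : Measure X} (f : X → ℝ) :
    eLpNorm f 2 μ ^ 2 = ∫⁻ x, ‖f x‖ₑ ^ 2 ∂μ := by
  rw [eLpNorm_eq_lintegral_rpow_enorm_toReal (by norm_num) (by norm_num), ← ENNReal.rpow_natCast,
    ← ENNReal.rpow_mul]
  simp

lemma tendsto_eLpNorm_translate {n : ℕ} {f : Space n → ℝ} (hf : MemLp f 2 volume) :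
    Tendsto (fun y => eLpNorm (fun x => f (x - y) - f x) 2 volume) (𝓝 0) (𝓝 0) := by
  let G : C(Space n, C(Space n, Space n)) :=
    ContinuousMap.curry ⟨fun z : Space n × Space n => z.2 - z.1, by fun_prop⟩
  have hG : ∀ y, MeasurePreserving (G y) volume volume := fun y =>
    measurePreserving_sub_right volume y
  have h1 := Filter.Tendsto.compMeasurePreservingLp (f := fun _ : Space n => hf.toLp f)
    (tendsto_const_nhds (f := 𝓝 (0 : Space n))) (G.continuous.tendsto 0) hG (hG 0)
    (by norm_num : (2 : ENNReal) ≠ ⊤)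
  rw [tendsto_iff_edist_tendsto_0] at h1
  refine h1.congr fun y => ?_
  rw [Lp.toLp_compMeasurePreserving, Lp.toLp_compMeasurePreserving, Lp.edist_toLp_toLp]
  congr 1
  funext x
  simp [G]

/-- The convolution of real functions. -/
noncomputable def mollify {n : ℕ} (η f : Space n → ℝ) : Space n → ℝ :=
  convolution η f (ContinuousLinearMap.lsmul ℝ ℝ) volume

lemma mollify_apply {n : ℕ} (η f : Space n → ℝ) (x : Space n) :
    mollify η f x = ∫ y, η y * f (x - y) := by
  simp [mollify, convolution_def]

/-- As `η` is a probability density, the error of mollification is an average of the differences f(x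
- y) - f(x). The square of an average is at most the average of the squares, and Tonelli's theorem
exchanges the integrals over x and y. -/
lemma eLpNorm_mollify_sub_le {n : ℕ} {η f : Space n → ℝ} (hη : Continuous η)
    (hηc : HasCompactSupport η) (h0 : ∀ x, 0 ≤ η x) (h1 : ∫ x, η x = 1) (hf : MemLp f 2 volume)
    {c : ENNReal}
    (hc : ∀ y, η y ≠ 0 → eLpNorm (fun x => f (x - y) - f x) 2 volume ≤ c) :
    eLpNorm (fun x => mollify η f x - f x) 2 volume ≤ c := by
  set P : Measure (Space n) := volume.withDensity fun y => ENNReal.ofReal (η y)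
  have hηm : Measurable fun y => ENNReal.ofReal (η y) := hη.measurable.ennreal_ofReal
  have hP : IsProbabilityMeasure P := ⟨by
    rw [withDensity_apply _ MeasurableSet.univ, Measure.restrict_univ,
      ← ofReal_integral_eq_lintegral_ofReal (hη.integrable_of_hasCompactSupport hηc)
        (Eventually.of_forall h0), h1, ENNReal.ofReal_one]⟩
  -- A strongly measurable representative makes the integrand jointly measurable, as Tonelli's
  -- theorem requires.
  set g := hf.1.mk f
  have hg : StronglyMeasurable g := hf.1.stronglyMeasurable_mk
  have hfg : f =ᵐ[volume] g := hf.1.ae_eq_mk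
  have hgL : MemLp g 2 volume := (memLp_congr_ae hfg).1 hf
  have hPint : ∀ u : Space n → ℝ, ∫ y, u y ∂P = ∫ y, η y * u y := fun u => by
    rw [integral_withDensity_eq_integral_toReal_smul hηm
      (Eventually.of_forall fun _ => ENNReal.ofReal_lt_top)]
    simp [ENNReal.toReal_ofReal (h0 _)]
  have hconv : ∀ x, mollify η f x = ∫ y, g (x - y) ∂P := fun x => by
    rw [hPint, mollify_apply]
    refine integral_congr_ae ?_
    filter_upwards [(Measure.measurePreserving_sub_left volume x).quasiMeasurePreserving.ae_eq_comp hfg]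
      with y hy
    simp only [Function.comp_apply] at hy
    rw [hy]
  have hint : ∀ x, Integrable (fun y => g (x - y)) P := fun x => by
    rw [integrable_withDensity_iff_integrable_smul' hηm
      (Eventually.of_forall fun _ => ENNReal.ofReal_lt_top)]
    have := hηc.convolutionExists_left (ContinuousLinearMap.lsmul ℝ ℝ) hη
      (hgL.locallyIntegrable (by norm_num)) x
    simpa [ConvolutionExistsAt, ENNReal.toReal_ofReal (h0 _)] using this
  have hpt : ∀ᵐ x, ‖mollify η f x - f x‖ₑ ^ 2 ≤ ∫⁻ y, ‖g (x - y) - g x‖ₑ ^ 2 ∂P := by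
    filter_upwards [hfg] with x hx
    rw [hconv, hx]
    have e1 : ∫ y, g (x - y) ∂P - g x = ∫ y, (g (x - y) - g x) ∂P := by
      rw [integral_sub (hint x) (integrable_const _)]; simp
    rw [e1, ← sq_eLpNorm_two]
    gcongr
    refine (enorm_integral_le_lintegral_enorm _).trans ?_
    rw [← eLpNorm_one_eq_lintegral_enorm]
    exact eLpNorm_le_eLpNorm_of_exponent_le (by norm_num)
      ((hint x).1.sub aestronglyMeasurable_const)
  have hjm : Measurable (Function.uncurry fun x y : Space n => ‖g (x - y) - g x‖ₑ ^ 2) :=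
    (((hg.measurable.comp (measurable_fst.sub measurable_snd)).sub
      (hg.measurable.comp measurable_fst)).enorm.pow_const 2)
  have hsq : eLpNorm (fun x => mollify η f x - f x) 2 volume ^ 2 ≤ c ^ 2 := by
    rw [sq_eLpNorm_two]
    refine (lintegral_mono_ae hpt).trans ?_
    rw [lintegral_lintegral_swap hjm.aemeasurable]
    calc _ ≤ ∫⁻ _, c ^ 2 ∂P := by
          refine lintegral_mono_ae ((ae_withDensity_iff hηm).2 (Eventually.of_forall fun y hy => ?_))
          rw [← sq_eLpNorm_two]
          gcongr
          refine le_trans (le_of_eq (eLpNorm_congr_ae ?_)) (hc y fun h => hy (by simp [h]))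
          filter_upwards [hfg,
            (measurePreserving_sub_right volume y).quasiMeasurePreserving.ae_eq_comp hfg]
            with x hx hxy
          simp only [Function.comp_apply] at hxy
          rw [hx, hxy]
      _ = c ^ 2 := by simp
  exact (ENNReal.pow_le_pow_left_iff two_ne_zero).1 hsq

/-- A sequence of mollifiers. -/
noncomputable def mollifierBump (n k : ℕ) : ContDiffBump (0 : Space n) where
  rIn := 1 / (2 * (k + 1))
  rOut := 1 / (k + 1)
  rIn_pos := by positivity
  rIn_lt_rOut := by
    apply one_div_lt_one_div_of_lt <;> linarith [Nat.cast_nonneg (α := ℝ) k]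

/-- The normalised mollifiers. -/
noncomputable def mollifier (n k : ℕ) : Space n → ℝ := (mollifierBump n k).normed volume

lemma contDiff_mollifier (n k : ℕ) : ContDiff ℝ ∞ (mollifier n k) :=
  (mollifierBump n k).contDiff_normed

lemma hasCompactSupport_mollifier (n k : ℕ) : HasCompactSupport (mollifier n k) :=
  (mollifierBump n k).hasCompactSupport_normed

lemma support_mollifier (n k : ℕ) :
    Function.support (mollifier n k) = Metric.ball 0 (1 / (k + 1)) :=
  (mollifierBump n k).support_normed_eq

lemma tendsto_mollify {n : ℕ} {f : Space n → ℝ} (hf : MemLp f 2 volume) :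
    L2Tendsto volume (fun k => mollify (mollifier n k) f) f := by
  refine ENNReal.tendsto_nhds_zero.2 fun ε hε => ?_
  obtain ⟨δ, hδ, hb⟩ := Metric.eventually_nhds_iff_ball.1
    (ENNReal.tendsto_nhds_zero.1 (tendsto_eLpNorm_translate hf) ε hε)
  have : ∀ᶠ k : ℕ in atTop, 1 / ((k : ℝ) + 1) < δ :=
    tendsto_one_div_add_atTop_nhds_zero_nat.eventually (gt_mem_nhds hδ)
  filter_upwards [this] with k hk
  refine eLpNorm_mollify_sub_le (contDiff_mollifier n k).continuous
    (hasCompactSupport_mollifier n k) ((mollifierBump n k).nonneg_normed)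
    ((mollifierBump n k).integral_normed) hf fun y hy => hb y ?_
  have : y ∈ Metric.ball (0 : Space n) (1 / (k + 1)) := by rw [← support_mollifier]; exact hy
  exact Metric.ball_subset_ball hk.le this

/-- The classical derivatives of the mollification are the mollifications of the weak ones. -/
lemma partialDeriv_mollify {n : ℕ} {η f : Space n → ℝ} {Df : Fin (n + 1) → Space n → ℝ}
    (hη : ContDiff ℝ ∞ η) (hηc : HasCompactSupport η) (hf : MemH1 univ f Df) (j : Fin (n + 1)) :
    partialDeriv j (mollify η f) = mollify η (Df j) := by
  have hfL : MemLp f 2 volume := by simpa using hf.memLp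
  funext x
  have hloc := hfL.locallyIntegrable (by norm_num)
  have h1 := hηc.hasFDerivAt_convolution_left (ContinuousLinearMap.lsmul ℝ ℝ) (μ := volume)
    (hη.of_le (by simp)) hloc x
  rw [partialDeriv, mollify, h1.fderiv]
  have hex := (hηc.fderiv ℝ).convolutionExists_left
    (ContinuousLinearMap.precompL (Space n) (ContinuousLinearMap.lsmul ℝ ℝ)) (μ := volume)
    (hη.continuous_fderiv (by simp)) hloc x
  have h6 : (convolution (fderiv ℝ η) f (ContinuousLinearMap.precompL (Space n)
      (ContinuousLinearMap.lsmul ℝ ℝ)) volume x) (EuclideanSpace.single j 1)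
      = convolution (partialDeriv j η) f (ContinuousLinearMap.lsmul ℝ ℝ) volume x := by
    rw [convolution_def, convolution_def, ContinuousLinearMap.integral_apply hex]
    rfl
  rw [h6]
  have h2 : ∀ t, partialDeriv j (fun t => η (x - t)) t = -partialDeriv j η (x - t) := fun t => by
    have h3 : HasFDerivAt (fun t => x - t) (-ContinuousLinearMap.id ℝ (Space n)) t :=
      (hasFDerivAt_id t).const_sub x
    have h4 := ((hη.differentiable (by simp) (x - t)).hasFDerivAt).comp t h3
    rw [partialDeriv, show (fun t => η (x - t)) = η ∘ fun t => x - t from rfl, h4.fderiv]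
    simp [partialDeriv]
  -- The weak derivative is tested with the reflected and translated mollifier t ↦ η(x - t); the
  -- reflection cancels the sign.
  have h5 := hf.weak_deriv (fun t => η (x - t)) (hη.comp (contDiff_const.sub contDiff_id))
    (hηc.comp_homeomorph (Homeomorph.subLeft x)) (subset_univ _) j
  simp only [h2, Measure.restrict_univ] at h5
  rw [convolution_eq_swap, mollify, convolution_eq_swap]
  simp only [ContinuousLinearMap.lsmul_apply, smul_eq_mul]
  have e : ∫ t, f t * -partialDeriv j η (x - t) = -∫ t, partialDeriv j η (x - t) * f t := by
    rw [← integral_neg]; congr 1; funext t; ring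
  rw [e, neg_inj] at h5
  simp only [mul_comm (Df j _)] at h5
  exact h5

/-! ### Limits of smooth functions in `H¹` -/

lemma Continuous.exists_abs_le_of_isBounded {n : ℕ} {f : Space n → ℝ} (hf : Continuous f)
    {s : Set (Space n)} (hs : Bornology.IsBounded s) : ∃ C, ∀ x ∈ s, |f x| ≤ C := by
  obtain ⟨C, hC⟩ := hs.isCompact_closure.exists_bound_of_continuousOn hf.continuousOn
  exact ⟨C, fun x hx => hC x (subset_closure hx)⟩

lemma Continuous.memLp_two_of_isBounded {n : ℕ} {f : Space n → ℝ} (hf : Continuous f)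
    {μ : Measure (Space n)} {s : Set (Space n)} (hs : MeasurableSet s)
    (hb : Bornology.IsBounded s) [IsFiniteMeasure (μ.restrict s)] : MemLp f 2 (μ.restrict s) := by
  obtain ⟨C, hC⟩ := hf.exists_abs_le_of_isBounded hb
  exact MemLp.of_bound hf.aestronglyMeasurable C (ae_restrict_of_forall_mem hs hC)

lemma Bornology.IsBounded.isFiniteMeasure_restrict_volume {n : ℕ} {s : Set (Space n)}
    (hb : Bornology.IsBounded s) : IsFiniteMeasure ((volume : Measure (Space n)).restrict s) :=
  ⟨by rw [Measure.restrict_apply_univ]; exact hb.measure_lt_top⟩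

lemma MeasureTheory.MemLp.integrable_mul_two {X : Type*} [MeasurableSpace X] {μ : Measure X}
    {f g : X → ℝ} (hf : MemLp f 2 μ) (hg : MemLp g 2 μ) : Integrable (fun x => f x * g x) μ :=
  hf.integrable_mul hg

lemma MeasureTheory.MemLp.mul_continuous {n : ℕ} {f c : Space n → ℝ} {U : Set (Space n)}
    (hf : MemLp f 2 (volume.restrict U)) (hc : Continuous c) (hU : MeasurableSet U)
    (hb : Bornology.IsBounded U) : MemLp (fun x => c x * f x) 2 (volume.restrict U) := by
  obtain ⟨C, hC⟩ := hc.exists_abs_le_of_isBounded hb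
  refine hf.of_le_mul (c := C) (hc.aestronglyMeasurable.mul hf.1) ?_
  refine ae_restrict_of_forall_mem hU fun x hx => ?_
  rw [norm_mul]
  gcongr
  exact hC x hx

lemma integral_mul_partialDeriv {n : ℕ} {f g : Space n → ℝ} (hf : ContDiff ℝ ∞ f)
    (hg : ContDiff ℝ ∞ g) (hc : HasCompactSupport g) (j : Fin (n + 1)) :
    ∫ x, f x * partialDeriv j g x = -∫ x, partialDeriv j f x * g x := by
  refine integral_mul_fderiv_eq_neg_fderiv_mul_of_integrable ?_ ?_ ?_
    (fun x _ => hf.differentiable (by simp) x) (fun x _ => hg.differentiable (by simp) x)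
  · exact ((contDiff_partialDeriv hf j).continuous.mul hg.continuous).integrable_of_hasCompactSupport
      hc.mul_left
  · exact (hf.continuous.mul (contDiff_partialDeriv hg j).continuous).integrable_of_hasCompactSupport
      (hc.fderiv_apply ℝ _).mul_left
  · exact (hf.continuous.mul hg.continuous).integrable_of_hasCompactSupport hc.mul_left

lemma partialDeriv_eq_zero_of_notMem_tsupport {n : ℕ} {f : Space n → ℝ} {x : Space n}
    (hx : x ∉ tsupport f) (j : Fin (n + 1)) : partialDeriv j f x = 0 := by
  rw [partialDeriv, fderiv_of_notMem_tsupport ℝ hx]; rfl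

lemma ae_eq_zero_of_forall_test {n : ℕ} {U : Set (Space n)} (hU : IsOpen U) {f : Space n → ℝ}
    (hf : MemLp f 2 (volume.restrict U))
    (h : ∀ τ : Space n → ℝ, ContDiff ℝ ∞ τ → HasCompactSupport τ → tsupport τ ⊆ U →
      ∫ x in U, f x * τ x = 0) : f =ᵐ[volume.restrict U] 0 := by
  have hl : LocallyIntegrableOn f U volume :=
    locallyIntegrableOn_of_locallyIntegrable_restrict (hf.locallyIntegrable (by norm_num))
  have h1 := hU.ae_eq_zero_of_integral_contDiff_smul_eq_zero hl fun τ h1 h2 h3 => by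
    rw [← h τ h1 h2 h3]
    rw [setIntegral_eq_integral_of_forall_compl_eq_zero fun x hx => by
      rw [image_eq_zero_of_notMem_tsupport fun h => hx (h3 h), mul_zero]]
    simp [mul_comm]
  exact (ae_restrict_iff' hU.measurableSet).2 h1

lemma MemH1.deriv_ae_eq {n : ℕ} {U : Set (Space n)} (hU : IsOpen U) {f : Space n → ℝ}
    {Df Df' : Fin (n + 1) → Space n → ℝ} (h : MemH1 U f Df) (h' : MemH1 U f Df')
    (j : Fin (n + 1)) : Df j =ᵐ[volume.restrict U] Df' j := by
  have h1 := ae_eq_zero_of_forall_test hU ((h.memLp_deriv j).sub (h'.memLp_deriv j))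
    fun τ h1 h2 h3 => by
      have e1 := h.weak_deriv τ h1 h2 h3 j
      have e2 := h'.weak_deriv τ h1 h2 h3 j
      have hτ : MemLp τ 2 (volume.restrict U) :=
        (h1.continuous.memLp_of_hasCompactSupport h2).restrict U
      simp only [Pi.sub_apply, sub_mul]
      rw [integral_sub ((h.memLp_deriv j).integrable_mul_two hτ) ((h'.memLp_deriv j).integrable_mul_two hτ)]
      linarith
  filter_upwards [h1] with x hx
  simpa [sub_eq_zero] using hx

/-- The smooth functions `φ k` converge to `f` in `H¹(U)`, where the derivatives of the limit are
`Df`. -/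
structure IsH1Limit {n : ℕ} (U : Set (Space n)) (φ : ℕ → Space n → ℝ) (f : Space n → ℝ)
    (Df : Fin (n + 1) → Space n → ℝ) : Prop where
  contDiff : ∀ k, ContDiff ℝ ∞ (φ k)
  memLp : MemLp f 2 (volume.restrict U)
  memLp_deriv : ∀ j, MemLp (Df j) 2 (volume.restrict U)
  tendsto : L2Tendsto (volume.restrict U) φ f
  tendsto_deriv : ∀ j, L2Tendsto (volume.restrict U) (fun k => partialDeriv j (φ k)) (Df j)

/-- A trace comes with some weak gradient; uniqueness of weak derivatives allows the prescribed one
to be used instead. -/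
lemma HasTrace.exists_isH1Limit {n : ℕ} {U Γ : Set (Space n)} (hU : IsOpen U)
    {f a : Space n → ℝ} {Df : Fin (n + 1) → Space n → ℝ} (h : HasTrace U Γ f a)
    (hD : MemH1 U f Df) : ∃ φ, IsH1Limit U φ f Df ∧ L2Tendsto (surfaceMeasure Γ) φ a := by
  obtain ⟨Df', hD', -, φ, h1, h2, h3, h4⟩ := h
  refine ⟨φ, ⟨h1, hD.memLp, hD.memLp_deriv, h2, fun j => ?_⟩, h4⟩
  exact L2Tendsto.congr' (h3 j) (fun k => EventuallyEq.rfl) (hD'.deriv_ae_eq hU hD j)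

namespace IsH1Limit

variable {n : ℕ} {U V Γ : Set (Space n)} {φ ψ : ℕ → Space n → ℝ} {f g a : Space n → ℝ}
  {Df Dg : Fin (n + 1) → Space n → ℝ}

lemma mono (h : IsH1Limit U φ f Df) (hV : V ⊆ U) : IsH1Limit V φ f Df where
  contDiff := h.contDiff
  memLp := h.memLp.mono_measure (Measure.restrict_mono_set _ hV)
  memLp_deriv j := (h.memLp_deriv j).mono_measure (Measure.restrict_mono_set _ hV)
  tendsto := h.tendsto.mono_measure (Measure.restrict_mono_set _ hV)
  tendsto_deriv j := (h.tendsto_deriv j).mono_measure (Measure.restrict_mono_set _ hV)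

lemma congr (h : IsH1Limit U φ f Df) (hf : f =ᵐ[volume.restrict U] g)
    (hD : ∀ j, Df j =ᵐ[volume.restrict U] Dg j) : IsH1Limit U φ g Dg where
  contDiff := h.contDiff
  memLp := (memLp_congr_ae hf).1 h.memLp
  memLp_deriv j := (memLp_congr_ae (hD j)).1 (h.memLp_deriv j)
  tendsto := h.tendsto.congr' (fun _ => EventuallyEq.rfl) hf
  tendsto_deriv j := (h.tendsto_deriv j).congr' (fun _ => EventuallyEq.rfl) (hD j)

lemma add (h : IsH1Limit U φ f Df) (h' : IsH1Limit U ψ g Dg) :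
    IsH1Limit U (fun k x => φ k x + ψ k x) (fun x => f x + g x) (fun j x => Df j x + Dg j x) where
  contDiff k := (h.contDiff k).add (h'.contDiff k)
  memLp := h.memLp.add h'.memLp
  memLp_deriv j := (h.memLp_deriv j).add (h'.memLp_deriv j)
  tendsto := h.tendsto.add h'.tendsto
    (fun k => (h.contDiff k).continuous.aestronglyMeasurable.sub h.memLp.1)
    (fun k => (h'.contDiff k).continuous.aestronglyMeasurable.sub h'.memLp.1)
  tendsto_deriv j := by
    refine ((h.tendsto_deriv j).add (h'.tendsto_deriv j)
      (fun k => (contDiff_partialDeriv (h.contDiff k) j).continuous.aestronglyMeasurable.sub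
        (h.memLp_deriv j).1)
      (fun k => (contDiff_partialDeriv (h'.contDiff k) j).continuous.aestronglyMeasurable.sub
        (h'.memLp_deriv j).1)).congr' (fun k => Eventually.of_forall fun x => ?_) EventuallyEq.rfl
    simp only [partialDeriv]
    rw [fderiv_fun_add ((h.contDiff k).differentiable (by simp) x)
      ((h'.contDiff k).differentiable (by simp) x)]
    rfl

lemma mul_smooth (h : IsH1Limit U φ f Df) (hU : MeasurableSet U) (hb : Bornology.IsBounded U)
    {c : Space n → ℝ} (hc : ContDiff ℝ ∞ c) :
    IsH1Limit U (fun k x => c x * φ k x) (fun x => c x * f x)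
      (fun j x => c x * Df j x + partialDeriv j c x * f x) := by
  obtain ⟨C, hC⟩ := hc.continuous.exists_abs_le_of_isBounded hb
  have hdc : ∀ j, Continuous (partialDeriv j c) := fun j => (contDiff_partialDeriv hc j).continuous
  refine ⟨fun k => hc.mul (h.contDiff k), h.memLp.mul_continuous hc.continuous hU hb, fun j =>
    ((h.memLp_deriv j).mul_continuous hc.continuous hU hb).add
      (h.memLp.mul_continuous (hdc j) hU hb),
    h.tendsto.mul_left (ae_restrict_of_forall_mem hU hC), fun j => ?_⟩
  obtain ⟨C', hC'⟩ := (hdc j).exists_abs_le_of_isBounded hb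
  refine (((h.tendsto_deriv j).mul_left (ae_restrict_of_forall_mem hU hC)).add
    (h.tendsto.mul_left (ae_restrict_of_forall_mem hU hC')) (fun k => ?_) (fun k => ?_)).congr'
    (fun k => Eventually.of_forall fun x => ?_) EventuallyEq.rfl
  · exact (hc.continuous.mul
      (contDiff_partialDeriv (h.contDiff k) j).continuous).aestronglyMeasurable.sub
      ((h.memLp_deriv j).mul_continuous hc.continuous hU hb).1
  · exact ((hdc j).mul (h.contDiff k).continuous).aestronglyMeasurable.sub
      (h.memLp.mul_continuous (hdc j) hU hb).1
  · simp only
    rw [partialDeriv_mul hc (h.contDiff k)]; ring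

lemma sub (h : IsH1Limit U φ f Df) (h' : IsH1Limit U ψ g Dg) (hU : MeasurableSet U)
    (hb : Bornology.IsBounded U) :
    IsH1Limit U (fun k x => φ k x - ψ k x) (fun x => f x - g x) (fun j x => Df j x - Dg j x) := by
  have := h.add (h'.mul_smooth hU hb (contDiff_const (c := (-1 : ℝ))))
  simpa [partialDeriv, sub_eq_add_neg] using this

/-- Classical integration by parts holds for each smooth approximant and passes to the limit. -/
lemma memH1 (h : IsH1Limit U φ f Df) (hU : IsOpen U) (hb : Bornology.IsBounded U) :
    MemH1 U f Df where
  memLp := h.memLp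
  memLp_deriv := h.memLp_deriv
  weak_deriv τ h1 h2 h3 j := by
    have := hb.isFiniteMeasure_restrict_volume
    have hτ : MemLp τ 2 (volume.restrict U) :=
      (h1.continuous.memLp_of_hasCompactSupport h2).restrict U
    have hdτ : MemLp (partialDeriv j τ) 2 (volume.restrict U) :=
      ((contDiff_partialDeriv h1 j).continuous.memLp_of_hasCompactSupport
        (h2.fderiv_apply ℝ _)).restrict U
    have l1 := h.tendsto.integral_mul (L2Tendsto.const (partialDeriv j τ))
      (fun k => (h.contDiff k).continuous.memLp_two_of_isBounded hU.measurableSet hb)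
      (fun k => hdτ) h.memLp hdτ
    have l2 := (h.tendsto_deriv j).integral_mul (L2Tendsto.const τ)
      (fun k => (contDiff_partialDeriv (h.contDiff k) j).continuous.memLp_two_of_isBounded
        hU.measurableSet hb) (fun k => hτ) (h.memLp_deriv j) hτ
    refine tendsto_nhds_unique l1 (l2.neg.congr fun k => ?_)
    rw [setIntegral_eq_integral_of_forall_compl_eq_zero fun x hx => by
        rw [image_eq_zero_of_notMem_tsupport fun h => hx (h3 h), mul_zero],
      setIntegral_eq_integral_of_forall_compl_eq_zero fun x hx => by
        rw [partialDeriv_eq_zero_of_notMem_tsupport fun h => hx (h3 h), mul_zero],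
      integral_mul_partialDeriv (h.contDiff k) h1 h2]

lemma hasTrace (h : IsH1Limit U φ f Df) (hU : IsOpen U) (hb : Bornology.IsBounded U)
    (ha : MemLp a 2 (surfaceMeasure Γ)) (ht : L2Tendsto (surfaceMeasure Γ) φ a) :
    HasTrace U Γ f a :=
  ⟨Df, h.memH1 hU hb, ha, φ, h.contDiff, h.tendsto, h.tendsto_deriv, ht⟩

end IsH1Limit

lemma ContDiff.isH1Limit_const {n : ℕ} {f : Space n → ℝ} (hf : ContDiff ℝ ∞ f) {U : Set (Space n)}
    (hU : MeasurableSet U) (hb : Bornology.IsBounded U) :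
    IsH1Limit U (fun _ => f) f (fun j => partialDeriv j f) := by
  have := hb.isFiniteMeasure_restrict_volume
  exact ⟨fun _ => hf, hf.continuous.memLp_two_of_isBounded hU hb,
    fun j => (contDiff_partialDeriv hf j).continuous.memLp_two_of_isBounded hU hb,
    L2Tendsto.const _, fun j => L2Tendsto.const _⟩

/-- Integration by parts for the traces of `H¹` functions. -/
lemma IsGreenPair.integral_eq {n : ℕ} {U Γ : Set (Space n)} {ν : Space n → Space n}
    {χ : Space n → ℝ} (hG : IsGreenPair U Γ ν χ) (hΓ : IsCompact Γ) {φ ψ : ℕ → Space n → ℝ}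
    {f g a b : Space n → ℝ} {Df Dg : Fin (n + 1) → Space n → ℝ} (hf : IsH1Limit U φ f Df)
    (hg : IsH1Limit U ψ g Dg) (ha : MemLp a 2 (surfaceMeasure Γ))
    (hb : MemLp b 2 (surfaceMeasure Γ)) (hfa : L2Tendsto (surfaceMeasure Γ) φ a)
    (hgb : L2Tendsto (surfaceMeasure Γ) ψ b) (j : Fin (n + 1)) :
    ∫ x in U, (f x * (χ x * Dg j x + partialDeriv j χ x * g x) + Df j x * (χ x * g x))
      = ∫ x, a x * (ν x j * b x) ∂surfaceMeasure Γ := by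
  have hUm := hG.isOpen.measurableSet
  have := hG.isBounded.isFiniteMeasure_restrict_volume
  have := hG.finite
  have hsm : ∀ {u : Space n → ℝ}, Continuous u → MemLp u 2 (volume.restrict U) := fun hu =>
    hu.memLp_two_of_isBounded hUm hG.isBounded
  have hsm' : ∀ {u : Space n → ℝ}, Continuous u → MemLp u 2 (surfaceMeasure Γ) := fun hu => by
    have : IsFiniteMeasure ((Measure.euclideanHausdorffMeasure n).restrict Γ) := hG.finite
    exact hu.memLp_two_of_isBounded hΓ.isClosed.measurableSet hΓ.isBounded
  have hχg := hg.mul_smooth hUm hG.isBounded hG.contDiff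
  have l1 := hf.tendsto.integral_mul (hχg.tendsto_deriv j)
    (fun k => hsm (hf.contDiff k).continuous)
    (fun k => hsm (contDiff_partialDeriv (hχg.contDiff k) j).continuous) hf.memLp
    (hχg.memLp_deriv j)
  have l2 := (hf.tendsto_deriv j).integral_mul hχg.tendsto
    (fun k => hsm (contDiff_partialDeriv (hf.contDiff k) j).continuous)
    (fun k => hsm (hχg.contDiff k).continuous) (hf.memLp_deriv j) hχg.memLp
  have hνm : AEStronglyMeasurable (fun x => ν x j) (surfaceMeasure Γ) :=
    (by fun_prop : Continuous fun y : Space n => y j).comp_aestronglyMeasurable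
      hG.aestronglyMeasurable
  have hνb : ∀ x, |ν x j| ≤ 1 := fun x => (PiLp.norm_apply_le (ν x) j).trans (hG.norm_le x)
  have hνL : ∀ {u : Space n → ℝ}, MemLp u 2 (surfaceMeasure Γ) →
      MemLp (fun x => ν x j * u x) 2 (surfaceMeasure Γ) := fun {u} hu => by
    refine hu.of_le_mul (c := 1) (hνm.mul hu.1) (Eventually.of_forall fun x => ?_)
    rw [norm_mul]
    gcongr
    exact hνb x
  have l3 := hfa.integral_mul (hgb.mul_left (Eventually.of_forall hνb))
    (fun k => hsm' (hf.contDiff k).continuous) (fun k => hνL (hsm' (hg.contDiff k).continuous))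
    ha (hνL hb)
  rw [integral_add (hf.memLp.integrable_mul_two (hχg.memLp_deriv j))
    ((hf.memLp_deriv j).integrable_mul_two hχg.memLp)]
  refine tendsto_nhds_unique (l1.add l2) (l3.congr fun k => ?_)
  -- Green's formula for the smooth product `φ k * ψ k`; every term is an integral of products
  -- converging in `L²`.
  have h1 := hG.green (fun x => φ k x * ψ k x) ((hf.contDiff k).mul (hg.contDiff k)) j
  have h2 : ∀ x, partialDeriv j (fun x => χ x * (φ k x * ψ k x)) x
      = φ k x * partialDeriv j (fun x => χ x * ψ k x) x
        + partialDeriv j (φ k) x * (χ x * ψ k x) := fun x => by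
    rw [show (fun x => χ x * (φ k x * ψ k x)) = fun x => φ k x * (χ x * ψ k x) by
      funext x; ring, partialDeriv_mul (hf.contDiff k) (hχg.contDiff k)]
    ring
  simp_rw [h2] at h1
  rw [integral_add ((hsm (hf.contDiff k).continuous).integrable_mul_two
      (hsm (contDiff_partialDeriv (hχg.contDiff k) j).continuous))
    ((hsm (contDiff_partialDeriv (hf.contDiff k) j).continuous).integrable_mul_two
      (hsm (hχg.contDiff k).continuous))] at h1
  rw [h1]
  refine integral_congr_ae (Eventually.of_forall fun x => ?_)
  simp only; ring

/-! ### Extension by zero and density -/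

/-- Functions with zero trace on `Γ`, localised near `Γ`, can be extended by zero. -/
lemma IsGreenPair.memH1_indicator {n : ℕ} {U Γ : Set (Space n)} {ν : Space n → Space n}
    {χ : Space n → ℝ} (hG : IsGreenPair U Γ ν χ) (hΓ : IsCompact Γ) {f : Space n → ℝ}
    {Df : Fin (n + 1) → Space n → ℝ} (hf : MemH1 U f Df) (h0 : HasTrace U Γ f (fun _ => 0)) :
    MemH1 univ (U.indicator fun x => χ x * f x)
      (fun j => U.indicator fun x => χ x * Df j x + partialDeriv j χ x * f x) := by
  obtain ⟨φ, hφ, hφ0⟩ := h0.exists_isH1Limit hG.isOpen hf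
  have hUm := hG.isOpen.measurableSet
  have hχf := hφ.mul_smooth hUm hG.isBounded hG.contDiff
  refine ⟨?_, fun j => ?_, fun τ h1 h2 _ j => ?_⟩
  · rw [Measure.restrict_univ, memLp_indicator_iff_restrict hUm]; exact hχf.memLp
  · rw [Measure.restrict_univ, memLp_indicator_iff_restrict hUm]; exact hχf.memLp_deriv j
  · have hτ := h1.isH1Limit_const hUm hG.isBounded
    have := hG.finite
    have hτΓ : MemLp τ 2 (surfaceMeasure Γ) := by
      have : IsFiniteMeasure ((Measure.euclideanHausdorffMeasure n).restrict Γ) := hG.finite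
      exact h1.continuous.memLp_two_of_isBounded hΓ.isClosed.measurableSet hΓ.isBounded
    -- Because the trace is zero, the boundary term vanishes for every test function `τ`, even one
    -- that does not vanish on `Γ`. What remains is the definition of the weak derivative on the
    -- whole space.
    have h3 := hG.integral_eq hΓ hφ hτ (by simp) hτΓ hφ0 (L2Tendsto.const τ) j
    simp only [zero_mul, integral_zero] at h3
    simp only [Measure.restrict_univ]
    have e1 : ∀ u v : Space n → ℝ, ∫ x, U.indicator u x * v x = ∫ x in U, u x * v x := fun u v => by
      rw [← integral_indicator hUm]
      congr 1
      funext x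
      by_cases hx : x ∈ U <;> simp [hx]
    rw [e1, e1, eq_neg_iff_add_eq_zero, ← integral_add
      (hχf.memLp.integrable_mul_two (hτ.memLp_deriv j))
      ((hχf.memLp_deriv j).integrable_mul_two hτ.memLp), ← h3]
    refine integral_congr_ae (Eventually.of_forall fun x => ?_)
    simp only; ring

/-- `H¹` functions with compact support are limits of test functions. -/
lemma MemH1.exists_isH1Limit_univ {n : ℕ} {F : Space n → ℝ} {DF : Fin (n + 1) → Space n → ℝ}
    (h : MemH1 univ F DF) {K W : Set (Space n)} (hK : IsCompact K) (hW : IsOpen W) (hKW : K ⊆ W)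
    (h0 : ∀ x ∉ K, F x = 0) :
    ∃ φ : ℕ → Space n → ℝ, IsH1Limit univ φ F DF ∧ (∀ k, HasCompactSupport (φ k)) ∧
      ∀ k, ∀ x ∉ W, φ k x = 0 := by
  have hF : MemLp F 2 volume := by simpa using h.memLp
  obtain ⟨δ, hδ, hthick⟩ := hK.exists_thickening_subset_open hW hKW
  -- Starting the mollifiers at index `N` keeps every radius below the margin `δ` between `K` and
  -- the complement of `W`.
  obtain ⟨N, hN⟩ := exists_nat_one_div_lt hδ
  have hlim : IsH1Limit univ (fun k => mollify (mollifier n (k + N)) F) F DF := by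
    refine ⟨fun k => (hasCompactSupport_mollifier n _).contDiff_convolution_left
      (ContinuousLinearMap.lsmul ℝ ℝ) (contDiff_mollifier n _)
      (hF.locallyIntegrable (by norm_num)), h.memLp, h.memLp_deriv, ?_, fun j => ?_⟩
    · rw [Measure.restrict_univ]
      exact (tendsto_mollify hF).comp (tendsto_add_atTop_nat N)
    · have hD : MemLp (DF j) 2 volume := by simpa using h.memLp_deriv j
      rw [Measure.restrict_univ]
      simp_rw [partialDeriv_mollify (contDiff_mollifier n _) (hasCompactSupport_mollifier n _) h]
      exact (tendsto_mollify hD).comp (tendsto_add_atTop_nat N)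
  have hsF : Function.support F ⊆ K := fun x hx => by
    by_contra h; exact hx (h0 x h)
  refine ⟨_, hlim, fun k => (hasCompactSupport_mollifier n _).convolution _
    (HasCompactSupport.of_support_subset_isCompact hK hsF), fun k x hx => ?_⟩
  by_contra hne
  have hx' := support_convolution_subset (ContinuousLinearMap.lsmul ℝ ℝ) (μ := volume)
    (show x ∈ Function.support (mollify (mollifier n (k + N)) F) from hne)
  rw [support_mollifier] at hx'
  obtain ⟨y, hy, z, hz, rfl⟩ := hx'
  refine hx (hthick (Metric.mem_thickening_iff.2 ⟨z, hsF hz, ?_⟩))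
  simp only [dist_add_self_left]
  refine (mem_ball_zero_iff.1 hy).trans_le (le_trans ?_ hN.le)
  apply one_div_le_one_div_of_le (by positivity)
  push_cast; linarith [Nat.cast_nonneg (α := ℝ) k]

lemma partialDeriv_comm {n : ℕ} {f : Space n → ℝ} (hf : ContDiff ℝ ∞ f) (i j : Fin (n + 1))
    (x : Space n) : partialDeriv i (partialDeriv j f) x = partialDeriv j (partialDeriv i f) x := by
  have hd : DifferentiableAt ℝ (fderiv ℝ f) x :=
    (hf.fderiv_right (m := ∞) (by simp)).differentiable (by simp) x
  have key : ∀ i j : Fin (n + 1), partialDeriv i (partialDeriv j f) x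
      = fderiv ℝ (fderiv ℝ f) x (EuclideanSpace.single i 1) (EuclideanSpace.single j 1) :=
    fun i j => by
      unfold partialDeriv
      rw [fderiv_clm_apply hd (differentiableAt_const _)]
      simp
  rw [key, key]
  exact (hf.contDiffAt.isSymmSndFDerivAt
    (by simpa using (WithTop.coe_le_coe.2 le_top : ((2 : ℕ∞) : WithTop ℕ∞) ≤ ∞))).eq _ _

/-- The key identity behind Korn's inequality on `ℝ^d`. -/
lemma integral_sum_deriv_mul_deriv_nonneg {n : ℕ} {W : Fin (n + 1) → Space n → ℝ}
    {DW : Fin (n + 1) → Fin (n + 1) → Space n → ℝ} (h : ∀ i, MemH1 univ (W i) (DW i))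
    {K : Set (Space n)} (hK : IsCompact K) (h0 : ∀ i, ∀ x ∉ K, W i x = 0) :
    0 ≤ ∑ i, ∑ j, ∫ x, DW i j x * DW j i x := by
  choose φ hφ hc _ using fun i =>
    (h i).exists_isH1Limit_univ hK isOpen_univ (subset_univ _) (h0 i)
  have hm : ∀ i j k, MemLp (partialDeriv j (φ i k)) 2 volume := fun i j k =>
    (contDiff_partialDeriv ((hφ i).contDiff k) j).continuous.memLp_of_hasCompactSupport
      ((hc i k).fderiv_apply ℝ _)
  have hl : ∀ i j, Tendsto (fun k => ∫ x, partialDeriv j (φ i k) x * partialDeriv i (φ j k) x)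
      atTop (𝓝 (∫ x, DW i j x * DW j i x)) := fun i j => by
    have h1 := (hφ i).tendsto_deriv j
    have h2 := (hφ j).tendsto_deriv i
    rw [Measure.restrict_univ] at h1 h2
    exact h1.integral_mul h2 (hm i j) (hm j i) (by simpa using (hφ i).memLp_deriv j)
      (by simpa using (hφ j).memLp_deriv i)
  refine ge_of_tendsto' (tendsto_finsetSum _ fun i _ => tendsto_finsetSum _ fun j _ => hl i j)
    fun k => ?_
  -- Two integrations by parts and the symmetry of second derivatives interchange the two
  -- derivatives. After summation over i and j the integrand is the square of the divergence.
  have e : ∀ i j, ∫ x, partialDeriv j (φ i k) x * partialDeriv i (φ j k) x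
      = ∫ x, partialDeriv i (φ i k) x * partialDeriv j (φ j k) x := fun i j => by
    rw [integral_mul_partialDeriv (contDiff_partialDeriv ((hφ i).contDiff k) j)
        ((hφ j).contDiff k) (hc j k),
      integral_mul_partialDeriv (contDiff_partialDeriv ((hφ i).contDiff k) i)
        ((hφ j).contDiff k) (hc j k)]
    simp_rw [partialDeriv_comm ((hφ i).contDiff k) i j]
  simp_rw [e]
  have hi : ∀ i j, Integrable (fun x => partialDeriv i (φ i k) x * partialDeriv j (φ j k) x)
      volume := fun i j => (hm i i k).integrable_mul_two (hm j j k)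
  simp_rw [fun i => (integral_finsetSum Finset.univ fun j _ => hi i j).symm]
  rw [← integral_finsetSum _ fun i _ => integrable_finsetSum _ fun j _ => hi i j]
  refine integral_nonneg fun x => ?_
  simp only [Pi.zero_apply]
  rw [← Finset.sum_mul_sum]
  exact mul_self_nonneg _

/-! ### The Frobenius product -/

/-- The Frobenius product of matrices. -/
def frobProd {m : ℕ} (A B : Matrix (Fin m) (Fin m) ℝ) : ℝ := ∑ i, ∑ j, A i j * B i j

lemma frobProd_comm {m : ℕ} (A B : Matrix (Fin m) (Fin m) ℝ) :
    frobProd A B = frobProd B A := by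
  simp only [frobProd, mul_comm]

lemma frobProd_add_right {m : ℕ} (A B C : Matrix (Fin m) (Fin m) ℝ) :
    frobProd A (B + C) = frobProd A B + frobProd A C := by
  simp [frobProd, mul_add, Finset.sum_add_distrib]

lemma frobProd_sub_right {m : ℕ} (A B C : Matrix (Fin m) (Fin m) ℝ) :
    frobProd A (B - C) = frobProd A B - frobProd A C := by
  simp [frobProd, mul_sub, Finset.sum_sub_distrib]

lemma frobProd_transpose {m : ℕ} (A B : Matrix (Fin m) (Fin m) ℝ) :
    frobProd A.transpose B = frobProd A B.transpose := by
  simp only [frobProd, Matrix.transpose_apply]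
  exact Finset.sum_comm

lemma frobProd_smul_one {m : ℕ} (A : Matrix (Fin m) (Fin m) ℝ) (c : ℝ) :
    frobProd A (c • 1) = c * A.trace := by
  simp [frobProd, Matrix.one_apply, Matrix.trace, Finset.mul_sum, mul_comm]

/-- The pressure meets `B` only through its trace. -/
lemma frobProd_stress {n : ℕ} (Du : Space n → Matrix (Fin (n + 1)) (Fin (n + 1)) ℝ)
    (p : Space n → ℝ) (x : Space n) {B : Matrix (Fin (n + 1)) (Fin (n + 1)) ℝ}
    (hB : B.trace = 0) :
    frobProd (stress Du p x) B = frobProd (Du x) B + frobProd (Du x) B.transpose := by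
  rw [stress, frobProd_comm, frobProd_sub_right, frobProd_add_right, frobProd_smul_one, hB,
    frobProd_comm B (Du x), frobProd_comm B, frobProd_transpose]
  ring

/-- All entries of `A` are in `L²(U)`. -/
def MatrixMemL2 {n : ℕ} (U : Set (Space n))
    (A : Space n → Matrix (Fin (n + 1)) (Fin (n + 1)) ℝ) : Prop :=
  ∀ i j, MemLp (fun x => A x i j) 2 (volume.restrict U)

namespace MatrixMemL2

variable {n : ℕ} {U V : Set (Space n)} {A B : Space n → Matrix (Fin (n + 1)) (Fin (n + 1)) ℝ}

lemma integrable_frobProd (hA : MatrixMemL2 U A) (hB : MatrixMemL2 U B) :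
    IntegrableOn (fun x => frobProd (A x) (B x)) U :=
  integrable_finsetSum _ fun i _ => integrable_finsetSum _ fun j _ =>
    (hA i j).integrable_mul_two (hB i j)

lemma mono (hA : MatrixMemL2 U A) (hV : V ⊆ U) : MatrixMemL2 V A := fun i j =>
  (hA i j).mono_measure (Measure.restrict_mono_set _ hV)

lemma transpose (hA : MatrixMemL2 U A) : MatrixMemL2 U (fun x => (A x).transpose) :=
  fun i j => hA j i

lemma sub (hA : MatrixMemL2 U A) (hB : MatrixMemL2 U B) : MatrixMemL2 U (fun x => A x - B x) :=
  fun i j => (hA i j).sub (hB i j)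

lemma indicator (hA : MatrixMemL2 V A) (hV : MeasurableSet V) :
    MatrixMemL2 U (V.indicator A) := fun i j => by
  have : (fun x => V.indicator A x i j) = V.indicator fun x => A x i j := by
    funext x
    by_cases hx : x ∈ V <;> simp [hx]
  rw [this]
  exact ((memLp_indicator_iff_restrict hV).2 (hA i j)).restrict U

end MatrixMemL2

/-! ### Testing the weak Stokes equation with limits of smooth fields -/

namespace IsStokesSolution

variable {n : ℕ} {U : Set (Space n)} {u : Space n → Space n}
  {Du : Space n → Matrix (Fin (n + 1)) (Fin (n + 1)) ℝ} {p : Space n → ℝ}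

lemma matrixMemL2 (h : IsStokesSolution U u Du p) : MatrixMemL2 U Du := fun i j =>
  (h.memH1 i).memLp_deriv j

lemma matrixMemL2_stress (h : IsStokesSolution U u Du p) : MatrixMemL2 U (stress Du p) :=
  fun i j => by
    have h1 := ((h.matrixMemL2 i j).add (h.matrixMemL2 j i)).sub
      (h.memLp_pressure.mul_const ((1 : Matrix (Fin (n + 1)) (Fin (n + 1)) ℝ) i j))
    exact h1

/-- The weak formulation for test fields that are limits of smooth fields whose boundary values
tend to zero. -/
lemma integral_frobProd_eq_zero (h : IsStokesSolution U u Du p) (hU : IsOpen U)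
    (hb : Bornology.IsBounded U) {φ : Fin (n + 1) → ℕ → Space n → ℝ}
    {w : Fin (n + 1) → Space n → ℝ} {Dw : Space n → Matrix (Fin (n + 1)) (Fin (n + 1)) ℝ}
    (hφ : ∀ i, IsH1Limit U (φ i) (w i) (fun j x => Dw x i j))
    (h0 : ∀ i, L2Tendsto (surfaceMeasure (frontier U)) (φ i) (fun _ => 0)) :
    ∫ x in U, frobProd (stress Du p x) (Dw x) = 0 :=
  h.momentum (fun x => WithLp.toLp 2 fun i => w i x) Dw
    (fun i => (hφ i).memH1 hU hb) (fun i => (hφ i).hasTrace hU hb (by simp) (h0 i))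

/-- The duality pairing in terms of an extension of the boundary values. -/
lemma integral_cutoff_eq (h : IsStokesSolution U u Du p) (hU : IsOpen U)
    (hb : Bornology.IsBounded U) {χ : Space n → ℝ} {φ : Fin (n + 1) → ℕ → Space n → ℝ}
    {v y : Fin (n + 1) → Space n → ℝ} {Dv Dy : Space n → Matrix (Fin (n + 1)) (Fin (n + 1)) ℝ}
    (hv : MatrixMemL2 U Dv) (hy : MatrixMemL2 U Dy)
    (hφ : ∀ i, IsH1Limit U (φ i) (fun x => (1 - χ x) * v i x - y i x)
      (fun j x => (1 - χ x) * Dv x i j - partialDeriv j χ x * v i x - Dy x i j))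
    (h0 : ∀ i, L2Tendsto (surfaceMeasure (frontier U)) (φ i) (fun _ => 0)) :
    ∫ x in U, ∑ i, ∑ j, stress Du p x i j * (χ x * Dv x i j + v i x * partialDeriv j χ x)
      = (∫ x in U, frobProd (stress Du p x) (Dv x)) - ∫ x in U, frobProd (stress Du p x) (Dy x) := by
  -- The gradient of the test field (1 - χ)v - y. Its zero boundary values mean that y carries the
  -- values of v where χ = 0 and vanishes where χ = 1.
  set E : Space n → Matrix (Fin (n + 1)) (Fin (n + 1)) ℝ := fun x => Matrix.of fun i j =>
    (1 - χ x) * Dv x i j - partialDeriv j χ x * v i x - Dy x i j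
  have hEL : MatrixMemL2 U E := fun i j => (hφ i).memLp_deriv j
  have h1 : ∫ x in U, frobProd (stress Du p x) (E x) = 0 :=
    h.integral_frobProd_eq_zero hU hb (Dw := E) hφ h0
  have hσ := h.matrixMemL2_stress
  have e : ∀ x, ∑ i, ∑ j, stress Du p x i j * (χ x * Dv x i j + v i x * partialDeriv j χ x)
      = frobProd (stress Du p x) (Dv x) - frobProd (stress Du p x) (Dy x)
        - frobProd (stress Du p x) (E x) := fun x => by
    simp only [frobProd, ← Finset.sum_sub_distrib]
    refine Finset.sum_congr rfl fun i _ => Finset.sum_congr rfl fun j _ => ?_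
    simp only [E, Matrix.of_apply]
    ring
  simp_rw [e]
  have hi : IntegrableOn (fun x => frobProd (stress Du p x) (Dv x)
      - frobProd (stress Du p x) (Dy x)) U :=
    (hσ.integrable_frobProd hv).sub (hσ.integrable_frobProd hy)
  rw [integral_sub hi (hσ.integrable_frobProd hEL), integral_sub (hσ.integrable_frobProd hv)
    (hσ.integrable_frobProd hy), h1, sub_zero]

end IsStokesSolution

/-! ### Traces on two boundary components -/

/-- In terms of squared norms, convergence on two boundary pieces adds up to convergence on their
union. -/
lemma l2Tendsto_iff_lintegral {X : Type*} [MeasurableSpace X] {μ : Measure X}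
    {φ : ℕ → X → ℝ} {f : X → ℝ} :
    L2Tendsto μ φ f ↔ Tendsto (fun k => ∫⁻ x, ‖φ k x - f x‖ₑ ^ 2 ∂μ) atTop (𝓝 0) := by
  simp_rw [← sq_eLpNorm_two]
  constructor
  · intro h
    simpa using ENNReal.Tendsto.pow (n := 2) h
  · intro h
    have h1 := (ENNReal.continuous_rpow_const (y := 1 / 2)).tendsto 0 |>.comp h
    simp only [Function.comp_def, ← ENNReal.rpow_natCast, ← ENNReal.rpow_mul] at h1
    simpa [L2Tendsto] using h1

lemma L2Tendsto.surfaceMeasure_union {n : ℕ} {Γ Γ' : Set (Space n)} {φ : ℕ → Space n → ℝ}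
    {f : Space n → ℝ} (h : L2Tendsto (surfaceMeasure Γ) φ f)
    (h' : L2Tendsto (surfaceMeasure Γ') φ f) : L2Tendsto (surfaceMeasure (Γ ∪ Γ')) φ f := by
  rw [l2Tendsto_iff_lintegral] at *
  have h1 := h.add h'
  rw [add_zero] at h1
  refine tendsto_of_tendsto_of_tendsto_of_le_of_le tendsto_const_nhds h1 (fun _ => zero_le)
    fun k => lintegral_union_le _ _ _

lemma L2Tendsto.of_eqOn {n : ℕ} {Γ : Set (Space n)} (hΓ : MeasurableSet Γ)
    {φ ψ : ℕ → Space n → ℝ} {f g : Space n → ℝ} (h : L2Tendsto (surfaceMeasure Γ) φ f)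
    (hφ : ∀ k, ∀ x ∈ Γ, φ k x = ψ k x) (hf : ∀ x ∈ Γ, f x = g x) :
    L2Tendsto (surfaceMeasure Γ) ψ g :=
  h.congr' (fun k => ae_restrict_of_forall_mem hΓ (hφ k)) (ae_restrict_of_forall_mem hΓ hf)

/-- Two sequences with the same trace. -/
lemma L2Tendsto.sub_self {n : ℕ} {Γ : Set (Space n)} {φ ψ : ℕ → Space n → ℝ} {a : Space n → ℝ}
    (h : L2Tendsto (surfaceMeasure Γ) φ a) (h' : L2Tendsto (surfaceMeasure Γ) ψ a)
    (hφ : ∀ k, Continuous (φ k)) (hψ : ∀ k, Continuous (ψ k))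
    (ha : MemLp a 2 (surfaceMeasure Γ)) :
    L2Tendsto (surfaceMeasure Γ) (fun k x => φ k x - ψ k x) (fun _ => 0) := by
  have h1 := h.add (h'.mul_left (c := fun _ => -1) (C := 1) (Eventually.of_forall fun x => by simp))
    (fun k => (hφ k).aestronglyMeasurable.sub ha.1)
    (fun k => (continuous_const.mul (hψ k)).aestronglyMeasurable.sub
      (aestronglyMeasurable_const.mul ha.1))
  refine h1.congr' (fun k => Eventually.of_forall fun x => ?_) (Eventually.of_forall fun x => ?_)
  · ring
  · ring

lemma partialDeriv_one_sub {n : ℕ} (χ : Space n → ℝ) (j : Fin (n + 1)) (x : Space n) :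
    partialDeriv j (fun x => 1 - χ x) x = -partialDeriv j χ x := by
  rw [partialDeriv, fderiv_const_sub, partialDeriv]; rfl

lemma MemH1.mono {n : ℕ} {U V : Set (Space n)} {f : Space n → ℝ}
    {Df : Fin (n + 1) → Space n → ℝ} (h : MemH1 U f Df) (hV : V ⊆ U) : MemH1 V f Df where
  memLp := h.memLp.mono_measure (Measure.restrict_mono_set _ hV)
  memLp_deriv j := (h.memLp_deriv j).mono_measure (Measure.restrict_mono_set _ hV)
  weak_deriv τ h1 h2 h3 j := by
    have hz : ∀ x ∉ V, τ x = 0 := fun x hx =>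
      image_eq_zero_of_notMem_tsupport fun h => hx (h3 h)
    have hdz : ∀ x ∉ V, partialDeriv j τ x = 0 := fun x hx =>
      partialDeriv_eq_zero_of_notMem_tsupport (fun h => hx (h3 h)) j
    have e := h.weak_deriv τ h1 h2 (h3.trans hV) j
    rw [setIntegral_eq_integral_of_forall_compl_eq_zero fun x hx => by
        rw [hdz x fun h => hx (hV h), mul_zero],
      setIntegral_eq_integral_of_forall_compl_eq_zero fun x hx => by
        rw [hz x fun h => hx (hV h), mul_zero]] at e
    rwa [setIntegral_eq_integral_of_forall_compl_eq_zero fun x hx => by rw [hdz x hx, mul_zero],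
      setIntegral_eq_integral_of_forall_compl_eq_zero fun x hx => by rw [hz x hx, mul_zero]]

/-- A function on `U` multiplied by a cut-off that vanishes near the rest of `V`. -/
lemma IsH1Limit.indicator {n : ℕ} {U V : Set (Space n)} (hU : IsOpen U) (hb : Bornology.IsBounded U)
    (hV : MeasurableSet V) (hUV : U ⊆ V) {φ : ℕ → Space n → ℝ} {f : Space n → ℝ}
    {Df : Fin (n + 1) → Space n → ℝ} (h : IsH1Limit U φ f Df) {c : Space n → ℝ}
    (hc : ContDiff ℝ ∞ c) (h0 : ∀ x ∈ V \ U, c =ᶠ[𝓝 x] 0) :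
    IsH1Limit V (fun k x => c x * φ k x) (U.indicator fun x => c x * f x)
      (fun j => U.indicator fun x => c x * Df j x + partialDeriv j c x * f x) := by
  have hcf := h.mul_smooth hU.measurableSet hb hc
  have key : ∀ {ψ : ℕ → Space n → ℝ} {g : Space n → ℝ}, L2Tendsto (volume.restrict U) ψ g →
      (∀ k, ∀ x ∈ V \ U, ψ k x = 0) → L2Tendsto (volume.restrict V) ψ (U.indicator g) := by
    intro ψ g hψ hz
    refine Tendsto.congr (fun k => ?_) hψ
    have e1 : eLpNorm (fun x => ψ k x - g x) 2 (volume.restrict U)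
        = eLpNorm (U.indicator fun x => ψ k x - g x) 2 (volume.restrict V) := by
      rw [eLpNorm_indicator_eq_eLpNorm_restrict hU.measurableSet,
        Measure.restrict_restrict hU.measurableSet, inter_eq_left.2 hUV]
    rw [e1]
    refine eLpNorm_congr_ae (ae_restrict_of_forall_mem hV fun x hx => ?_)
    by_cases hxU : x ∈ U
    · simp [hxU]
    · simp [hxU, hz k x ⟨hx, hxU⟩]
  refine ⟨hcf.contDiff, ?_, fun j => ?_, key hcf.tendsto fun k x hx => ?_, fun j =>
    key (hcf.tendsto_deriv j) fun k x hx => ?_⟩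
  · exact ((memLp_indicator_iff_restrict hU.measurableSet).2 hcf.memLp).restrict V
  · exact ((memLp_indicator_iff_restrict hU.measurableSet).2 (hcf.memLp_deriv j)).restrict V
  · simp [(h0 x hx).eq_of_nhds]
  · have : (fun x => c x * φ k x) =ᶠ[𝓝 x] fun _ => 0 := by
      filter_upwards [h0 x hx] with y hy
      simp [hy]
    rw [partialDeriv_congr this]
    simp [partialDeriv]

/-- The key inequality behind Korn's inequality for fields with zero trace. -/
lemma HasLipschitzBoundary.integral_frobProd_transpose_nonneg {n : ℕ} {A : Set (Space n)}
    (h : HasLipschitzBoundary A) (ho : IsOpen A) (hb : Bornology.IsBounded A)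
    {w : Fin (n + 1) → Space n → ℝ} {Dw : Space n → Matrix (Fin (n + 1)) (Fin (n + 1)) ℝ}
    (hw : ∀ i, MemH1 A (w i) (fun j x => Dw x i j))
    (h0 : ∀ i, HasTrace A (frontier A) (w i) (fun _ => 0)) :
    0 ≤ ∫ x in A, frobProd (Dw x) (Dw x).transpose := by
  have hc : IsCompact (frontier A) := hb.isCompact_closure.of_isClosed_subset isClosed_frontier
    frontier_subset_closure
  -- The Green pair with cut-off 1 extends the field by zero to the whole space, where the Korn
  -- identity applies.
  have h1 := fun i => (h.isGreenPair ho hb).memH1_indicator hc (hw i) (h0 i)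
  have h2 := integral_sum_deriv_mul_deriv_nonneg h1 hb.isCompact_closure fun i x hx =>
    indicator_of_notMem (fun h => hx (subset_closure h)) _
  have hL : MatrixMemL2 A Dw := fun i j => (hw i).memLp_deriv j
  have e : ∫ x in A, frobProd (Dw x) (Dw x).transpose
      = ∑ i, ∑ j, ∫ x in A, Dw x i j * Dw x j i := by
    simp only [frobProd, Matrix.transpose_apply]
    rw [integral_finsetSum _ fun i _ => integrable_finsetSum _ fun j _ =>
      (hL i j).integrable_mul_two (hL j i)]
    refine Finset.sum_congr rfl fun i _ => integral_finsetSum _ fun j _ =>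
      (hL i j).integrable_mul_two (hL j i)
  rw [e]
  refine h2.trans_eq (Finset.sum_congr rfl fun i _ => Finset.sum_congr rfl fun j _ => ?_)
  rw [← integral_indicator ho.measurableSet]
  congr 1
  funext x
  by_cases hx : x ∈ A <;> simp [hx, partialDeriv]

/-! ### The energy identities -/

lemma HasTrace.memLp_trace {n : ℕ} {U Γ : Set (Space n)} {f a : Space n → ℝ}
    (h : HasTrace U Γ f a) : MemLp a 2 (surfaceMeasure Γ) := h.choose_spec.2.1

lemma IsStokesSolution.integral_frobProd_stress_self {n : ℕ} {U : Set (Space n)}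
    {u : Space n → Space n} {Du : Space n → Matrix (Fin (n + 1)) (Fin (n + 1)) ℝ} {p : Space n → ℝ}
    (h : IsStokesSolution U u Du p) {V : Set (Space n)} (hV : V ⊆ U)
    {B : Space n → Matrix (Fin (n + 1)) (Fin (n + 1)) ℝ}
    (hB : ∀ᵐ x ∂volume.restrict V, (B x).trace = 0) (hBL : MatrixMemL2 V B) :
    ∫ x in V, frobProd (stress Du p x) (B x)
      = (∫ x in V, frobProd (Du x) (B x)) + ∫ x in V, frobProd (Du x) (B x).transpose := by
  rw [← integral_add ((h.matrixMemL2.mono hV).integrable_frobProd hBL)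
    ((h.matrixMemL2.mono hV).integrable_frobProd hBL.transpose)]
  refine integral_congr_ae ?_
  filter_upwards [hB] with x hx
  exact frobProd_stress Du p x hx

/-- The pairing with the own boundary values is the dissipated energy. -/
lemma IsStokesSolution.integral_cutoff_self {n : ℕ} {U : Set (Space n)}
    {u : Space n → Space n} {Du : Space n → Matrix (Fin (n + 1)) (Fin (n + 1)) ℝ} {p : Space n → ℝ}
    (h : IsStokesSolution U u Du p) (hU : IsOpen U) (hb : Bornology.IsBounded U)
    {χ : Space n → ℝ} (hχ : ContDiff ℝ ∞ χ) {φ : Fin (n + 1) → ℕ → Space n → ℝ}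
    (hφ : ∀ i, IsH1Limit U (φ i) (fun x => u x i) (fun j x => Du x i j))
    (h0 : ∀ i, L2Tendsto (surfaceMeasure (frontier U)) (fun k x => (1 - χ x) * φ i k x)
      (fun _ => 0)) :
    ∫ x in U, ∑ i, ∑ j, stress Du p x i j * (χ x * Du x i j + u x i * partialDeriv j χ x)
      = ∫ x in U, frobProd (stress Du p x) (Du x) := by
  have h1 := h.integral_cutoff_eq hU hb (χ := χ) (v := fun i x => u x i) (y := fun _ _ => 0)
    (Dv := Du) (Dy := fun _ => 0) h.matrixMemL2 (fun i j => by simp) (fun i =>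
      ((hφ i).mul_smooth hU.measurableSet hb (contDiff_const.sub hχ)).congr
        (Eventually.of_forall fun x => by simp)
        (fun j => Eventually.of_forall fun x => by
          simp only [partialDeriv_one_sub, Matrix.zero_apply]; ring)) h0
  rw [h1]
  simp [frobProd]

/-- The situation of the theorem: `w` is the reference field in `Ω` and `u` the field in the
domain with the hole, with the same boundary values. -/
structure IsHolePair {n : ℕ} (Ω D : Set (Space n)) (g u₀ u : Space n → Space n)
    (Du₀ Du : Space n → Matrix (Fin (n + 1)) (Fin (n + 1)) ℝ) (p₀ p : Space n → ℝ) : Prop where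
  hole : IsLipschitzHole Ω D
  stokes₀ : IsStokesSolution Ω u₀ Du₀ p₀
  values₀ : HasBoundaryValues Ω (frontier Ω) u₀ g
  stokes : IsStokesSolution (Ω \ closure D) u Du p
  values : HasBoundaryValues (Ω \ closure D) (frontier Ω) u g
  values_hole : HasBoundaryValues (Ω \ closure D) (frontier D) u (fun _ => 0)

/-! ### Comparison of the energies with and without the hole -/

namespace IsHolePair

variable {n : ℕ} {Ω D : Set (Space n)} {g u₀ u : Space n → Space n}
  {Du₀ Du : Space n → Matrix (Fin (n + 1)) (Fin (n + 1)) ℝ} {p₀ p : Space n → ℝ}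

/-- The test field (1 - χ)u₀ vanishes on `∂Ω` whatever the boundary values are. -/
lemma pairing₀_eq (h : IsHolePair Ω D g u₀ u Du₀ Du p₀ p) {W₀ : ℝ}
    (hW : IsTractionPairing Ω (frontier Ω) (stress Du₀ p₀) u₀ Du₀ W₀) :
    W₀ = ∫ x in Ω, frobProd (stress Du₀ p₀ x) (Du₀ x) := by
  obtain ⟨χ, hχ, h1, -, rfl⟩ := hW
  choose φ hφ _ using fun i => (h.values₀ i).exists_isH1Limit h.hole.isOpen (h.stokes₀.memH1 i)
  refine h.stokes₀.integral_cutoff_self h.hole.isOpen h.hole.isBounded hχ hφ fun i => ?_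
  refine (L2Tendsto.const fun _ => 0).of_eqOn isClosed_frontier.measurableSet
    (fun k x hx => ?_) fun _ _ => rfl
  simp [h1.self_of_nhdsSet x hx]

/-- The test field (1 - χ)u vanishes near `∂Ω` by the cut-off and on `∂D` by the no-slip condition.
Hence only the approximants attached to `∂D` are needed. -/
lemma pairing_eq (h : IsHolePair Ω D g u₀ u Du₀ Du p₀ p) {W : ℝ}
    (hW : IsTractionPairing (Ω \ closure D) (frontier Ω) (stress Du p) u Du W) :
    W = ∫ x in Ω \ closure D, frobProd (stress Du p x) (Du x) := by
  obtain ⟨χ, hχ, h1, h0, rfl⟩ := hW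
  rw [h.hole.frontier_diff_sdiff_outer] at h0
  choose φ hφ hφ0 using fun i =>
    (h.values_hole i).exists_isH1Limit h.hole.isOpen_diff (h.stokes.memH1 i)
  refine h.stokes.integral_cutoff_self h.hole.isOpen_diff h.hole.isBounded_diff hχ hφ fun i => ?_
  rw [h.hole.frontier_diff]
  refine L2Tendsto.surfaceMeasure_union ?_ ?_
  · refine (L2Tendsto.const fun _ => 0).of_eqOn isClosed_frontier.measurableSet
      (fun k x hx => ?_) fun _ _ => rfl
    simp [h1.self_of_nhdsSet x hx]
  · refine (hφ0 i).of_eqOn isClosed_frontier.measurableSet (fun k x hx => ?_) fun _ _ => rfl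
    simp [h0.self_of_nhdsSet x hx]

/-- The equation of `u` is tested with (1 - χ)u₀ - u. On `∂Ω` this is u₀ - u, which has zero trace;
on `∂D` it is -u, again zero. -/
lemma pairing_hole_eq (h : IsHolePair Ω D g u₀ u Du₀ Du p₀ p) {B : ℝ}
    (hB : IsTractionPairing (Ω \ closure D) (frontier D) (stress Du p) u₀ Du₀ (-B)) :
    B = (∫ x in Ω \ closure D, frobProd (stress Du p x) (Du x))
      - ∫ x in Ω \ closure D, frobProd (stress Du p x) (Du₀ x) := by
  obtain ⟨χ, hχ, h1, h0, hc⟩ := hB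
  rw [h.hole.frontier_diff_sdiff_inner] at h0
  have hUo := h.hole.isOpen_diff
  have hUb := h.hole.isBounded_diff
  have hUm := hUo.measurableSet
  choose ψ hψ hψ0 using fun i =>
    (h.values_hole i).exists_isH1Limit hUo (h.stokes.memH1 i)
  choose φ hφ hφg using fun i => (h.values i).exists_isH1Limit hUo (h.stokes.memH1 i)
  choose θ hθ hθg using fun i => (h.values₀ i).exists_isH1Limit h.hole.isOpen (h.stokes₀.memH1 i)
  have hχ' : ContDiff ℝ ∞ fun x => 1 - χ x := contDiff_const.sub hχ
  have h2 := h.stokes.integral_cutoff_eq hUo hUb (χ := χ) (v := fun i x => u₀ x i)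
    (y := fun i x => u x i) (Dv := Du₀) (Dy := Du) (h.stokes₀.matrixMemL2.mono sdiff_subset)
    h.stokes.matrixMemL2
    -- The two traces of `u` come with different approximating sequences, `φ` adapted to `∂Ω` and
    -- `ψ` to `∂D`; both converge to `u` in `H¹` and are glued by the cut-off.
    (φ := fun i k x => (1 - χ x) * θ i k x - ((1 - χ x) * φ i k x + χ x * ψ i k x))
    (fun i => ((((hθ i).mono sdiff_subset).mul_smooth hUm hUb hχ').sub
      (((hφ i).mul_smooth hUm hUb hχ').add ((hψ i).mul_smooth hUm hUb hχ)) hUm hUb).congr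
        (Eventually.of_forall fun x => by ring)
        (fun j => Eventually.of_forall fun x => by
          simp only [partialDeriv_one_sub]; ring)) (fun i => by
      rw [h.hole.frontier_diff]
      refine L2Tendsto.surfaceMeasure_union ?_ ?_
      · refine ((hθg i).sub_self (hφg i) (fun k => ((hθ i).contDiff k).continuous)
          (fun k => ((hφ i).contDiff k).continuous) (h.values i).memLp_trace).of_eqOn
          isClosed_frontier.measurableSet (fun k x hx => ?_) fun _ _ => rfl
        simp [h0.self_of_nhdsSet x hx]
      · refine ((hψ0 i).mul_left (c := fun _ => -1) (C := 1)
          (Eventually.of_forall fun x => by simp)).of_eqOn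
          isClosed_frontier.measurableSet (fun k x hx => ?_) fun _ _ => ?_
        · simp [h1.self_of_nhdsSet x hx]
        · simp)
  rw [h2] at hc
  linarith

/-- The gradient of the extension of `u` by zero, minus that of `u₀`. -/
noncomputable def gradDiff (Ω D : Set (Space n))
    (Du₀ Du : Space n → Matrix (Fin (n + 1)) (Fin (n + 1)) ℝ) (x : Space n) :
    Matrix (Fin (n + 1)) (Fin (n + 1)) ℝ :=
  (Ω \ closure D).indicator Du x - Du₀ x

/-- The extension of `u` by zero has the same boundary values on `∂Ω` as `u₀`. -/
lemma exists_isH1Limit_sub (h : IsHolePair Ω D g u₀ u Du₀ Du p₀ p) (i : Fin (n + 1)) :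
    ∃ φ : ℕ → Space n → ℝ, IsH1Limit Ω φ
      (fun x => (Ω \ closure D).indicator (fun x => u x i) x - u₀ x i)
      (fun j x => gradDiff Ω D Du₀ Du x i j) ∧
      L2Tendsto (surfaceMeasure (frontier Ω)) φ (fun _ => 0) := by
  have hUo := h.hole.isOpen_diff
  have hUb := h.hole.isBounded_diff
  have hΩm := h.hole.isOpen.measurableSet
  have hΩb := h.hole.isBounded
  obtain ⟨χ, hχ, hχc, hχs, hχ1, hχ0⟩ := h.hole.exists_cutoff_hole
  have hχ' : ContDiff ℝ ∞ fun x => 1 - χ x := contDiff_const.sub hχ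
  obtain ⟨φ, hφ, hφg⟩ := (h.values i).exists_isH1Limit hUo (h.stokes.memH1 i)
  obtain ⟨θ, hθ, hθg⟩ := (h.values₀ i).exists_isH1Limit h.hole.isOpen (h.stokes₀.memH1 i)
  have hG := h.hole.isGreenPair_inner hχ
    (hχ1.filter_mono (nhdsSet_mono frontier_subset_closure)) hχ0
  have hDc : IsCompact (frontier D) := h.hole.isBounded_hole.isCompact_closure.of_isClosed_subset
    isClosed_frontier frontier_subset_closure
  -- The part χu has zero trace on `∂D` and is extended by zero into the hole. Its support lies in a
  -- compact subset of `Ω`, so its mollifications can be chosen to vanish on `∂Ω`.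
  obtain ⟨m, hm, -, hm0⟩ := (hG.memH1_indicator hDc (h.stokes.memH1 i)
    (h.values_hole i)).exists_isH1Limit_univ (K := tsupport χ) (W := Ω) hχc h.hole.isOpen hχs
    (fun x hx => by
      rw [indicator_apply_eq_zero]; intro _
      rw [image_eq_zero_of_notMem_tsupport hx, zero_mul])
  -- The complementary part (1 - χ)u vanishes near `closure D`, so the approximants adapted to `∂Ω`
  -- extend without any trace condition on `∂D`.
  have h1 := hφ.indicator hUo hUb hΩm sdiff_subset hχ' fun x hx => by
    have hxD : x ∈ closure D := by
      by_contra hc; exact hx.2 ⟨hx.1, hc⟩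
    filter_upwards [hχ1.filter_mono (nhds_le_nhdsSet hxD)] with y hy
    simp [hy]
  refine ⟨_, ((h1.add (hm.mono (subset_univ _))).sub hθ hΩm hΩb).congr
    (Eventually.of_forall fun x => ?_) (fun j => Eventually.of_forall fun x => ?_), ?_⟩
  · by_cases hx : x ∈ Ω \ closure D
    · simp only [indicator_of_mem hx]; ring
    · simp only [indicator_of_notMem hx]; ring
  · by_cases hx : x ∈ Ω \ closure D
    · simp only [gradDiff, indicator_of_mem hx, partialDeriv_one_sub, Matrix.sub_apply]; ring
    · simp [gradDiff, indicator_of_notMem hx, Matrix.sub_apply]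
  · refine (hφg.sub_self hθg (fun k => (hφ.contDiff k).continuous)
      (fun k => (hθ.contDiff k).continuous) (h.values i).memLp_trace).of_eqOn
      isClosed_frontier.measurableSet (fun k x hx => ?_) fun _ _ => rfl
    simp [hχ0.self_of_nhdsSet x hx, hm0 k x fun hxΩ => h.hole.notMem_frontier hxΩ hx]

/-- The claim for the duality pairings. -/
lemma energy_estimate (h : IsHolePair Ω D g u₀ u Du₀ Du p₀ p) {W₀ W B : ℝ}
    (hW₀ : IsTractionPairing Ω (frontier Ω) (stress Du₀ p₀) u₀ Du₀ W₀)
    (hW : IsTractionPairing (Ω \ closure D) (frontier Ω) (stress Du p) u Du W)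
    (hB : IsTractionPairing (Ω \ closure D) (frontier D) (stress Du p) u₀ Du₀ (-B)) :
    ∫ x in D, ∑ i, ∑ j, (Du₀ x i j) ^ 2 ≤ W - W₀ ∧ W - W₀ = B := by
  set U := Ω \ closure D
  have hUΩ : U ⊆ Ω := sdiff_subset
  have hUm : MeasurableSet U := h.hole.isOpen_diff.measurableSet
  have hΩo := h.hole.isOpen
  have hΩb := h.hole.isBounded
  have eW₀ := h.pairing₀_eq hW₀
  have eW := h.pairing_eq hW
  have eB := h.pairing_hole_eq hB
  have hL₀ := h.stokes₀.matrixMemL2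
  have hL := h.stokes.matrixMemL2
  have hL₀U := hL₀.mono hUΩ
  have htr₀ : ∀ᵐ x ∂volume.restrict U, (Du₀ x).trace = 0 :=
    ae_restrict_of_ae_restrict_of_subset hUΩ h.stokes₀.div_free
  rw [h.stokes₀.integral_frobProd_stress_self Subset.rfl h.stokes₀.div_free hL₀] at eW₀
  rw [h.stokes.integral_frobProd_stress_self Subset.rfl h.stokes.div_free hL] at eW eB
  rw [h.stokes.integral_frobProd_stress_self Subset.rfl htr₀ hL₀U] at eB
  choose φ hφ hφ0 using h.exists_isH1Limit_sub
  set E := gradDiff Ω D Du₀ Du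
  set F : Space n → Matrix (Fin (n + 1)) (Fin (n + 1)) ℝ := U.indicator Du with hF
  have hFL : MatrixMemL2 Ω F := hL.indicator hUm
  have hEL : MatrixMemL2 Ω E := hFL.sub hL₀
  -- Integrals over `Ω` of quantities that vanish with the extended gradient `F` reduce to the
  -- domain with the hole.
  have hind : ∀ G : Space n → Matrix (Fin (n + 1)) (Fin (n + 1)) ℝ → ℝ, (∀ x, G x 0 = 0) →
      ∫ x in Ω, G x (F x) = ∫ x in U, G x (Du x) := fun G hG => by
    have : (fun x => G x (F x)) = U.indicator fun x => G x (Du x) := by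
      funext x
      by_cases hx : x ∈ U
      · simp only [hF, indicator_of_mem hx]
      · simp only [hF, indicator_of_notMem hx, hG]
    rw [this, setIntegral_indicator hUm, inter_eq_right.2 hUΩ]
  have hz : ∀ A : Matrix (Fin (n + 1)) (Fin (n + 1)) ℝ, frobProd A 0 = 0 := fun A => by
    simp [frobProd]
  -- The orthogonality relation: the equation of u₀ tested with the extension of `u` minus u₀.
  have hmom := h.stokes₀.integral_frobProd_eq_zero hΩo hΩb hφ hφ0
  have htrE : ∀ᵐ x ∂volume.restrict Ω, (E x).trace = 0 := by
    have h1 := (ae_restrict_iff' hUm).1 h.stokes.div_free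
    filter_upwards [h.stokes₀.div_free, ae_restrict_of_ae h1] with x hx hxU
    simp only [E, gradDiff, Matrix.trace_sub, hx, sub_zero]
    by_cases hxm : x ∈ Ω \ closure D
    · rw [indicator_of_mem hxm]; exact hxU hxm
    · rw [indicator_of_notMem hxm]; exact Matrix.trace_zero _ _
  have I := fun {A B : Space n → Matrix (Fin (n + 1)) (Fin (n + 1)) ℝ} (hA : MatrixMemL2 Ω A)
    (hB : MatrixMemL2 Ω B) => hA.integrable_frobProd hB
  rw [h.stokes₀.integral_frobProd_stress_self Subset.rfl htrE hEL] at hmom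
  have eE : ∀ x, E x = F x - Du₀ x := fun x => rfl
  have m1 : ∫ x in Ω, frobProd (Du₀ x) (E x)
      = (∫ x in U, frobProd (Du₀ x) (Du x)) - ∫ x in Ω, frobProd (Du₀ x) (Du₀ x) := by
    rw [← hind (fun x M => frobProd (Du₀ x) M) fun x => hz _, ← integral_sub (I hL₀ hFL) (I hL₀ hL₀)]
    simp_rw [eE, frobProd_sub_right]
  have m2 : ∫ x in Ω, frobProd (Du₀ x) (E x).transpose
      = (∫ x in U, frobProd (Du₀ x) (Du x).transpose)
        - ∫ x in Ω, frobProd (Du₀ x) (Du₀ x).transpose := by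
    rw [← hind (fun x M => frobProd (Du₀ x) M.transpose) fun x => by simp [hz],
      ← integral_sub (I hL₀ hFL.transpose) (I hL₀ hL₀.transpose)]
    simp_rw [eE, Matrix.transpose_sub, frobProd_sub_right]
  have s1 : ∫ x in U, frobProd (Du x) (Du₀ x) = ∫ x in U, frobProd (Du₀ x) (Du x) := by
    simp_rw [frobProd_comm (Du _)]
  have s2 : ∫ x in U, frobProd (Du x) (Du₀ x).transpose
      = ∫ x in U, frobProd (Du₀ x) (Du x).transpose := by
    simp_rw [← frobProd_transpose (Du _), frobProd_comm _ (Du₀ _)]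
  -- This and `q2` are the two halves of 2∫_Ω |e(w)|², expanded as squares. By orthogonality their
  -- sum is W - 2W₀ + W₀.
  have q1 : ∫ x in Ω, frobProd (E x) (E x) = (∫ x in U, frobProd (Du x) (Du x))
      - 2 * (∫ x in U, frobProd (Du₀ x) (Du x)) + ∫ x in Ω, frobProd (Du₀ x) (Du₀ x) := by
    have e1 : ∀ x, frobProd (E x) (E x)
        = frobProd (F x) (F x) - frobProd (Du₀ x) (F x) - frobProd (Du₀ x) (E x) := fun x => by
      rw [eE, frobProd_sub_right, frobProd_sub_right, frobProd_comm _ (F x),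
        frobProd_comm _ (Du₀ x), frobProd_sub_right, frobProd_sub_right, frobProd_comm (F x) (Du₀ x)]
    simp_rw [e1]
    have i1 : IntegrableOn (fun x => frobProd (F x) (F x) - frobProd (Du₀ x) (F x)) Ω :=
      (I hFL hFL).sub (I hL₀ hFL)
    rw [integral_sub i1 (I hL₀ hEL), integral_sub (I hFL hFL) (I hL₀ hFL), m1,
      hind (fun x M => frobProd (Du₀ x) M) fun x => hz _, hind (fun x M => frobProd M M) fun x => hz _]
    ring
  have q2 : ∫ x in Ω, frobProd (E x) (E x).transpose = (∫ x in U, frobProd (Du x) (Du x).transpose)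
      - 2 * (∫ x in U, frobProd (Du₀ x) (Du x).transpose)
      + ∫ x in Ω, frobProd (Du₀ x) (Du₀ x).transpose := by
    have e1 : ∀ x, frobProd (E x) (E x).transpose = frobProd (F x) (F x).transpose
        - frobProd (Du₀ x) (F x).transpose - frobProd (Du₀ x) (E x).transpose := fun x => by
      have c : ∀ A B : Matrix (Fin (n + 1)) (Fin (n + 1)) ℝ,
          frobProd A B.transpose = frobProd B A.transpose := fun A B => by
        rw [← frobProd_transpose, frobProd_comm]
      rw [eE, Matrix.transpose_sub, frobProd_sub_right, c _ (F x), c _ (Du₀ x),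
        Matrix.transpose_sub, frobProd_sub_right, frobProd_sub_right, c (F x) (Du₀ x)]
    simp_rw [e1]
    have i1 : IntegrableOn (fun x => frobProd (F x) (F x).transpose
        - frobProd (Du₀ x) (F x).transpose) Ω := (I hFL hFL.transpose).sub (I hL₀ hFL.transpose)
    rw [integral_sub i1 (I hL₀ hEL.transpose),
      integral_sub (I hFL hFL.transpose) (I hL₀ hFL.transpose), m2,
      hind (fun x M => frobProd (Du₀ x) M.transpose) fun x => by simp [hz],
      hind (fun x M => frobProd M M.transpose) fun x => by simp [hz]]
    ring
  have hkorn : 0 ≤ ∫ x in Ω, frobProd (E x) (E x).transpose :=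
    h.hole.lipschitz.integral_frobProd_transpose_nonneg hΩo hΩb (Dw := E)
      (fun i => (hφ i).memH1 hΩo hΩb) fun i => (hφ i).hasTrace hΩo hΩb (by simp) (hφ0 i)
  -- On `D` the extended field is zero, so `E` is there minus the gradient of u₀.
  have hD : ∫ x in D, ∑ i, ∑ j, (Du₀ x i j) ^ 2 ≤ ∫ x in Ω, frobProd (E x) (E x) := by
    have hDE : ∀ x ∈ D, ∑ i, ∑ j, (Du₀ x i j) ^ 2 = frobProd (E x) (E x) := fun x hx => by
      have hxU : x ∉ Ω \ closure D := fun hc => hc.2 (subset_closure hx)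
      simp [E, gradDiff, hxU, frobProd, sq]
    rw [setIntegral_congr_fun h.hole.isOpen_hole.measurableSet hDE]
    refine setIntegral_mono_set (I hEL hEL) (Eventually.of_forall fun x => ?_)
      (subset_closure.trans h.hole.closure_subset).eventuallyLE
    exact Finset.sum_nonneg fun i _ => Finset.sum_nonneg fun j _ => mul_self_nonneg _
  constructor
  · linarith
  · linarith

end IsHolePair

/-! ### Surface integrals of the traction -/

/-- A weak solution whose stress is in `H¹` satisfies the momentum equation almost everywhere. -/
lemma IsStokesSolution.sum_deriv_stress_ae_eq_zero {n : ℕ} {U : Set (Space n)}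
    {u : Space n → Space n} {Du : Space n → Matrix (Fin (n + 1)) (Fin (n + 1)) ℝ} {p : Space n → ℝ}
    (h : IsStokesSolution U u Du p) (hU : IsOpen U) (hb : Bornology.IsBounded U)
    {i : Fin (n + 1)} {Dσ : Fin (n + 1) → Fin (n + 1) → Space n → ℝ}
    (hσ : ∀ j, MemH1 U (fun x => stress Du p x i j) (Dσ j)) :
    (fun x => ∑ j, Dσ j j x) =ᵐ[volume.restrict U] 0 := by
  refine ae_eq_zero_of_forall_test hU (memLp_finsetSum _ fun j _ => (hσ j).memLp_deriv j)
    fun τ h1 h2 h3 => ?_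
  have hτ : MemLp τ 2 (volume.restrict U) :=
    (h1.continuous.memLp_of_hasCompactSupport h2).restrict U
  have := hb.isFiniteMeasure_restrict_volume
  have hτ' : ∀ j, MemLp (partialDeriv j τ) 2 (volume.restrict U) := fun j =>
    (contDiff_partialDeriv h1 j).continuous.memLp_two_of_isBounded hU.measurableSet hb
  have hτ0 : ∀ x ∈ frontier U, τ x = 0 := fun x hx =>
    image_eq_zero_of_notMem_tsupport fun hs => (hU.frontier_eq ▸ hx).2 (h3 hs)
  -- The test field has `τ` as its `i`-th component and zeros elsewhere, which isolates row `i` of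
  -- the stress.
  have hmom := h.integral_frobProd_eq_zero hU hb
    (φ := fun k _ => if k = i then τ else fun _ => 0) (w := fun k => if k = i then τ else fun _ => 0)
    (Dw := fun x => Matrix.of fun k j => if k = i then partialDeriv j τ x else 0)
    (fun k => by
      by_cases hk : k = i
      · simpa [hk] using h1.isH1Limit_const hU.measurableSet hb
      · have h0 := (contDiff_const (c := (0 : ℝ)) (E := Space n) (𝕜 := ℝ) (n := ∞)).isH1Limit_const
          hU.measurableSet hb
        have hz : ∀ j, partialDeriv j (fun _ : Space n => (0 : ℝ)) = fun _ => 0 := fun j => by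
          funext x; simp [partialDeriv]
        simpa [hk, hz] using h0)
    (fun k => by
      refine (L2Tendsto.const fun _ => 0).of_eqOn isClosed_frontier.measurableSet
        (fun _ x hx => ?_) fun _ _ => rfl
      by_cases hk : k = i
      · simp [hk, hτ0 x hx]
      · simp [hk])
  have e : ∀ x, frobProd (stress Du p x) (Matrix.of fun k j =>
      if k = i then partialDeriv j τ x else 0) = ∑ j, stress Du p x i j * partialDeriv j τ x :=
    fun x => by
      rw [frobProd, Finset.sum_eq_single i (fun k _ hk => by simp [hk]) (by simp)]
      simp
  simp_rw [e] at hmom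
  rw [integral_finsetSum _ fun j _ => (hσ j).memLp.integrable_mul_two (hτ' j)] at hmom
  simp_rw [Finset.sum_mul]
  rw [integral_finsetSum _ fun j _ => ((hσ j).memLp_deriv j).integrable_mul_two hτ]
  rw [← neg_eq_zero, ← Finset.sum_neg_distrib, ← hmom]
  exact Finset.sum_congr rfl fun j _ => ((hσ j).weak_deriv τ h1 h2 h3 j).symm

/-- If the stress is in `H¹`, then the duality pairing is the surface integral of the traces. -/
lemma IsStokesSolution.isTractionPairing_integral {n : ℕ} {U Γ : Set (Space n)}
    {u v b ν : Space n → Space n} {Du Dv T : Space n → Matrix (Fin (n + 1)) (Fin (n + 1)) ℝ}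
    {p χ : Space n → ℝ} (h : IsStokesSolution U u Du p) (hG : IsGreenPair U Γ ν χ)
    (hΓ : IsCompact Γ) (h1 : ∀ᶠ x in 𝓝ˢ Γ, χ x = 1) (h0 : ∀ᶠ x in 𝓝ˢ (frontier U \ Γ), χ x = 0)
    (hT : HasMatrixTrace U Γ (stress Du p) T)
    (hv : ∀ i, MemH1 U (fun x => v x i) (fun j x => Dv x i j)) (hvb : HasBoundaryValues U Γ v b) :
    IsTractionPairing U Γ (stress Du p) v Dv
      (∫ x, ∑ i, (∑ j, T x i j * ν x j) * b x i ∂surfaceMeasure Γ) := by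
  refine ⟨χ, hG.contDiff, h1, h0, ?_⟩
  have hUm := hG.isOpen.measurableSet
  choose Dσ hσ using fun i j => (show ∃ Df : Fin (n + 1) → Space n → ℝ,
    MemH1 U (fun x => stress Du p x i j) Df from ⟨_, (hT i j).choose_spec.1⟩)
  choose φ hφ hφT using fun i j => (hT i j).exists_isH1Limit hG.isOpen (hσ i j)
  choose ψ hψ hψb using fun i => (hvb i).exists_isH1Limit hG.isOpen (hv i)
  have hdiv := fun i => h.sum_deriv_stress_ae_eq_zero hG.isOpen hG.isBounded (hσ i)
  have hχψ := fun i => (hψ i).mul_smooth hUm hG.isBounded hG.contDiff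
  -- Green's formula for each stress entry times a component of `v`. Summed over j, the terms
  -- without derivatives of `v` or `χ` combine into the row divergence of the stress, which is zero
  -- almost everywhere.
  have key := fun i j => hG.integral_eq hΓ (hφ i j) (hψ i) (hT i j).memLp_trace
    (hvb i).memLp_trace (hφT i j) (hψb i) j
  have hνm : ∀ j, AEStronglyMeasurable (fun x => ν x j) (surfaceMeasure Γ) := fun j =>
    (by fun_prop : Continuous fun y : Space n => y j).comp_aestronglyMeasurable
      hG.aestronglyMeasurable
  have hνb : ∀ i j, MemLp (fun x => ν x j * b x i) 2 (surfaceMeasure Γ) := fun i j => by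
    refine (hvb i).memLp_trace.of_le_mul (c := 1) ((hνm j).mul (hvb i).memLp_trace.1)
      (Eventually.of_forall fun x => ?_)
    rw [norm_mul]
    gcongr
    exact (PiLp.norm_apply_le (ν x) j).trans (hG.norm_le x)
  have hI : ∀ i j, IntegrableOn (fun x => stress Du p x i j *
      (χ x * Dv x i j + partialDeriv j χ x * v x i) + Dσ i j j x * (χ x * v x i)) U := fun i j =>
    ((hσ i j).memLp.integrable_mul_two ((hχψ i).memLp_deriv j)).add
    (((hσ i j).memLp_deriv j).integrable_mul_two (hχψ i).memLp)
  have e1 : ∀ x, ∑ i, (∑ j, T x i j * ν x j) * b x i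
      = ∑ i, ∑ j, T x i j * (ν x j * b x i) := fun x => by
    simp_rw [Finset.sum_mul, mul_assoc]
  simp_rw [e1]
  rw [integral_finsetSum _ fun i _ => integrable_finsetSum _ fun j _ =>
    (hT i j).memLp_trace.integrable_mul_two (hνb i j)]
  rw [Finset.sum_congr rfl fun i _ => integral_finsetSum _ fun j _ =>
    (hT i j).memLp_trace.integrable_mul_two (hνb i j)]
  simp_rw [← key]
  rw [Finset.sum_congr rfl fun i _ => (integral_finsetSum _ fun j _ => hI i j).symm]
  rw [← integral_finsetSum _ fun i _ => integrable_finsetSum _ fun j _ => hI i j]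
  refine integral_congr_ae ?_
  filter_upwards [ae_all_iff.2 hdiv] with x hx
  refine Finset.sum_congr rfl fun i _ => ?_
  have hx' : ∑ j, Dσ i j j x = 0 := hx i
  rw [Finset.sum_add_distrib, ← Finset.sum_mul, hx', zero_mul, add_zero]
  refine Finset.sum_congr rfl fun j _ => ?_
  ring

/-- The claim for surface integrals of traces. -/
lemma IsHolePair.energy_estimate_trace {n : ℕ} {Ω D : Set (Space n)} {g u₀ u b : Space n → Space n}
    {Du₀ Du T₀ T S : Space n → Matrix (Fin (n + 1)) (Fin (n + 1)) ℝ} {p₀ p : Space n → ℝ}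
    (h : IsHolePair Ω D g u₀ u Du₀ Du p₀ p)
    (hT₀ : HasMatrixTrace Ω (frontier Ω) (stress Du₀ p₀) T₀)
    (hT : HasMatrixTrace (Ω \ closure D) (frontier Ω) (stress Du p) T)
    (hS : HasMatrixTrace (Ω \ closure D) (frontier D) (stress Du p) S)
    (hb : HasBoundaryValues (Ω \ closure D) (frontier D) u₀ b) :
    (∫ x in D, ∑ i, ∑ j, (Du₀ x i j) ^ 2)
        ≤ tractionIntegral Ω T g - tractionIntegral Ω T₀ g ∧
      tractionIntegral Ω T g - tractionIntegral Ω T₀ g = tractionIntegral D S b := by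
  have hc : ∀ {A : Set (Space n)}, Bornology.IsBounded A → IsCompact (frontier A) := fun hA =>
    hA.isCompact_closure.of_isClosed_subset isClosed_frontier frontier_subset_closure
  -- One cut-off serves both components: χ localises to `∂D` and 1 - χ to `∂Ω`.
  obtain ⟨χ, hχ, -, -, hχ1, hχ0⟩ := h.hole.exists_cutoff_hole
  replace hχ1 := hχ1.filter_mono (nhdsSet_mono frontier_subset_closure)
  have hχ1' : ∀ᶠ x in 𝓝ˢ (frontier Ω), 1 - χ x = 1 := hχ0.mono fun x hx => by simp [hx]
  have hχ0' : ∀ᶠ x in 𝓝ˢ (frontier D), 1 - χ x = 0 := hχ1.mono fun x hx => by simp [hx]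
  refine h.energy_estimate
    (h.stokes₀.isTractionPairing_integral (h.hole.lipschitz.isGreenPair h.hole.isOpen
      h.hole.isBounded) (hc h.hole.isBounded) (Eventually.of_forall fun _ => rfl) (by simp) hT₀
      h.stokes₀.memH1 h.values₀)
    (h.stokes.isTractionPairing_integral (h.hole.isGreenPair_outer (contDiff_const.sub hχ) hχ1'
      hχ0') (hc h.hole.isBounded) hχ1' (by rwa [h.hole.frontier_diff_sdiff_outer]) hT
      h.stokes.memH1 h.values) ?_
  have h1 := h.stokes.isTractionPairing_integral (h.hole.isGreenPair_inner hχ hχ1 hχ0)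
    (hc h.hole.isBounded_hole) hχ1 (by rwa [h.hole.frontier_diff_sdiff_inner]) hS
    (fun i => (h.stokes₀.memH1 i).mono sdiff_subset) hb
  -- The surface integral uses the normal exterior to `D`, the pairing its opposite; this is the
  -- sign in front of `B`.
  rw [tractionIntegral, ← integral_neg]
  simpa [Finset.sum_neg_distrib] using h1

/-- Here `d = n + 1`, `U = Ω \ closure D`. The first part is the claim for arbitrary weak solutions
in `H^1 × L²`, with the boundary integrals read as duality pairings (the exterior normal to `U` on
`∂D` is the opposite of the exterior normal to `D`, hence the sign of `B`). The second part is the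
claim with genuine surface integrals, when the stresses are in `H^1`. -/
theorem lemma3p4 (n : ℕ) (hd : n + 1 = 2 ∨ n + 1 = 3) (Ω : Set (Space n)) (ρ₀ M₀ : ℝ)
    (hΩ : IsDomainOfClass 0 1 ρ₀ M₀ Ω) (hΩ' : IsConnected (frontier Ω)) :
    ∃ C : ℝ, 0 < C ∧ ∀ D : Set (Space n), IsCavity Ω D →
      ∀ (g u₀ u : Space n → Space n)
        (Du₀ Du : Space n → Matrix (Fin (n + 1)) (Fin (n + 1)) ℝ) (p₀ p : Space n → ℝ),
        IsStokesSolution Ω u₀ Du₀ p₀ →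
        HasBoundaryValues Ω (frontier Ω) u₀ g →
        IsStokesSolution (Ω \ closure D) u Du p →
        HasBoundaryValues (Ω \ closure D) (frontier Ω) u g →
        HasBoundaryValues (Ω \ closure D) (frontier D) u (fun _ => 0) →
        (∀ W₀ W B : ℝ,
          IsTractionPairing Ω (frontier Ω) (stress Du₀ p₀) u₀ Du₀ W₀ →
          IsTractionPairing (Ω \ closure D) (frontier Ω) (stress Du p) u Du W →
          IsTractionPairing (Ω \ closure D) (frontier D) (stress Du p) u₀ Du₀ (-B) →
          (∫ x in D, ∑ i, ∑ j, (Du₀ x i j) ^ 2) ≤ C * (W - W₀) ∧ W - W₀ = B) ∧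
        (∀ (T₀ T S : Space n → Matrix (Fin (n + 1)) (Fin (n + 1)) ℝ) (h : Space n → Space n),
          HasMatrixTrace Ω (frontier Ω) (stress Du₀ p₀) T₀ →
          HasMatrixTrace (Ω \ closure D) (frontier Ω) (stress Du p) T →
          HasMatrixTrace (Ω \ closure D) (frontier D) (stress Du p) S →
          HasBoundaryValues (Ω \ closure D) (frontier D) u₀ h →
          (∫ x in D, ∑ i, ∑ j, (Du₀ x i j) ^ 2)
            ≤ C * (tractionIntegral Ω T g - tractionIntegral Ω T₀ g) ∧
          tractionIntegral Ω T g - tractionIntegral Ω T₀ g = tractionIntegral D S h) := by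
  -- Korn's inequality for zero trace has the form ∫|∇w|² ≤ 2∫|e(w)|², so the constant 1 works for
  -- every `Ω`.
  refine ⟨1, one_pos, fun D hD g u₀ u Du₀ Du p₀ p h₀ hg₀ h hg hgD => ?_⟩
  have hP : IsHolePair Ω D g u₀ u Du₀ Du p₀ p := ⟨hD.isLipschitzHole hΩ, h₀, hg₀, h, hg, hgD⟩
  simp only [one_mul]
  exact ⟨fun W₀ W B hW₀ hW hB => hP.energy_estimate hW₀ hW hB,
    fun T₀ T S b hT₀ hT hS hb => hP.energy_estimate_trace hT₀ hT hS hb⟩
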